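/- Let $n\ge 1$ and let $(M^n,g)$ be a smooth Riemannian manifold with (possibly empty) smooth boundary which is locally convex, i.e. the second fundamental form of $\partial M$ with respect to the inner unit normal is $\ge 0$. On the Riemannian product $M\times\mathbb R$, with vertical unit field $\xi=(0,1)$, consider a product weight $e^{\psi(p,t)}=e^{h(p)}e^{v(t)}$ with $h\in C^\infty(M)$, $v\in C^\infty(\mathbb R)$. For a weight $e^f$ write $\mathrm{Ric}_f=\mathrm{Ric}-\nabla^2 f$ (the Bakry–Émery–Ricci tensor), and suppose that there is $c\in\mathbb R$ with $\mathrm{Ric}_v\le c\le \mathrm{Ric}_h$, i.e. $\mathrm{Ric}_v(w,w)\le c|w|^2$ for all tangent vectors $w$ of $\mathbb R$ and $\mathrm{Ric}_h(w,w)\ge c|w|^2$ for all tangent vectors $w$ of $M$. Let $\Sigma$ be a connected two-sided smooth (immersed) hypersurface, possibly with boundary, in $M\times\mathbb R$, with smooth unit normal $N$ and angle function $\theta=\langle\xi,N\rangle$, such that: - $\Sigma$ is a horizontal multigraph: $\theta\le 0$ on $\Sigma$; - $\Sigma$ is $\psi$-parabolic: for the induced metric, every $u\in C^2(\Sigma)$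 that is bounded from above and satisfies $\Delta_{\Sigma,\psi}u=\Delta_\Sigma u+\langle\nabla_\Sigma\psi,\nabla_\Sigma u\rangle\ge 0$ on $\Sigma\setminus\partial\Sigma$ and $\partial u/\partial\nu\ge 0$ along $\partial\Sigma$ is constant, where $\nu$ is the inner unit normal of $\partial\Sigma$ in $\Sigma$; - $\Sigma$ has constant $\psi$-mean curvature: $H_\psi=-(\mathrm{div}_\Sigma N+\langle\nabla\psi,N\rangle)$ is constant on $\Sigma$; - $\Sigma$ has free boundary in $\partial M\times\mathbb R$: if $\partial\Sigma\ne\emptyset$, then $\partial\Sigma=\Sigma\cap(\partial M\times\mathbb R)$ and $\Sigma$ is orthogonal to $\partial M\times\mathbb R$ along $\partial\Sigma$. Then $\theta$ is constant, and at least one of the following holds: (i) $\Sigma$ is a vertical cylinder, i.e. $\theta=0$ on $\Sigma$; (ii) $\Sigma$ is contained in a horizontal slice $M\times\{s\}$ for some $s\in\mathbb R$; (iii) $\Sigma$ is totally geodesic, $\mathrm{Ric}_\psi(N,N)=\mathrm{Ric}_\psi(\xi,\xi)=c$ on $\Sigma$, and $\mathrm{II}(N,N)=0$ along $\partial\Sigma$,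 where $\mathrm{II}$ is the second fundamental form of $\partial M\times\mathbb R$ with respect to the inner unit normal. -/

import Mathlib

open scoped Manifold ContDiff Topology

noncomputable section

namespace WeightedGeom

/-! ### Riemannian geometry in an open piece of a vector space

`G : E → E →L[ℝ] E →L[ℝ] ℝ` is a metric given in coordinates and `s` the set on which all
derivatives are taken (the range of a chart model: the whole space or a half-space). -/

section Coordinates

variable {E : Type*} [NormedAddCommGroup E] [NormedSpace ℝ E]

/-- Cyclic permutation of the arguments of a trilinear form: `(u, v, w) ↦ D (w, u, v)`. -/
def cycleForm (D : E →L[ℝ] E →L[ℝ] E →L[ℝ] ℝ) : E →L[ℝ] E →L[ℝ] E →L[ℝ] ℝ :=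
  ContinuousLinearMap.comp
    ((ContinuousLinearMap.flipₗᵢ ℝ E E ℝ).toContinuousLinearEquiv.toContinuousLinearMap) D.flip

/-- Christoffel symbols of the first kind:
`Γ♭(u, v, w) = (∂_u G (v, w) + ∂_v G (u, w) - ∂_w G (u, v)) / 2`. -/
def christoffelLow (G : E → E →L[ℝ] E →L[ℝ] ℝ) (s : Set E) (y : E) : E →L[ℝ] E →L[ℝ] E →L[ℝ] ℝ :=
  (1 / 2 : ℝ) • (fderivWithin ℝ G s y + (fderivWithin ℝ G s y).flip
    + (-1 : ℝ) • cycleForm (fderivWithin ℝ G s y))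

theorem christoffelLow_apply (G : E → E →L[ℝ] E →L[ℝ] ℝ) (s : Set E) (y u v w : E) :
    christoffelLow G s y u v w = (1 / 2 : ℝ) * (fderivWithin ℝ G s y u v w
      + fderivWithin ℝ G s y v u w - fderivWithin ℝ G s y w u v) := by
  have : christoffelLow G s y u v w = (1 / 2 : ℝ) * (fderivWithin ℝ G s y u v w
      + fderivWithin ℝ G s y v u w + (-1 : ℝ) * fderivWithin ℝ G s y w u v) := rfl
  rw [this]
  ring

/-- Christoffel symbols of the Levi-Civita connection: `G (Γ(u, v), w) = Γ♭(u, v, w)`, so that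
`D_u V = ∂_u V + Γ(u, V)` for a vector field `V` in coordinates. -/
def christoffel (G : E → E →L[ℝ] E →L[ℝ] ℝ) (s : Set E) (y : E) : E →L[ℝ] E →L[ℝ] E :=
  (ContinuousLinearMap.compL ℝ E (E →L[ℝ] ℝ) E (G y).inverse) ∘L christoffelLow G s y

theorem christoffel_apply (G : E → E →L[ℝ] E →L[ℝ] ℝ) (s : Set E) (y u v : E) :
    christoffel G s y u v = (G y).inverse (christoffelLow G s y u v) := rfl

/-- The endomorphism `u ↦ R(u, v) w`, where `R(u, v) w = D_u D_v w - D_v D_u w` for constant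
coordinate fields `u`, `v`, `w`. -/
def curvatureEnd (G : E → E →L[ℝ] E →L[ℝ] ℝ) (s : Set E) (y v w : E) : E →L[ℝ] E :=
  ((fderivWithin ℝ (christoffel G s) s y).flip v).flip w
    - (fderivWithin ℝ (christoffel G s) s y v).flip w
    + (christoffel G s y).flip (christoffel G s y v w)
    - (christoffel G s y v) ∘L (christoffel G s y).flip w

theorem curvatureEnd_apply (G : E → E →L[ℝ] E →L[ℝ] ℝ) (s : Set E) (y u v w : E) :
    curvatureEnd G s y v w u =
      fderivWithin ℝ (christoffel G s) s y u v w - fderivWithin ℝ (christoffel G s) s y v u w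
        + christoffel G s y u (christoffel G s y v w)
        - christoffel G s y v (christoffel G s y u w) := rfl

/-- The Ricci tensor `Ric(v, w) = trace (u ↦ R(u, v) w)`. -/
def coordRicci (G : E → E →L[ℝ] E →L[ℝ] ℝ) (s : Set E) (y v w : E) : ℝ :=
  LinearMap.trace ℝ E (curvatureEnd G s y v w).toLinearMap

/-- The Hessian `∇²f(v, w) = ∂_v ∂_w f - df(Γ(v, w))`. -/
def coordHessian (G : E → E →L[ℝ] E →L[ℝ] ℝ) (s : Set E) (f : E → ℝ) (y v w : E) : ℝ :=
  fderivWithin ℝ (fderivWithin ℝ f s) s y v w - fderivWithin ℝ f s y (christoffel G s y v w)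

/-- The gradient: `G (∇f, w) = df(w)`. -/
def coordGrad (G : E → E →L[ℝ] E →L[ℝ] ℝ) (s : Set E) (f : E → ℝ) (y : E) : E :=
  (G y).inverse (fderivWithin ℝ f s y)

/-- The divergence `div X = trace (u ↦ D_u X)`. -/
def coordDiv (G : E → E →L[ℝ] E →L[ℝ] ℝ) (s : Set E) (X : E → E) (y : E) : ℝ :=
  LinearMap.trace ℝ E
    (fderivWithin ℝ X s y + (christoffel G s y).flip (X y)).toLinearMap

end Coordinates

/-! ### Riemannian manifolds with boundary

Tensors at `x` are computed in the preferred chart at `x`, through which Mathlib identifies the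
tangent space at `x` with the model vector space. -/

section Manifold

variable {E : Type*} [NormedAddCommGroup E] [NormedSpace ℝ E]
  {H : Type*} [TopologicalSpace H] (I : ModelWithCorners ℝ E H)
  {M : Type*} [TopologicalSpace M] [ChartedSpace H M]

variable (M) in
/-- Fields of bilinear forms on the tangent spaces (Riemannian metrics are among them). -/
abbrev BilinField := ∀ x : M, TangentSpace I x →L[ℝ] TangentSpace I x →L[ℝ] ℝ

variable {I}

/-- The pull-back of a bilinear form by a linear map: `(u, v) ↦ B (A u, A v)`. -/
def pullForm {V W : Type*} [AddCommGroup V] [Module ℝ V] [TopologicalSpace V]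
    [IsTopologicalAddGroup V] [ContinuousSMul ℝ V]
    [AddCommGroup W] [Module ℝ W] [TopologicalSpace W]
    [IsTopologicalAddGroup W] [ContinuousSMul ℝ W]
    (B : W →L[ℝ] W →L[ℝ] ℝ) (A : V →L[ℝ] W) : V →L[ℝ] V →L[ℝ] ℝ :=
  (ContinuousLinearMap.precomp ℝ A) ∘L B ∘L A

theorem pullForm_apply {V W : Type*} [AddCommGroup V] [Module ℝ V] [TopologicalSpace V]
    [IsTopologicalAddGroup V] [ContinuousSMul ℝ V]
    [AddCommGroup W] [Module ℝ W] [TopologicalSpace W]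
    [IsTopologicalAddGroup W] [ContinuousSMul ℝ W]
    (B : W →L[ℝ] W →L[ℝ] ℝ) (A : V →L[ℝ] W) (u v : V) :
    pullForm B A u v = B (A u) (A v) := rfl

/-- The coordinate expression of `g` in the chart at `x₀`. -/
def chartForm (g : BilinField I M) (x₀ : M) (y : E) : E →L[ℝ] E →L[ℝ] ℝ :=
  pullForm (V := TangentSpace 𝓘(ℝ, E) y) (g ((extChartAt I x₀).symm y))
    (mfderivWithin 𝓘(ℝ, E) I (extChartAt I x₀).symm (Set.range I) y)

theorem chartForm_apply (g : BilinField I M) (x₀ : M) (y u v : E) :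
    chartForm g x₀ y u v = g ((extChartAt I x₀).symm y)
      (mfderivWithin 𝓘(ℝ, E) I (extChartAt I x₀).symm (Set.range I) y u)
      (mfderivWithin 𝓘(ℝ, E) I (extChartAt I x₀).symm (Set.range I) y v) := rfl

/-- The coordinate expression of a function in the chart at `x₀`. -/
def chartFun (I : ModelWithCorners ℝ E H) (f : M → ℝ) (x₀ : M) (y : E) : ℝ :=
  f ((extChartAt I x₀).symm y)

/-- The Christoffel symbols at `x` in the chart at `x`. -/
def christoffelAt (g : BilinField I M) (x : M) :
    TangentSpace I x →L[ℝ] TangentSpace I x →L[ℝ] TangentSpace I x :=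
  (christoffel (chartForm g x) (Set.range I) (extChartAt I x x) : E →L[ℝ] E →L[ℝ] E)

/-- The Ricci tensor of `g`. -/
def ricci (g : BilinField I M) (x : M) (v w : TangentSpace I x) : ℝ :=
  coordRicci (chartForm g x) (Set.range I) (extChartAt I x x) v w

/-- The Hessian of `f` with respect to `g`. -/
def hessian (g : BilinField I M) (f : M → ℝ) (x : M) (v w : TangentSpace I x) : ℝ :=
  coordHessian (chartForm g x) (Set.range I) (chartFun I f x) (extChartAt I x x) v w

/-- The Bakry-Émery-Ricci tensor `Ric_ψ = Ric - ∇²ψ` for the weight `e^ψ`. -/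
def ricciBE (g : BilinField I M) (ψ : M → ℝ) (x : M) (v w : TangentSpace I x) : ℝ :=
  ricci g x v w - hessian g ψ x v w

/-- The gradient of `f` with respect to `g`. -/
def grad (g : BilinField I M) (f : M → ℝ) (x : M) : TangentSpace I x :=
  (g x).inverse (mfderiv I 𝓘(ℝ, ℝ) f x)

/-- The Laplacian `Δf = div ∇f`. -/
def laplacian (g : BilinField I M) (f : M → ℝ) (x : M) : ℝ :=
  coordDiv (chartForm g x) (Set.range I)
    (coordGrad (chartForm g x) (Set.range I) (chartFun I f x)) (extChartAt I x x)

/-- The drifted Laplacian `Δ_ψ f = Δf + ⟨∇ψ, ∇f⟩`. -/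
def driftedLaplacian (g : BilinField I M) (ψ f : M → ℝ) (x : M) : ℝ :=
  laplacian g f x + g x (grad g ψ x) (grad g f x)

/-- The model `I` has range the half-space `{y | 0 ≤ ℓ y}`, as is the case for manifolds with
(possibly empty) boundary. At a boundary point `x` of such a manifold the boundary is `{ℓ = 0}` in
the chart at `x`, so its tangent space is `{w | ℓ w = 0}` and the vectors with `ℓ w > 0` point
inwards. -/
class HalfSpaceModel (I : ModelWithCorners ℝ E H) where
  /-- the defining linear form -/
  ℓ : E →L[ℝ] ℝ
  range_eq : Set.range I = {y | 0 ≤ ℓ y}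

/-- The linear form `ℓ` on the tangent space at `x`. -/
def bdryForm [h : HalfSpaceModel I] (x : M) : TangentSpace I x →L[ℝ] ℝ := h.ℓ

/-- The inner unit normal along the boundary: `ν = ∇ℓ / |∇ℓ|`. It is `g`-orthogonal to `{ℓ = 0}`,
and `ℓ ν > 0`. -/
def innerNormal [HalfSpaceModel I] (g : BilinField I M) (x : M) : TangentSpace I x :=
  (Real.sqrt (bdryForm x ((g x).inverse (bdryForm x))))⁻¹ • (g x).inverse (bdryForm x)

/-- The second fundamental form of the boundary with respect to the inner unit normal `ν`,
`II(u, w) = ⟨D_u V, ν⟩` for `u`, `w` tangent to the boundary, where `V` is any extension of `w`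
tangent to the boundary. With the extension that is constant in the chart, `D_u V = Γ(u, w)`. -/
def bdrySFF [HalfSpaceModel I] (g : BilinField I M) (x : M) (u w : TangentSpace I x) : ℝ :=
  g x (christoffelAt g x u w) (innerNormal g x)

/-- The boundary is locally convex: `II ≥ 0` with respect to the inner unit normal. -/
def HasLocallyConvexBoundary [HalfSpaceModel I] (g : BilinField I M) : Prop :=
  ∀ x ∈ I.boundary M, ∀ w : TangentSpace I x, bdryForm x w = 0 → 0 ≤ bdrySFF g x w w

/-- Weighted parabolicity: a `C²` function that is bounded from above, `ψ`-subharmonic in the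
interior, and satisfies `∂u/∂ν ≥ 0` along the boundary is constant. -/
def IsWeightedParabolic [HalfSpaceModel I] (g : BilinField I M) (ψ : M → ℝ) : Prop :=
  ∀ u : M → ℝ, ContMDiff I 𝓘(ℝ, ℝ) 2 u → BddAbove (Set.range u) →
    (∀ x ∈ I.interior M, 0 ≤ driftedLaplacian g ψ u x) →
    (∀ x ∈ I.boundary M, (0 : ℝ) ≤ mfderiv I 𝓘(ℝ, ℝ) u x (innerNormal g x)) →
    ∃ a : ℝ, ∀ x, u x = a

end Manifold

/-! ### Hypersurfaces

A hypersurface is a manifold `S` with boundary together with an immersion `F : S → W`; an embedded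
hypersurface is the case where `F` is the inclusion of a subset. -/

section Hypersurface

variable {E : Type*} [NormedAddCommGroup E] [NormedSpace ℝ E]
  {H : Type*} [TopologicalSpace H] {I : ModelWithCorners ℝ E H}
  {S : Type*} [TopologicalSpace S] [ChartedSpace H S]
  {E' : Type*} [NormedAddCommGroup E'] [NormedSpace ℝ E']
  {H' : Type*} [TopologicalSpace H'] {J : ModelWithCorners ℝ E' H'}
  {W : Type*} [TopologicalSpace W] [ChartedSpace H' W]

variable (I J) in
/-- A smooth immersion. -/
def IsSmoothImmersion (F : S → W) : Prop :=
  ContMDiff I J ∞ F ∧ ∀ p, Function.Injective (mfderiv I J F p)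

variable (I) in
/-- The pull-back `F^* g`; for an immersion of `S` this is the induced metric. -/
def pullback (F : S → W) (g : BilinField J W) : BilinField I S :=
  fun p => pullForm (g (F p)) (mfderiv I J F p)

variable (I) in
/-- `N` is a Gauss map: a smooth unit normal field along the hypersurface. -/
structure IsGaussMap [IsManifold J 1 W] (F : S → W) (g : BilinField J W)
    (N : ∀ p, TangentSpace J (F p)) : Prop where
  smooth : ContMDiff I J.tangent ∞ (fun p => (⟨F p, N p⟩ : TangentBundle J W))
  unit : ∀ p, g (F p) (N p) (N p) = 1
  normal : ∀ p (u : TangentSpace I p), g (F p) (N p) (mfderiv I J F p u) = 0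

/-- The coordinate expression, in the chart of `W` at `F p₀`, of a vector field along `F`. -/
def chartField (F : S → W) (X : ∀ p, TangentSpace J (F p)) (p₀ p : S) : E' :=
  mfderiv J 𝓘(ℝ, E') (extChartAt J (F p₀)) (F p) (X p)

/-- `u ↦ A u + Γ(B u, X)`: the covariant derivative in coordinates of a field with value `X` and
coordinate derivative `A` along a map with derivative `B`. -/
def coordCovDeriv (Γ : E' →L[ℝ] E' →L[ℝ] E') (A B : E →L[ℝ] E') (X : E') : E →L[ℝ] E' :=
  A + Γ.flip X ∘L B

variable (I) in
/-- The Levi-Civita covariant derivative `u ↦ D_u X = ∂_u X + Γ(dF u, X)` of a vector field `X`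
along `F`. -/
def covDerivAlong (F : S → W) (g : BilinField J W) (X : ∀ p, TangentSpace J (F p)) (p : S) :
    TangentSpace I p →L[ℝ] TangentSpace J (F p) :=
  coordCovDeriv (E := E) (E' := E') (christoffelAt g (F p))
    (mfderiv I 𝓘(ℝ, E') (chartField F X p) p) (mfderiv I J F p) (X p)

variable (I) in
/-- The second fundamental form of a hypersurface with Gauss map `N`:
`σ(u, w) = - ⟨D_u N, w⟩`. -/
def secondFF (F : S → W) (g : BilinField J W) (N : ∀ p, TangentSpace J (F p)) (p : S)
    (u w : TangentSpace I p) : ℝ :=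
  - g (F p) (covDerivAlong I F g N p u) (mfderiv I J F p w)

variable (I) in
/-- Totally geodesic: the second fundamental form vanishes. -/
def IsTotallyGeodesic (F : S → W) (g : BilinField J W) (N : ∀ p, TangentSpace J (F p)) : Prop :=
  ∀ p (u w : TangentSpace I p), secondFF I F g N p u w = 0

variable (I) in
/-- The divergence `div_Σ X`: the trace over the tangent space of the hypersurface of the
tangential part of `u ↦ D_u X`, i.e. of the endomorphism `A` with `⟨A u, w⟩ = ⟨D_u X, w⟩`. -/
def divAlong (F : S → W) (g : BilinField J W) (X : ∀ p, TangentSpace J (F p)) (p : S) : ℝ :=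
  LinearMap.trace ℝ (TangentSpace I p)
    ((pullback I F g p).inverse ∘L (ContinuousLinearMap.precomp ℝ (mfderiv I J F p))
      ∘L g (F p) ∘L covDerivAlong I F g X p).toLinearMap

variable (I) in
/-- The `ψ`-mean curvature `H_ψ = - div_{Σ,ψ} N = - (div_Σ N + ⟨∇ψ, N⟩)`. -/
def weightedMeanCurvature (F : S → W) (g : BilinField J W) (ψ : W → ℝ)
    (N : ∀ p, TangentSpace J (F p)) (p : S) : ℝ :=
  - (divAlong I F g N p + g (F p) (grad g ψ (F p)) (N p))

variable (I) in
/-- Free boundary: if `∂S` is not empty, then `∂S` is the set of points of `S` on `∂W`, and along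
`∂S` the hypersurface is orthogonal to `∂W`, i.e. the normal of `∂W` is tangent to it. -/
def HasFreeBoundary [HalfSpaceModel J] (F : S → W) (g : BilinField J W) : Prop :=
  (I.boundary S).Nonempty →
    I.boundary S = F ⁻¹' J.boundary W ∧
    ∀ p ∈ I.boundary S, ∃ u : TangentSpace I p, mfderiv I J F p u = innerNormal g (F p)

end Hypersurface

/-! ### Riemannian cylinders `M × ℝ` -/

section Cylinder

instance halfSpaceModelEuclidean (n : ℕ) [NeZero n] : HalfSpaceModel (𝓡∂ n) where
  ℓ := EuclideanSpace.proj 0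
  range_eq := range_modelWithCornersEuclideanHalfSpace n

instance halfSpaceModelProd {E : Type*} [NormedAddCommGroup E] [NormedSpace ℝ E]
    {H : Type*} [TopologicalSpace H] (I : ModelWithCorners ℝ E H) [h : HalfSpaceModel I] :
    HalfSpaceModel (I.prod 𝓘(ℝ, ℝ)) where
  ℓ := h.ℓ ∘L ContinuousLinearMap.fst ℝ E ℝ
  range_eq := by
    rw [ModelWithCorners.range_prod, h.range_eq]
    ext y
    simp

variable {E : Type*} [NormedAddCommGroup E] [NormedSpace ℝ E]
  {H : Type*} [TopologicalSpace H] {I : ModelWithCorners ℝ E H}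
  {M : Type*} [TopologicalSpace M] [ChartedSpace H M]

/-- The standard metric of the real line. -/
def lineMetric : BilinField 𝓘(ℝ, ℝ) ℝ := (riemannianMetricVectorSpace ℝ).inner

/-- The Riemannian product metric on `M × ℝ`. -/
def cylMetric (g : BilinField I M) : BilinField (I.prod 𝓘(ℝ, ℝ)) (M × ℝ) :=
  fun x => pullback (I.prod 𝓘(ℝ, ℝ)) Prod.fst g x
    + pullback (I.prod 𝓘(ℝ, ℝ)) Prod.snd lineMetric x

variable (I) in
/-- The vertical field `ξ = (0, 1)` on `M × ℝ`. -/
def vertical (x : M × ℝ) : TangentSpace (I.prod 𝓘(ℝ, ℝ)) x := ((0, 1) : E × ℝ)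

/-- The exponent of the product weight `e^{h(p)} e^{v(t)}`. -/
def prodWeight (h : M → ℝ) (v : ℝ → ℝ) (x : M × ℝ) : ℝ := h x.1 + v x.2

/-- The angle function `θ = ⟨ξ, N⟩`. -/
def angle {S : Type*} (g : BilinField I M) (F : S → M × ℝ)
    (N : ∀ p, TangentSpace (I.prod 𝓘(ℝ, ℝ)) (F p)) (p : S) : ℝ :=
  cylMetric g (F p) (vertical I (F p)) (N p)

end Cylinder

end WeightedGeom

end

open WeightedGeom

/-!
The field `ξ` is parallel and the `ψ`-mean curvature is constant, so the angle function `θ` solves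
the Jacobi equation `Δ_ψ θ = -θ q` with
`q = Ric_h(Nʰ, Nʰ) + (1 - θ²) v'' + |σ|²`, where `Nʰ` is the horizontal part of `N` and
`|Nʰ|² = 1 - θ²`. Written as
`q = (Ric_h(Nʰ, Nʰ) - c (1 - θ²)) + (1 - θ²) (c + v'') + |σ|²`, this potential is a sum of three
nonnegative terms, and `θ ≤ 0` makes `θ` subharmonic. Along `∂Σ` the free boundary condition gives
`∂θ/∂ν = -θ II(N, N)`, which is nonnegative by convexity, so parabolicity forces `θ` to be
a constant `a`. If `a ≠ 0`, all three summands of `q` and `II(N, N)` vanish: for `a² = 1` the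
height is constant, and otherwise `v'' = -c` along `Σ`, which is the equality case (iii).

The Jacobi equation is a pointwise identity between derivatives of order at most three of the chart
expressions, taken within the model half-space so that it makes sense up to the boundary.
-/

section

open Filter Set

set_option maxSynthPendingDepth 3

noncomputable section

namespace WeightedGeom

section InnerForm

variable {E : Type*} [NormedAddCommGroup E] [NormedSpace ℝ E]
  {E' : Type*} [NormedAddCommGroup E'] [NormedSpace ℝ E']

/-- A symmetric positive definite bilinear form: an inner product on `E`, unrelated to the norm
of `E`. -/
structure IsInnerForm (B : E →L[ℝ] E →L[ℝ] ℝ) : Prop where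
  symm : ∀ u v, B u v = B v u
  pos : ∀ u, u ≠ 0 → 0 < B u u

namespace IsInnerForm

variable {B : E →L[ℝ] E →L[ℝ] ℝ}

theorem eq_zero (hB : IsInnerForm B) {u : E} (hu : B u u = 0) : u = 0 := by
  by_contra hne
  exact (hB.pos u hne).ne' hu

theorem nonneg (hB : IsInnerForm B) (u : E) : 0 ≤ B u u := by
  by_cases hu : u = 0
  · simp [hu]
  · exact (hB.pos u hu).le

theorem ext (hB : IsInnerForm B) {u v : E} (huv : ∀ w, B u w = B v w) : u = v := by
  rw [← sub_eq_zero]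
  apply hB.eq_zero
  rw [map_sub B u v, sub_apply, huv, sub_self]

theorem isInvertible [FiniteDimensional ℝ E] (hB : IsInnerForm B) : B.IsInvertible := by
  have hinj : Function.Injective (B : E →ₗ[ℝ] (E →L[ℝ] ℝ)) := fun u v huv =>
    hB.ext fun w => congrArg (fun f : E →L[ℝ] ℝ => f w) huv
  have dualEquiv : (E →L[ℝ] ℝ) ≃ₗ[ℝ] Module.Dual ℝ E := LinearMap.toContinuousLinearMap.symm
  have : FiniteDimensional ℝ (E →L[ℝ] ℝ) := dualEquiv.symm.finiteDimensional
  have hdim : Module.finrank ℝ E = Module.finrank ℝ (E →L[ℝ] ℝ) := by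
    rw [dualEquiv.finrank_eq, Subspace.dual_finrank_eq]
  exact ⟨(LinearEquiv.ofInjectiveOfFinrankEq (B : E →ₗ[ℝ] (E →L[ℝ] ℝ)) hinj
    hdim).toContinuousLinearEquiv, rfl⟩

theorem apply_inverse [FiniteDimensional ℝ E] (hB : IsInnerForm B) (f : E →L[ℝ] ℝ) (w : E) :
    B (B.inverse f) w = f w := by
  rw [hB.isInvertible.self_apply_inverse]

theorem pullForm {B : E' →L[ℝ] E' →L[ℝ] ℝ} (hB : IsInnerForm B) {A : E →L[ℝ] E'}
    (hA : Function.Injective A) : IsInnerForm (pullForm B A) where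
  symm _ _ := hB.symm _ _
  pos _ hu := hB.pos _ ((map_ne_zero_iff A hA).2 hu)

end IsInnerForm

end InnerForm

section LocalMetric

variable {E : Type*} [NormedAddCommGroup E] [NormedSpace ℝ E]
  {F₁ F₂ F₃ : Type*} [NormedAddCommGroup F₁] [NormedSpace ℝ F₁]
  [NormedAddCommGroup F₂] [NormedSpace ℝ F₂] [NormedAddCommGroup F₃] [NormedSpace ℝ F₃]

theorem fderivWithin_bilin_apply {b : E → F₁ →L[ℝ] F₂ →L[ℝ] F₃} {f₁ : E → F₁} {f₂ : E → F₂}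
    {s : Set E} {y : E} (hs : UniqueDiffWithinAt ℝ s y) (hb : DifferentiableWithinAt ℝ b s y)
    (hf₁ : DifferentiableWithinAt ℝ f₁ s y) (hf₂ : DifferentiableWithinAt ℝ f₂ s y) (u : E) :
    fderivWithin ℝ (fun z => b z (f₁ z) (f₂ z)) s y u
      = fderivWithin ℝ b s y u (f₁ y) (f₂ y) + b y (fderivWithin ℝ f₁ s y u) (f₂ y)
        + b y (f₁ y) (fderivWithin ℝ f₂ s y u) := by
  rw [fderivWithin_clm_apply hs (hb.clm_apply hf₁) hf₂, fderivWithin_clm_apply hs hb hf₁]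
  simp only [add_apply, ContinuousLinearMap.comp_apply, ContinuousLinearMap.flip_apply]
  abel

/-- A set on which first derivatives are unique and second derivatives are symmetric, such as the
range of a model with corners. -/
structure IsRegion (s : Set E) : Prop where
  uniqueDiffOn : UniqueDiffOn ℝ s
  subset_closure_interior : s ⊆ closure (interior s)

theorem IsRegion.fderivWithin_fderivWithin_comm {s : Set E} (hs : IsRegion s) {y : E} (hy : y ∈ s)
    {f : E → F₁} (hf : ContDiffWithinAt ℝ 2 f s y) (u v : E) :
    fderivWithin ℝ (fderivWithin ℝ f s) s y u v = fderivWithin ℝ (fderivWithin ℝ f s) s y v u :=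
  hf.isSymmSndFDerivWithinAt (by simp) hs.uniqueDiffOn (hs.subset_closure_interior hy) hy u v

/-- `G` is, near `y` in `s`, a Riemannian metric in coordinates, of class `C²` at `y`. -/
structure IsLocalMetric (G : E → E →L[ℝ] E →L[ℝ] ℝ) (s : Set E) (y : E) : Prop where
  mem : y ∈ s
  contDiffWithinAt : ContDiffWithinAt ℝ 2 G s y
  eventually_isInnerForm : ∀ᶠ z in 𝓝[s] y, IsInnerForm (G z)

variable {G : E → E →L[ℝ] E →L[ℝ] ℝ} {s : Set E} {y : E}

theorem christoffel_congr {G₁ G₂ : E → E →L[ℝ] E →L[ℝ] ℝ} (hG : G₁ =ᶠ[𝓝[s] y] G₂) (hy : y ∈ s) :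
    christoffel G₁ s y = christoffel G₂ s y := by
  have hGy := hG.self_of_nhdsWithin hy
  unfold christoffel christoffelLow
  rw [hGy, hG.fderivWithin_eq hGy]

namespace IsLocalMetric

theorem isInnerForm (hG : IsLocalMetric G s y) : IsInnerForm (G y) :=
  hG.eventually_isInnerForm.self_of_nhdsWithin hG.mem

theorem eventually (hG : IsLocalMetric G s y) : ∀ᶠ z in 𝓝[s] y, IsLocalMetric G s z := by
  have hC2 := hG.contDiffWithinAt.eventually (by simp)
  rw [insert_eq_of_mem hG.mem] at hC2
  filter_upwards [hC2, eventually_eventually_nhdsWithin.2 hG.eventually_isInnerForm,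
    self_mem_nhdsWithin] with z hC2 hpos hz using ⟨hz, hC2, hpos⟩

theorem differentiableWithinAt (hG : IsLocalMetric G s y) : DifferentiableWithinAt ℝ G s y :=
  hG.contDiffWithinAt.differentiableWithinAt (by simp)

theorem fderivWithin_comm (hG : IsLocalMetric G s y) (hs : IsRegion s) (w u v : E) :
    fderivWithin ℝ G s y w u v = fderivWithin ℝ G s y w v u := by
  have hcomm : (fun z => G z u v) =ᶠ[𝓝[s] y] fun z => G z v u :=
    hG.eventually_isInnerForm.mono fun z hz => hz.symm u v
  have hderiv (a b : E) : fderivWithin ℝ (fun z => G z a b) s y w = fderivWithin ℝ G s y w a b := by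
    rw [fderivWithin_bilin_apply (hs.uniqueDiffOn y hG.mem) hG.differentiableWithinAt
      (differentiableWithinAt_const a) (differentiableWithinAt_const b)]
    simp
  rw [← hderiv u v, ← hderiv v u, hcomm.fderivWithin_eq (hG.isInnerForm.symm u v)]

theorem apply_christoffel [FiniteDimensional ℝ E] (hG : IsLocalMetric G s y) (u v w : E) :
    G y (christoffel G s y u v) w = christoffelLow G s y u v w := by
  rw [christoffel_apply, hG.isInnerForm.apply_inverse]

theorem christoffel_comm [FiniteDimensional ℝ E] (hG : IsLocalMetric G s y) (hs : IsRegion s)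
    (u v : E) : christoffel G s y u v = christoffel G s y v u := by
  refine hG.isInnerForm.ext fun w => ?_
  rw [hG.apply_christoffel, hG.apply_christoffel, christoffelLow_apply, christoffelLow_apply,
    hG.fderivWithin_comm hs w u v]
  ring

theorem fderivWithin_eq_christoffel [FiniteDimensional ℝ E] (hG : IsLocalMetric G s y)
    (hs : IsRegion s) (w u v : E) : fderivWithin ℝ G s y w u v
      = G y (christoffel G s y w u) v + G y u (christoffel G s y w v) := by
  rw [hG.isInnerForm.symm u, hG.apply_christoffel, hG.apply_christoffel, christoffelLow_apply,
    christoffelLow_apply, hG.fderivWithin_comm hs w v u]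
  ring

theorem contDiffWithinAt_inverse [FiniteDimensional ℝ E] (hG : IsLocalMetric G s y) :
    ContDiffWithinAt ℝ 2 (fun z => (G z).inverse) s y :=
  haveI := FiniteDimensional.complete ℝ E
  hG.isInnerForm.isInvertible.contDiffAt_map_inverse.comp_contDiffWithinAt y hG.contDiffWithinAt

theorem contDiffWithinAt_christoffelLow (hG : IsLocalMetric G s y) (hs : IsRegion s) :
    ContDiffWithinAt ℝ 1 (christoffelLow G s) s y := by
  have hD : ContDiffWithinAt ℝ 1 (fderivWithin ℝ G s) s y :=
    hG.contDiffWithinAt.fderivWithin_right hs.uniqueDiffOn (by norm_num) hG.mem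
  have hflip : ContDiffWithinAt ℝ 1 (fun z => (fderivWithin ℝ G s z).flip) s y :=
    (ContinuousLinearMap.flipₗᵢ ℝ E E (E →L[ℝ] ℝ)).toContinuousLinearEquiv.contDiff.contDiffAt
      |>.comp_contDiffWithinAt y hD
  unfold christoffelLow cycleForm
  exact ((hD.add hflip).add
    ((contDiffWithinAt_const.clm_comp hflip).const_smul (-1 : ℝ))).const_smul (1 / 2 : ℝ)

theorem contDiffWithinAt_christoffel [FiniteDimensional ℝ E] (hG : IsLocalMetric G s y)
    (hs : IsRegion s) : ContDiffWithinAt ℝ 1 (christoffel G s) s y := by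
  have hinv : ContDiffWithinAt ℝ 1
      (fun z => ContinuousLinearMap.compL ℝ E (E →L[ℝ] ℝ) E (G z).inverse) s y :=
    (ContinuousLinearMap.compL ℝ E (E →L[ℝ] ℝ) E).contDiff.contDiffAt.comp_contDiffWithinAt y
      (hG.contDiffWithinAt_inverse.of_le (by norm_num))
  exact hinv.clm_comp (hG.contDiffWithinAt_christoffelLow hs)

end IsLocalMetric

end LocalMetric

section InducedForm

variable {E : Type*} [NormedAddCommGroup E] [NormedSpace ℝ E]
  {E' : Type*} [NormedAddCommGroup E'] [NormedSpace ℝ E']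

/-- `φ` is, near `y`, a map from the region `s` to the region `s'`, of class `C³` at `y`. -/
structure IsLocalMap (φ : E → E') (s : Set E) (s' : Set E') (y : E) : Prop where
  mem : y ∈ s
  contDiffWithinAt : ContDiffWithinAt ℝ 3 φ s y
  eventually_mapsTo : ∀ᶠ z in 𝓝[s] y, φ z ∈ s'

/-- The coordinate expression of the pull-back `φ^* G'`, i.e. of the metric induced by `φ`. -/
def inducedForm (G' : E' → E' →L[ℝ] E' →L[ℝ] ℝ) (φ : E → E') (s : Set E) (y : E) :
    E →L[ℝ] E →L[ℝ] ℝ :=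
  pullForm (G' (φ y)) (fderivWithin ℝ φ s y)

/-- The Hessian `D_u (dφ(w)) = ∂_u ∂_w φ + Γ'(∂_u φ, ∂_w φ)` of a map `φ` for the flat connection
of `E` and the Levi-Civita connection of `G'`. -/
def mapHessian (G' : E' → E' →L[ℝ] E' →L[ℝ] ℝ) (φ : E → E') (s : Set E) (s' : Set E')
    (y u w : E) : E' :=
  fderivWithin ℝ (fderivWithin ℝ φ s) s y u w
    + christoffel G' s' (φ y) (fderivWithin ℝ φ s y u) (fderivWithin ℝ φ s y w)

variable {G' : E' → E' →L[ℝ] E' →L[ℝ] ℝ} {φ : E → E'} {s : Set E} {s' : Set E'} {y : E}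

theorem inducedForm_apply (u v : E) : inducedForm G' φ s y u v
    = G' (φ y) (fderivWithin ℝ φ s y u) (fderivWithin ℝ φ s y v) := rfl

namespace IsLocalMap

theorem eventually (hφ : IsLocalMap φ s s' y) : ∀ᶠ z in 𝓝[s] y, IsLocalMap φ s s' z := by
  have hC3 := hφ.contDiffWithinAt.eventually (by simp)
  rw [insert_eq_of_mem hφ.mem] at hC3
  filter_upwards [hC3, eventually_eventually_nhdsWithin.2 hφ.eventually_mapsTo,
    self_mem_nhdsWithin] with z hC3 hmaps hz using ⟨hz, hC3, hmaps⟩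

theorem map_mem (hφ : IsLocalMap φ s s' y) : φ y ∈ s' :=
  hφ.eventually_mapsTo.self_of_nhdsWithin hφ.mem

theorem tendsto (hφ : IsLocalMap φ s s' y) : Tendsto φ (𝓝[s] y) (𝓝[s'] (φ y)) :=
  tendsto_nhdsWithin_iff.2 ⟨hφ.contDiffWithinAt.continuousWithinAt, hφ.eventually_mapsTo⟩

theorem hasFDerivWithinAt (hφ : IsLocalMap φ s s' y) :
    HasFDerivWithinAt φ (fderivWithin ℝ φ s y) s y :=
  (hφ.contDiffWithinAt.differentiableWithinAt (by simp)).hasFDerivWithinAt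

theorem contDiffWithinAt_fderivWithin (hφ : IsLocalMap φ s s' y) (hs : IsRegion s) :
    ContDiffWithinAt ℝ 2 (fderivWithin ℝ φ s) s y :=
  hφ.contDiffWithinAt.fderivWithin_right hs.uniqueDiffOn (by norm_num) hφ.mem

theorem differentiableWithinAt_fderivWithin (hφ : IsLocalMap φ s s' y) (hs : IsRegion s) :
    DifferentiableWithinAt ℝ (fderivWithin ℝ φ s) s y :=
  (hφ.contDiffWithinAt_fderivWithin hs).differentiableWithinAt (by simp)

theorem comp_contDiffWithinAt {F : Type*} [NormedAddCommGroup F] [NormedSpace ℝ F]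
    (hφ : IsLocalMap φ s s' y) {f : E' → F} {n : ℕ∞ω} (hn : n ≤ 3)
    (hf : ContDiffWithinAt ℝ n f s' (φ y)) : ContDiffWithinAt ℝ n (fun z => f (φ z)) s y :=
  hf.comp_of_preimage_mem_nhdsWithin y (hφ.contDiffWithinAt.of_le hn) hφ.eventually_mapsTo

theorem comp_hasFDerivWithinAt {F : Type*} [NormedAddCommGroup F] [NormedSpace ℝ F]
    (hφ : IsLocalMap φ s s' y) {f : E' → F} (hf : DifferentiableWithinAt ℝ f s' (φ y)) :
    HasFDerivWithinAt (fun z => f (φ z))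
      ((fderivWithin ℝ f s' (φ y)).comp (fderivWithin ℝ φ s y)) s y :=
  hf.hasFDerivWithinAt.comp_of_tendsto y hφ.hasFDerivWithinAt hφ.tendsto

theorem fderivWithin_comp_apply {F : Type*} [NormedAddCommGroup F] [NormedSpace ℝ F]
    (hφ : IsLocalMap φ s s' y) (hs : IsRegion s) {f : E' → F}
    (hf : DifferentiableWithinAt ℝ f s' (φ y)) (u : E) :
    fderivWithin ℝ (fun z => f (φ z)) s y u
      = fderivWithin ℝ f s' (φ y) (fderivWithin ℝ φ s y u) := by
  rw [(hφ.comp_hasFDerivWithinAt hf).fderivWithin (hs.uniqueDiffOn y hφ.mem)]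
  rfl

theorem contDiffWithinAt_inducedForm (hφ : IsLocalMap φ s s' y) (hs : IsRegion s)
    (hG : IsLocalMetric G' s' (φ y)) : ContDiffWithinAt ℝ 2 (inducedForm G' φ s) s y := by
  have hDφ := hφ.contDiffWithinAt_fderivWithin hs
  have hprecomp : ContDiffWithinAt ℝ 2
      (fun z => ContinuousLinearMap.precomp ℝ (fderivWithin ℝ φ s z)) s y :=
    (ContinuousLinearMap.compL ℝ E E' ℝ).flip.contDiff.contDiffAt.comp_contDiffWithinAt y hDφ
  exact hprecomp.clm_comp
    ((hφ.comp_contDiffWithinAt (by norm_num) hG.contDiffWithinAt).clm_comp hDφ)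

theorem isLocalMetric_inducedForm (hφ : IsLocalMap φ s s' y) (hs : IsRegion s)
    (hG : IsLocalMetric G' s' (φ y))
    (hinj : ∀ᶠ z in 𝓝[s] y, Function.Injective (fderivWithin ℝ φ s z)) :
    IsLocalMetric (inducedForm G' φ s) s y where
  mem := hφ.mem
  contDiffWithinAt := hφ.contDiffWithinAt_inducedForm hs hG
  eventually_isInnerForm := by
    filter_upwards [hφ.tendsto.eventually hG.eventually_isInnerForm, hinj]
      with z hpos hinj using hpos.pullForm hinj

theorem fderivWithin_inducedForm (hφ : IsLocalMap φ s s' y) (hs : IsRegion s)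
    (hG : IsLocalMetric G' s' (φ y)) (w u v : E) :
    fderivWithin ℝ (inducedForm G' φ s) s y w u v
      = fderivWithin ℝ G' s' (φ y) (fderivWithin ℝ φ s y w) (fderivWithin ℝ φ s y u)
          (fderivWithin ℝ φ s y v)
        + G' (φ y) (fderivWithin ℝ (fderivWithin ℝ φ s) s y w u) (fderivWithin ℝ φ s y v)
        + G' (φ y) (fderivWithin ℝ φ s y u) (fderivWithin ℝ (fderivWithin ℝ φ s) s y w v) := by
  have hy := hs.uniqueDiffOn y hφ.mem
  have hind := (hφ.contDiffWithinAt_inducedForm hs hG).differentiableWithinAt (by simp)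
  have hDφ := hφ.differentiableWithinAt_fderivWithin hs
  have hDφ_apply (a : E) : DifferentiableWithinAt ℝ (fun z => fderivWithin ℝ φ s z a) s y :=
    hDφ.clm_apply (differentiableWithinAt_const a)
  have hD2φ (a b : E) : fderivWithin ℝ (fun z => fderivWithin ℝ φ s z b) s y a
      = fderivWithin ℝ (fderivWithin ℝ φ s) s y a b := by
    simp [fderivWithin_clm_apply hy hDφ (differentiableWithinAt_const b)]
  calc fderivWithin ℝ (inducedForm G' φ s) s y w u v
      = fderivWithin ℝ (fun z => inducedForm G' φ s z u v) s y w := by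
        rw [fderivWithin_bilin_apply hy hind (differentiableWithinAt_const u)
          (differentiableWithinAt_const v)]
        simp
    _ = fderivWithin ℝ
          (fun z => G' (φ z) (fderivWithin ℝ φ s z u) (fderivWithin ℝ φ s z v)) s y w := rfl
    _ = _ := by
        rw [fderivWithin_bilin_apply hy
          (hφ.comp_hasFDerivWithinAt hG.differentiableWithinAt).differentiableWithinAt
          (hDφ_apply u) (hDφ_apply v), hφ.fderivWithin_comp_apply hs hG.differentiableWithinAt,
          hD2φ, hD2φ]

/-- This is the tangential part of the Gauss formula when `φ` is an immersion, and the
transformation rule of the Christoffel symbols when `φ` is a change of coordinates. -/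
theorem christoffelLow_inducedForm [FiniteDimensional ℝ E'] (hφ : IsLocalMap φ s s' y)
    (hs : IsRegion s) (hG : IsLocalMetric G' s' (φ y)) (u v w : E) :
    christoffelLow (inducedForm G' φ s) s y u v w
      = G' (φ y) (mapHessian G' φ s s' y u v) (fderivWithin ℝ φ s y w) := by
  have hD2φ_comm (a b : E) : fderivWithin ℝ (fderivWithin ℝ φ s) s y a b
      = fderivWithin ℝ (fderivWithin ℝ φ s) s y b a :=
    hs.fderivWithin_fderivWithin_comm hφ.mem (hφ.contDiffWithinAt.of_le (by norm_num)) a b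
  rw [mapHessian, map_add, add_apply, hG.apply_christoffel, christoffelLow_apply,
    christoffelLow_apply]
  simp only [hφ.fderivWithin_inducedForm hs hG]
  rw [hD2φ_comm w u, hD2φ_comm w v, hD2φ_comm v u,
    hG.isInnerForm.symm (fderivWithin ℝ φ s y v), hG.isInnerForm.symm (fderivWithin ℝ φ s y u)]
  ring

theorem mapHessian_comm [FiniteDimensional ℝ E'] (hφ : IsLocalMap φ s s' y) (hs : IsRegion s)
    (hs' : IsRegion s') (hG : IsLocalMetric G' s' (φ y)) (u v : E) :
    mapHessian G' φ s s' y u v = mapHessian G' φ s s' y v u := by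
  rw [mapHessian, mapHessian, hG.christoffel_comm hs',
    hs.fderivWithin_fderivWithin_comm hφ.mem (hφ.contDiffWithinAt.of_le (by norm_num))]

end IsLocalMap

end InducedForm

section FieldAlongMap

variable {E : Type*} [NormedAddCommGroup E] [NormedSpace ℝ E]
  {E' : Type*} [NormedAddCommGroup E'] [NormedSpace ℝ E']

/-- The covariant derivative `u ↦ D_u X` of a field `X` along a map `φ` of regions. -/
def localCovDeriv (G' : E' → E' →L[ℝ] E' →L[ℝ] ℝ) (φ X : E → E') (s : Set E) (s' : Set E')
    (z : E) : E →L[ℝ] E' :=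
  coordCovDeriv (christoffel G' s' (φ z)) (fderivWithin ℝ X s z) (fderivWithin ℝ φ s z) (X z)

variable {G' : E' → E' →L[ℝ] E' →L[ℝ] ℝ} {φ : E → E'} {s : Set E} {s' : Set E'} {y : E}

theorem localCovDeriv_apply (X : E → E') (z u : E) : localCovDeriv G' φ X s s' z u
    = fderivWithin ℝ X s z u + christoffel G' s' (φ z) (fderivWithin ℝ φ s z u) (X z) := rfl

theorem localCovDeriv_congr {X Y : E → E'} (hXY : X =ᶠ[𝓝[s] y] Y) (hy : y ∈ s) :
    localCovDeriv G' φ X s s' y = localCovDeriv G' φ Y s s' y := by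
  unfold localCovDeriv
  rw [hXY.fderivWithin_eq (hXY.self_of_nhdsWithin hy), hXY.self_of_nhdsWithin hy]

theorem localCovDeriv_neg (hs : IsRegion s) (hy : y ∈ s) (X : E → E') :
    localCovDeriv G' φ (fun z => -X z) s s' y = -localCovDeriv G' φ X s s' y := by
  ext u
  simp only [localCovDeriv_apply, neg_apply, fderivWithin_fun_neg (hs.uniqueDiffOn y hy), map_neg]
  abel

theorem localCovDeriv_const (ξ : E') (u : E) : localCovDeriv G' φ (fun _ => ξ) s s' y u
    = christoffel G' s' (φ y) (fderivWithin ℝ φ s y u) ξ := by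
  simp [localCovDeriv_apply]

theorem localCovDeriv_add (hs : IsRegion s) (hy : y ∈ s) {X Y : E → E'}
    (hX : DifferentiableWithinAt ℝ X s y) (hY : DifferentiableWithinAt ℝ Y s y) :
    localCovDeriv G' φ (fun z => X z + Y z) s s' y
      = localCovDeriv G' φ X s s' y + localCovDeriv G' φ Y s s' y := by
  ext u
  simp only [localCovDeriv_apply, add_apply, fderivWithin_fun_add (hs.uniqueDiffOn y hy) hX hY,
    map_add]
  abel

theorem localCovDeriv_smul_apply (hs : IsRegion s) (hy : y ∈ s) {f : E → ℝ} {X : E → E'}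
    (hf : DifferentiableWithinAt ℝ f s y) (hX : DifferentiableWithinAt ℝ X s y) (u : E) :
    localCovDeriv G' φ (fun z => f z • X z) s s' y u
      = fderivWithin ℝ f s y u • X y + f y • localCovDeriv G' φ X s s' y u := by
  simp only [localCovDeriv_apply, fderivWithin_fun_smul (hs.uniqueDiffOn y hy) hf hX, map_smul,
    add_apply, smul_apply, ContinuousLinearMap.smulRight_apply]
  module

namespace IsLocalMap

theorem localCovDeriv_fderivWithin_apply (hφ : IsLocalMap φ s s' y) (hs : IsRegion s)
    {V : E → E} (hV : DifferentiableWithinAt ℝ V s y) (u : E) :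
    localCovDeriv G' φ (fun z => fderivWithin ℝ φ s z (V z)) s s' y u
      = mapHessian G' φ s s' y u (V y) + fderivWithin ℝ φ s y (fderivWithin ℝ V s y u) := by
  rw [localCovDeriv_apply, mapHessian, fderivWithin_clm_apply (hs.uniqueDiffOn y hφ.mem)
    (hφ.differentiableWithinAt_fderivWithin hs) hV]
  simp only [add_apply, ContinuousLinearMap.comp_apply, ContinuousLinearMap.flip_apply]
  abel

theorem contDiffWithinAt_christoffel [FiniteDimensional ℝ E'] (hφ : IsLocalMap φ s s' y)
    (hs' : IsRegion s') (hG : IsLocalMetric G' s' (φ y)) :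
    ContDiffWithinAt ℝ 1 (fun z => christoffel G' s' (φ z)) s y :=
  hφ.comp_contDiffWithinAt (by norm_num) (hG.contDiffWithinAt_christoffel hs')

theorem contDiffWithinAt_localCovDeriv [FiniteDimensional ℝ E'] (hφ : IsLocalMap φ s s' y)
    (hs : IsRegion s) (hs' : IsRegion s') (hG : IsLocalMetric G' s' (φ y)) {X : E → E'}
    (hX : ContDiffWithinAt ℝ 2 X s y) : ContDiffWithinAt ℝ 1 (localCovDeriv G' φ X s s') s y := by
  have hflip : ContDiffWithinAt ℝ 1 (fun z => (christoffel G' s' (φ z)).flip) s y :=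
    (ContinuousLinearMap.flipₗᵢ ℝ E' E' E').toContinuousLinearEquiv.contDiff.contDiffAt
      |>.comp_contDiffWithinAt y (hφ.contDiffWithinAt_christoffel hs' hG)
  exact (hX.fderivWithin_right hs.uniqueDiffOn (by norm_num) hφ.mem).add
    ((hflip.clm_apply (hX.of_le (by norm_num))).clm_comp
      ((hφ.contDiffWithinAt_fderivWithin hs).of_le (by norm_num)))

theorem fderivWithin_metric_apply [FiniteDimensional ℝ E'] (hφ : IsLocalMap φ s s' y)
    (hs : IsRegion s) (hs' : IsRegion s') (hG : IsLocalMetric G' s' (φ y)) {X Y : E → E'}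
    (hX : DifferentiableWithinAt ℝ X s y) (hY : DifferentiableWithinAt ℝ Y s y) (u : E) :
    fderivWithin ℝ (fun z => G' (φ z) (X z) (Y z)) s y u
      = G' (φ y) (localCovDeriv G' φ X s s' y u) (Y y)
        + G' (φ y) (X y) (localCovDeriv G' φ Y s s' y u) := by
  rw [fderivWithin_bilin_apply (hs.uniqueDiffOn y hφ.mem)
      (hφ.comp_hasFDerivWithinAt hG.differentiableWithinAt).differentiableWithinAt hX hY,
    hφ.fderivWithin_comp_apply hs hG.differentiableWithinAt, hG.fderivWithin_eq_christoffel hs',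
    localCovDeriv_apply, localCovDeriv_apply]
  simp only [map_add, add_apply]
  ring

theorem localCovDeriv_localCovDeriv_apply [FiniteDimensional ℝ E'] (hφ : IsLocalMap φ s s' y)
    (hs : IsRegion s) (hs' : IsRegion s') (hG : IsLocalMetric G' s' (φ y)) {X : E → E'}
    (hX : ContDiffWithinAt ℝ 2 X s y) (u w : E) :
    localCovDeriv G' φ (fun z => localCovDeriv G' φ X s s' z w) s s' y u
      = fderivWithin ℝ (fderivWithin ℝ X s) s y u w
        + fderivWithin ℝ (christoffel G' s') s' (φ y) (fderivWithin ℝ φ s y u)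
          (fderivWithin ℝ φ s y w) (X y)
        + christoffel G' s' (φ y) (fderivWithin ℝ (fderivWithin ℝ φ s) s y u w) (X y)
        + christoffel G' s' (φ y) (fderivWithin ℝ φ s y w) (fderivWithin ℝ X s y u)
        + christoffel G' s' (φ y) (fderivWithin ℝ φ s y u)
          (localCovDeriv G' φ X s s' y w) := by
  have hy := hs.uniqueDiffOn y hφ.mem
  have hDX : DifferentiableWithinAt ℝ (fderivWithin ℝ X s) s y :=
    (hX.fderivWithin_right (m := 1) hs.uniqueDiffOn (by norm_num) hφ.mem).differentiableWithinAt
      (by simp)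
  have hX' : DifferentiableWithinAt ℝ X s y := hX.differentiableWithinAt (by simp)
  have hDφ := hφ.differentiableWithinAt_fderivWithin hs
  have hw : DifferentiableWithinAt ℝ (fun _ => w) s y := differentiableWithinAt_const w
  have hΓ := (hG.contDiffWithinAt_christoffel hs').differentiableWithinAt (by simp)
  have hΓφ := (hφ.comp_hasFDerivWithinAt hΓ).differentiableWithinAt
  have hderiv : fderivWithin ℝ (fun z => localCovDeriv G' φ X s s' z w) s y u
      = fderivWithin ℝ (fun z => fderivWithin ℝ X s z w) s y u
        + fderivWithin ℝ
          (fun z => christoffel G' s' (φ z) (fderivWithin ℝ φ s z w) (X z)) s y u := by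
    rw [← add_apply, ← fderivWithin_fun_add hy (hDX.clm_apply hw)
      ((hΓφ.clm_apply (hDφ.clm_apply hw)).clm_apply hX')]
    rfl
  rw [localCovDeriv_apply, hderiv, fderivWithin_bilin_apply hy hΓφ (hDφ.clm_apply hw) hX',
    hφ.fderivWithin_comp_apply hs hΓ, fderivWithin_clm_apply hy hDX hw,
    fderivWithin_clm_apply hy hDφ hw]
  simp only [fderivWithin_fun_const, Pi.zero_apply, ContinuousLinearMap.comp_zero, zero_add,
    ContinuousLinearMap.flip_apply, ← add_assoc]

theorem fderivWithin_fderivWithin_apply_field (hφ : IsLocalMap φ s s' y) (hs : IsRegion s)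
    (hs' : IsRegion s') {ψ : E' → ℝ} (hψ : ContDiffWithinAt ℝ 2 ψ s' (φ y)) {X : E → E'}
    (hX : DifferentiableWithinAt ℝ X s y) (u : E) :
    fderivWithin ℝ (fun z => fderivWithin ℝ ψ s' (φ z) (X z)) s y u
      = coordHessian G' s' ψ (φ y) (fderivWithin ℝ φ s y u) (X y)
        + fderivWithin ℝ ψ s' (φ y) (localCovDeriv G' φ X s s' y u) := by
  have hDψ : DifferentiableWithinAt ℝ (fderivWithin ℝ ψ s') s' (φ y) :=
    (hψ.fderivWithin_right (m := 1) hs'.uniqueDiffOn (by norm_num)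
      hφ.map_mem).differentiableWithinAt (by simp)
  rw [fderivWithin_clm_apply (hs.uniqueDiffOn y hφ.mem)
    (hφ.comp_hasFDerivWithinAt hDψ).differentiableWithinAt hX, coordHessian, localCovDeriv_apply]
  simp only [add_apply, ContinuousLinearMap.comp_apply, ContinuousLinearMap.flip_apply,
    hφ.fderivWithin_comp_apply hs hDψ, map_add]
  ring

/-- The Ricci identity. -/
theorem localCovDeriv_localCovDeriv_sub [FiniteDimensional ℝ E'] (hφ : IsLocalMap φ s s' y)
    (hs : IsRegion s) (hs' : IsRegion s') (hG : IsLocalMetric G' s' (φ y)) {X : E → E'}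
    (hX : ContDiffWithinAt ℝ 2 X s y) (u w : E) :
    localCovDeriv G' φ (fun z => localCovDeriv G' φ X s s' z w) s s' y u
        - localCovDeriv G' φ (fun z => localCovDeriv G' φ X s s' z u) s s' y w
      = curvatureEnd G' s' (φ y) (fderivWithin ℝ φ s y w) (X y) (fderivWithin ℝ φ s y u) := by
  rw [hφ.localCovDeriv_localCovDeriv_apply hs hs' hG hX,
    hφ.localCovDeriv_localCovDeriv_apply hs hs' hG hX, curvatureEnd_apply, localCovDeriv_apply,
    localCovDeriv_apply, map_add, map_add, hs.fderivWithin_fderivWithin_comm hφ.mem hX w u,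
    hs.fderivWithin_fderivWithin_comm hφ.mem (hφ.contDiffWithinAt.of_le (by norm_num)) w u]
  abel

end IsLocalMap

end FieldAlongMap

section LocalHypersurface

variable {E : Type*} [NormedAddCommGroup E] [NormedSpace ℝ E]
  {E' : Type*} [NormedAddCommGroup E'] [NormedSpace ℝ E']

/-- A map `φ` of regions which is, near `y`, an immersion as a hypersurface, with unit normal field
`n` for the metric `G'` of the target. -/
structure IsLocalHypersurface (G' : E' → E' →L[ℝ] E' →L[ℝ] ℝ) (φ n : E → E') (s : Set E)
    (s' : Set E') (y : E) : Prop where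
  isRegion : IsRegion s
  isRegion_target : IsRegion s'
  isLocalMap : IsLocalMap φ s s' y
  isLocalMetric_target : IsLocalMetric G' s' (φ y)
  eventually_injective : ∀ᶠ z in 𝓝[s] y, Function.Injective (fderivWithin ℝ φ s z)
  contDiffWithinAt_normal : ContDiffWithinAt ℝ 2 n s y
  eventually_unit : ∀ᶠ z in 𝓝[s] y, G' (φ z) (n z) (n z) = 1
  eventually_orthogonal : ∀ᶠ z in 𝓝[s] y, ∀ u, G' (φ z) (n z) (fderivWithin ℝ φ s z u) = 0
  finrank_eq : Module.finrank ℝ E' = Module.finrank ℝ E + 1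

/-- The tangential projection `E' → E` along an immersion `φ` of regions. -/
def tangentProj (G' : E' → E' →L[ℝ] E' →L[ℝ] ℝ) (φ : E → E') (s : Set E) (z : E) : E' →L[ℝ] E :=
  (inducedForm G' φ s z).inverse ∘L
    (ContinuousLinearMap.precomp ℝ (fderivWithin ℝ φ s z)) ∘L G' (φ z)

/-- The shape operator `u ↦ -(D_u n)^⊤` of an immersion `φ` of regions with normal field `n`. -/
def shapeOp (G' : E' → E' →L[ℝ] E' →L[ℝ] ℝ) (φ n : E → E') (s : Set E) (s' : Set E') (z : E) :
    E →L[ℝ] E :=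
  -(tangentProj G' φ s z ∘L localCovDeriv G' φ n s s' z)

/-- The exterior covariant derivative `u ↦ (D_w S) u - (D_u S) w` of the shape operator `S`, for
the Levi-Civita connection of the induced metric. -/
def shapeOpExtDeriv (G' : E' → E' →L[ℝ] E' →L[ℝ] ℝ) (φ n : E → E') (s : Set E) (s' : Set E')
    (y w : E) : E →L[ℝ] E :=
  fderivWithin ℝ (shapeOp G' φ n s s') s y w
    + christoffel (inducedForm G' φ s) s y w ∘L shapeOp G' φ n s s' y
    - (fderivWithin ℝ (shapeOp G' φ n s s') s y).flip w
    - (christoffel (inducedForm G' φ s) s y).flip (shapeOp G' φ n s s' y w)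

variable {G' : E' → E' →L[ℝ] E' →L[ℝ] ℝ} {φ n : E → E'} {s : Set E} {s' : Set E'} {y : E}

theorem shapeOpExtDeriv_apply (w u : E) : shapeOpExtDeriv G' φ n s s' y w u
    = fderivWithin ℝ (shapeOp G' φ n s s') s y w u
      + christoffel (inducedForm G' φ s) s y w (shapeOp G' φ n s s' y u)
      - fderivWithin ℝ (shapeOp G' φ n s s') s y u w
      - christoffel (inducedForm G' φ s) s y u (shapeOp G' φ n s s' y w) := rfl

namespace IsLocalHypersurface

theorem mem (h : IsLocalHypersurface G' φ n s s' y) : y ∈ s := h.isLocalMap.mem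

theorem eventually (h : IsLocalHypersurface G' φ n s s' y) :
    ∀ᶠ z in 𝓝[s] y, IsLocalHypersurface G' φ n s s' z := by
  have hn := h.contDiffWithinAt_normal.eventually (by simp)
  rw [insert_eq_of_mem h.mem] at hn
  filter_upwards [h.isLocalMap.eventually,
    h.isLocalMap.tendsto.eventually h.isLocalMetric_target.eventually,
    eventually_eventually_nhdsWithin.2 h.eventually_injective, hn,
    eventually_eventually_nhdsWithin.2 h.eventually_unit,
    eventually_eventually_nhdsWithin.2 h.eventually_orthogonal] with z hmap hmetric hinj hn hunit
    horth
  exact ⟨h.isRegion, h.isRegion_target, hmap, hmetric, hinj, hn, hunit, horth, h.finrank_eq⟩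

theorem unit (h : IsLocalHypersurface G' φ n s s' y) : G' (φ y) (n y) (n y) = 1 :=
  h.eventually_unit.self_of_nhdsWithin h.mem

theorem orthogonal (h : IsLocalHypersurface G' φ n s s' y) (u : E) :
    G' (φ y) (n y) (fderivWithin ℝ φ s y u) = 0 :=
  h.eventually_orthogonal.self_of_nhdsWithin h.mem u

theorem injective (h : IsLocalHypersurface G' φ n s s' y) :
    Function.Injective (fderivWithin ℝ φ s y) :=
  h.eventually_injective.self_of_nhdsWithin h.mem

theorem differentiableWithinAt_normal (h : IsLocalHypersurface G' φ n s s' y) :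
    DifferentiableWithinAt ℝ n s y :=
  h.contDiffWithinAt_normal.differentiableWithinAt (by simp)

section FiniteDimensionalTarget

variable [FiniteDimensional ℝ E']

theorem localCovDeriv_normal_orthogonal (h : IsLocalHypersurface G' φ n s s' y) (u : E) :
    G' (φ y) (localCovDeriv G' φ n s s' y u) (n y) = 0 := by
  have hunit : (fun z => G' (φ z) (n z) (n z)) =ᶠ[𝓝[s] y] fun _ => 1 := h.eventually_unit
  have hderiv := h.isLocalMap.fderivWithin_metric_apply h.isRegion h.isRegion_target
    h.isLocalMetric_target h.differentiableWithinAt_normal h.differentiableWithinAt_normal u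
  rw [hunit.fderivWithin_eq h.unit, fderivWithin_fun_const, Pi.zero_apply, zero_apply,
    h.isLocalMetric_target.isInnerForm.symm (n y)] at hderiv
  linarith

theorem mapHessian_normal (h : IsLocalHypersurface G' φ n s s' y) (u w : E) :
    G' (φ y) (mapHessian G' φ s s' y u w) (n y)
      = -G' (φ y) (localCovDeriv G' φ n s s' y u) (fderivWithin ℝ φ s y w) := by
  have horth : (fun z => G' (φ z) (n z) (fderivWithin ℝ φ s z w)) =ᶠ[𝓝[s] y] fun _ => 0 :=
    h.eventually_orthogonal.mono fun z hz => hz w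
  have hw : DifferentiableWithinAt ℝ (fun _ => w) s y := differentiableWithinAt_const w
  have hderiv := h.isLocalMap.fderivWithin_metric_apply h.isRegion h.isRegion_target
    h.isLocalMetric_target h.differentiableWithinAt_normal
    ((h.isLocalMap.differentiableWithinAt_fderivWithin h.isRegion).clm_apply hw) u
  rw [horth.fderivWithin_eq (h.orthogonal w),
    h.isLocalMap.localCovDeriv_fderivWithin_apply h.isRegion hw] at hderiv
  simp only [fderivWithin_fun_const, Pi.zero_apply, zero_apply, map_zero, add_zero] at hderiv
  rw [h.isLocalMetric_target.isInnerForm.symm]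
  linarith

end FiniteDimensionalTarget

theorem isLocalMetric (h : IsLocalHypersurface G' φ n s s' y) :
    IsLocalMetric (inducedForm G' φ s) s y :=
  h.isLocalMap.isLocalMetric_inducedForm h.isRegion h.isLocalMetric_target h.eventually_injective

variable [FiniteDimensional ℝ E]

theorem inducedForm_tangentProj (h : IsLocalHypersurface G' φ n s s' y) (X : E') (w : E) :
    inducedForm G' φ s y (tangentProj G' φ s y X) w = G' (φ y) X (fderivWithin ℝ φ s y w) := by
  rw [tangentProj, ContinuousLinearMap.comp_apply, h.isLocalMetric.isInnerForm.apply_inverse]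
  rfl

theorem tangentProj_fderivWithin (h : IsLocalHypersurface G' φ n s s' y) (u : E) :
    tangentProj G' φ s y (fderivWithin ℝ φ s y u) = u :=
  h.isLocalMetric.isInnerForm.ext fun w => by rw [h.inducedForm_tangentProj, inducedForm_apply]

theorem tangentProj_normal (h : IsLocalHypersurface G' φ n s s' y) :
    tangentProj G' φ s y (n y) = 0 :=
  h.isLocalMetric.isInnerForm.ext fun w => by
    rw [h.inducedForm_tangentProj, h.orthogonal, map_zero, zero_apply]

theorem exists_eq_fderivWithin_add_smul_normal (h : IsLocalHypersurface G' φ n s s' y) (X : E') :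
    ∃ (u : E) (a : ℝ), X = fderivWithin ℝ φ s y u + a • n y := by
  have : FiniteDimensional ℝ E' := Module.finite_of_finrank_pos (by rw [h.finrank_eq]; omega)
  let L : E × ℝ →ₗ[ℝ] E' :=
    (fderivWithin ℝ φ s y : E →ₗ[ℝ] E').coprod (LinearMap.toSpanSingleton ℝ E' (n y))
  have hL : Function.Injective L := by
    rw [← LinearMap.ker_eq_bot, LinearMap.ker_eq_bot']
    rintro ⟨u, a⟩ hua
    have hua : fderivWithin ℝ φ s y u + a • n y = 0 := hua
    have ha : a = 0 := by
      simpa [h.orthogonal, h.unit] using congrArg (G' (φ y) (n y)) hua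
    have hu : fderivWithin ℝ φ s y u = fderivWithin ℝ φ s y 0 := by simpa [ha] using hua
    rw [h.injective hu, ha, Prod.mk_zero_zero]
  have hdim : Module.finrank ℝ (E × ℝ) = Module.finrank ℝ E' := by
    rw [h.finrank_eq, Module.finrank_prod, Module.finrank_self]
  obtain ⟨⟨u, a⟩, hua⟩ := (LinearMap.injective_iff_surjective_of_finrank_eq_finrank hdim).1 hL X
  exact ⟨u, a, hua.symm⟩

theorem fderivWithin_tangentProj_add_normal (h : IsLocalHypersurface G' φ n s s' y) (X : E') :
    fderivWithin ℝ φ s y (tangentProj G' φ s y X) + G' (φ y) X (n y) • n y = X := by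
  obtain ⟨u, a, rfl⟩ := h.exists_eq_fderivWithin_add_smul_normal X
  have horth : G' (φ y) (fderivWithin ℝ φ s y u) (n y) = 0 := by
    rw [h.isLocalMetric_target.isInnerForm.symm, h.orthogonal]
  simp [h.tangentProj_fderivWithin, h.tangentProj_normal, horth, h.unit]

theorem trace_eq_of_normal_eq_zero (h : IsLocalHypersurface G' φ n s s' y) {L : E' →ₗ[ℝ] E'}
    {K : E →ₗ[ℝ] E} (hn : L (n y) = 0)
    (hLK : ∀ u, L (fderivWithin ℝ φ s y u) = fderivWithin ℝ φ s y (K u)) :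
    LinearMap.trace ℝ E' L = LinearMap.trace ℝ E K := by
  have : FiniteDimensional ℝ E' := Module.finite_of_finrank_pos (by rw [h.finrank_eq]; omega)
  let A : E →ₗ[ℝ] E' := fderivWithin ℝ φ s y
  let P : E' →ₗ[ℝ] E := tangentProj G' φ s y
  have hL : L = A ∘ₗ (K ∘ₗ P) := by
    ext X
    conv_lhs => rw [← h.fderivWithin_tangentProj_add_normal X, map_add, map_smul, hn, hLK]
    simp [A, P]
  have hPA : P ∘ₗ A = LinearMap.id := by
    ext u
    exact h.tangentProj_fderivWithin u
  rw [hL, LinearMap.trace_comp_comm', LinearMap.comp_assoc, hPA, LinearMap.comp_id]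

theorem contDiffWithinAt_tangentProj (h : IsLocalHypersurface G' φ n s s' y) :
    ContDiffWithinAt ℝ 1 (tangentProj G' φ s) s y := by
  have hprecomp : ContDiffWithinAt ℝ 1
      (fun z => ContinuousLinearMap.precomp ℝ (fderivWithin ℝ φ s z)) s y :=
    (ContinuousLinearMap.compL ℝ E E' ℝ).flip.contDiff.contDiffAt.comp_contDiffWithinAt y
      ((h.isLocalMap.contDiffWithinAt_fderivWithin h.isRegion).of_le (by norm_num))
  have hmetric : ContDiffWithinAt ℝ 1 (fun z => G' (φ z)) s y :=
    h.isLocalMap.comp_contDiffWithinAt (by norm_num)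
      (h.isLocalMetric_target.contDiffWithinAt.of_le (by norm_num))
  exact (h.isLocalMetric.contDiffWithinAt_inverse.of_le (by norm_num)).clm_comp
    (hprecomp.clm_comp hmetric)

theorem inducedForm_shapeOp (h : IsLocalHypersurface G' φ n s s' y) (u w : E) :
    inducedForm G' φ s y (shapeOp G' φ n s s' y u) w
      = -G' (φ y) (localCovDeriv G' φ n s s' y u) (fderivWithin ℝ φ s y w) := by
  rw [shapeOp, neg_apply, map_neg, neg_apply, ContinuousLinearMap.comp_apply,
    h.inducedForm_tangentProj]

variable [FiniteDimensional ℝ E']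

theorem localCovDeriv_normal (h : IsLocalHypersurface G' φ n s s' y) (u : E) :
    localCovDeriv G' φ n s s' y u = -fderivWithin ℝ φ s y (shapeOp G' φ n s s' y u) := by
  have hdecomp := h.fderivWithin_tangentProj_add_normal (localCovDeriv G' φ n s s' y u)
  rw [h.localCovDeriv_normal_orthogonal, zero_smul, add_zero] at hdecomp
  simp [shapeOp, hdecomp]

theorem tangentProj_mapHessian (h : IsLocalHypersurface G' φ n s s' y) (u w : E) :
    tangentProj G' φ s y (mapHessian G' φ s s' y u w)
      = christoffel (inducedForm G' φ s) s y u w := by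
  refine h.isLocalMetric.isInnerForm.ext fun z => ?_
  rw [h.inducedForm_tangentProj, h.isLocalMetric.apply_christoffel,
    h.isLocalMap.christoffelLow_inducedForm h.isRegion h.isLocalMetric_target]

/-- The Gauss formula. -/
theorem mapHessian_eq (h : IsLocalHypersurface G' φ n s s' y) (u w : E) :
    mapHessian G' φ s s' y u w
      = fderivWithin ℝ φ s y (christoffel (inducedForm G' φ s) s y u w)
        + inducedForm G' φ s y (shapeOp G' φ n s s' y u) w • n y := by
  have hdecomp := h.fderivWithin_tangentProj_add_normal (mapHessian G' φ s s' y u w)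
  rw [← hdecomp, h.tangentProj_mapHessian, h.mapHessian_normal, h.inducedForm_shapeOp]

theorem shapeOp_symm (h : IsLocalHypersurface G' φ n s s' y) (u w : E) :
    inducedForm G' φ s y (shapeOp G' φ n s s' y u) w
      = inducedForm G' φ s y (shapeOp G' φ n s s' y w) u := by
  rw [h.inducedForm_shapeOp, h.inducedForm_shapeOp, ← h.mapHessian_normal, ← h.mapHessian_normal,
    h.isLocalMap.mapHessian_comm h.isRegion h.isRegion_target h.isLocalMetric_target]

theorem contDiffWithinAt_shapeOp (h : IsLocalHypersurface G' φ n s s' y) :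
    ContDiffWithinAt ℝ 1 (shapeOp G' φ n s s') s y :=
  (h.contDiffWithinAt_tangentProj.clm_comp (h.isLocalMap.contDiffWithinAt_localCovDeriv h.isRegion
    h.isRegion_target h.isLocalMetric_target h.contDiffWithinAt_normal)).neg

theorem differentiableWithinAt_shapeOp (h : IsLocalHypersurface G' φ n s s' y) :
    DifferentiableWithinAt ℝ (shapeOp G' φ n s s') s y :=
  h.contDiffWithinAt_shapeOp.differentiableWithinAt (by simp)

theorem localCovDeriv_localCovDeriv_normal (h : IsLocalHypersurface G' φ n s s' y) (u w : E) :
    localCovDeriv G' φ (fun z => localCovDeriv G' φ n s s' z w) s s' y u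
      = -(mapHessian G' φ s s' y u (shapeOp G' φ n s s' y w)
        + fderivWithin ℝ φ s y (fderivWithin ℝ (shapeOp G' φ n s s') s y u w)) := by
  have hw : DifferentiableWithinAt ℝ (fun _ => w) s y := differentiableWithinAt_const w
  have hS := h.differentiableWithinAt_shapeOp
  have hWeingarten : (fun z => localCovDeriv G' φ n s s' z w)
      =ᶠ[𝓝[s] y] fun z => -fderivWithin ℝ φ s z (shapeOp G' φ n s s' z w) :=
    h.eventually.mono fun z hz => hz.localCovDeriv_normal w
  rw [localCovDeriv_congr hWeingarten h.mem, localCovDeriv_neg h.isRegion h.mem, neg_apply,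
    h.isLocalMap.localCovDeriv_fderivWithin_apply h.isRegion (hS.clm_apply hw),
    fderivWithin_clm_apply (h.isRegion.uniqueDiffOn y h.mem) hS hw]
  simp

/-- The Codazzi equation. -/
theorem curvatureEnd_normal_fderivWithin (h : IsLocalHypersurface G' φ n s s' y) (u w : E) :
    curvatureEnd G' s' (φ y) (fderivWithin ℝ φ s y w) (n y) (fderivWithin ℝ φ s y u)
      = fderivWithin ℝ φ s y (shapeOpExtDeriv G' φ n s s' y w u) := by
  rw [← h.isLocalMap.localCovDeriv_localCovDeriv_sub h.isRegion h.isRegion_target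
      h.isLocalMetric_target h.contDiffWithinAt_normal, h.localCovDeriv_localCovDeriv_normal,
    h.localCovDeriv_localCovDeriv_normal, h.mapHessian_eq, h.mapHessian_eq,
    h.isLocalMetric.isInnerForm.symm (shapeOp G' φ n s s' y w), shapeOpExtDeriv_apply]
  simp only [map_add, map_sub]
  abel

end IsLocalHypersurface

end LocalHypersurface

section TraceSquare

variable {E : Type*} [NormedAddCommGroup E] [NormedSpace ℝ E]

namespace IsInnerForm

variable {G : E →L[ℝ] E →L[ℝ] ℝ}

theorem apply_basis_eq_repr_mul {ι : Type*} [Finite ι] {b : Module.Basis ι ℝ E}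
    (hb : ∀ i j, i ≠ j → G (b i) (b j) = 0) (x : E) (i : ι) :
    G x (b i) = b.repr x i * G (b i) (b i) := by
  cases nonempty_fintype ι
  conv_lhs => rw [← b.sum_repr x]
  rw [map_sum, sum_apply, Finset.sum_eq_single i]
  · simp
  · intro j _ hj
    simp [hb j i hj]
  · simp

theorem exists_orthogonal_basis [FiniteDimensional ℝ E] (hG : IsInnerForm G) :
    ∃ b : Module.Basis (Fin (Module.finrank ℝ E)) ℝ E, ∀ i j, i ≠ j → G (b i) (b j) = 0 := by
  let β : LinearMap.BilinForm ℝ E := LinearMap.mk₂ ℝ (fun u v => G u v)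
    (fun u v w => by simp) (fun c u v => by simp) (fun u v w => by simp) (fun c u v => by simp)
  obtain ⟨b, hb⟩ := LinearMap.BilinForm.exists_orthogonal_basis (B := β) ⟨fun u v => hG.symm u v⟩
  exact ⟨b, fun i j hij => hb hij⟩

theorem trace_comp_self_eq_sum (hG : IsInnerForm G) {ι : Type*} [Fintype ι]
    {b : Module.Basis ι ℝ E} (hb : ∀ i j, i ≠ j → G (b i) (b j) = 0) {S : E →L[ℝ] E}
    (hS : ∀ u w, G (S u) w = G (S w) u) :
    LinearMap.trace ℝ E (S ∘L S).toLinearMap = ∑ i, G (S (b i)) (S (b i)) / G (b i) (b i) := by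
  classical
  rw [LinearMap.trace_eq_matrix_trace ℝ b, Matrix.trace]
  refine Finset.sum_congr rfl fun i _ => ?_
  rw [Matrix.diag_apply, LinearMap.toMatrix_apply, eq_div_iff (hG.pos _ (b.ne_zero i)).ne',
    ← apply_basis_eq_repr_mul hb, hS (b i)]
  rfl

theorem trace_comp_self_nonneg [FiniteDimensional ℝ E] (hG : IsInnerForm G) {S : E →L[ℝ] E}
    (hS : ∀ u w, G (S u) w = G (S w) u) : 0 ≤ LinearMap.trace ℝ E (S ∘L S).toLinearMap := by
  obtain ⟨b, hb⟩ := hG.exists_orthogonal_basis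
  rw [hG.trace_comp_self_eq_sum hb hS]
  exact Finset.sum_nonneg fun i _ => div_nonneg (hG.nonneg _) (hG.nonneg _)

theorem eq_zero_of_trace_comp_self_eq_zero [FiniteDimensional ℝ E] (hG : IsInnerForm G)
    {S : E →L[ℝ] E} (hS : ∀ u w, G (S u) w = G (S w) u)
    (htrace : LinearMap.trace ℝ E (S ∘L S).toLinearMap = 0) : S = 0 := by
  obtain ⟨b, hb⟩ := hG.exists_orthogonal_basis
  rw [hG.trace_comp_self_eq_sum hb hS, Finset.sum_eq_zero_iff_of_nonneg
    fun i _ => div_nonneg (hG.nonneg _) (hG.nonneg _)] at htrace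
  refine ContinuousLinearMap.coe_injective (b.ext fun i => ?_)
  have hterm := htrace i (Finset.mem_univ i)
  rw [div_eq_zero_iff, or_iff_left (hG.pos _ (b.ne_zero i)).ne'] at hterm
  exact hG.eq_zero hterm

end IsInnerForm

variable [FiniteDimensional ℝ E]

/-- The trace as a continuous linear form. -/
def traceForm : (E →L[ℝ] E) →L[ℝ] ℝ :=
  LinearMap.toContinuousLinearMap (LinearMap.trace ℝ E ∘ₗ ContinuousLinearMap.coeLM ℝ)

theorem traceForm_apply (A : E →L[ℝ] E) : traceForm A = LinearMap.trace ℝ E A.toLinearMap := rfl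

theorem traceForm_comp_comm (A B : E →L[ℝ] E) : traceForm (A ∘L B) = traceForm (B ∘L A) :=
  LinearMap.trace_mul_comm ℝ A.toLinearMap B.toLinearMap

end TraceSquare

section Angle

variable {E : Type*} [NormedAddCommGroup E] [NormedSpace ℝ E]
  {E' : Type*} [NormedAddCommGroup E'] [NormedSpace ℝ E']
  {G' : E' → E' →L[ℝ] E' →L[ℝ] ℝ} {φ n : E → E'} {s : Set E} {s' : Set E'} {y : E}

/-- The vector field that is constantly `ξ` in coordinates is parallel near `x`. -/
def IsLocallyParallel (G' : E' → E' →L[ℝ] E' →L[ℝ] ℝ) (s' : Set E') (ξ x : E') : Prop :=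
  ∀ᶠ z in 𝓝[s'] x, ∀ u, christoffel G' s' z u ξ = 0

/-- The angle function `θ = ⟨ξ, n⟩` between a constant field `ξ` and a field `n` along `φ`. -/
def localAngle (G' : E' → E' →L[ℝ] E' →L[ℝ] ℝ) (φ n : E → E') (ξ : E') (z : E) : ℝ :=
  G' (φ z) ξ (n z)

namespace IsLocalHypersurface

variable {ξ : E'}

theorem christoffel_parallel (h : IsLocalHypersurface G' φ n s s' y)
    (hξ : IsLocallyParallel G' s' ξ (φ y)) (u : E') : christoffel G' s' (φ y) u ξ = 0 :=
  hξ.self_of_nhdsWithin h.isLocalMap.map_mem u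

theorem differentiableWithinAt_localAngle (h : IsLocalHypersurface G' φ n s s' y) :
    DifferentiableWithinAt ℝ (localAngle G' φ n ξ) s y :=
  ((h.isLocalMap.comp_hasFDerivWithinAt
    h.isLocalMetric_target.differentiableWithinAt).differentiableWithinAt.clm_apply
      (differentiableWithinAt_const ξ)).clm_apply h.differentiableWithinAt_normal

theorem fderivWithin_localAngle [FiniteDimensional ℝ E']
    (h : IsLocalHypersurface G' φ n s s' y)
    (hξ : IsLocallyParallel G' s' ξ (φ y)) (u : E) :
    fderivWithin ℝ (localAngle G' φ n ξ) s y u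
      = G' (φ y) ξ (localCovDeriv G' φ n s s' y u) := by
  have hderiv := h.isLocalMap.fderivWithin_metric_apply h.isRegion h.isRegion_target
    h.isLocalMetric_target (differentiableWithinAt_const ξ) h.differentiableWithinAt_normal u
  rwa [localCovDeriv_const, h.christoffel_parallel hξ, map_zero, zero_apply, zero_add] at hderiv

variable [FiniteDimensional ℝ E]

theorem fderivWithin_tangentProj_eq_sub (h : IsLocalHypersurface G' φ n s s' y) (X : E') :
    fderivWithin ℝ φ s y (tangentProj G' φ s y X) = X - G' (φ y) X (n y) • n y :=
  eq_sub_of_add_eq (h.fderivWithin_tangentProj_add_normal X)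

theorem differentiableWithinAt_tangentProj_apply (h : IsLocalHypersurface G' φ n s s' y)
    (ξ : E') : DifferentiableWithinAt ℝ (fun z => tangentProj G' φ s z ξ) s y :=
  (h.contDiffWithinAt_tangentProj.differentiableWithinAt (by simp)).clm_apply
    (differentiableWithinAt_const ξ)

variable [FiniteDimensional ℝ E']

theorem coordGrad_localAngle (h : IsLocalHypersurface G' φ n s s' y)
    (hξ : IsLocallyParallel G' s' ξ (φ y)) :
    coordGrad (inducedForm G' φ s) s (localAngle G' φ n ξ) y
      = -shapeOp G' φ n s s' y (tangentProj G' φ s y ξ) := by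
  refine h.isLocalMetric.isInnerForm.ext fun w => ?_
  rw [coordGrad, h.isLocalMetric.isInnerForm.apply_inverse, h.fderivWithin_localAngle hξ, map_neg,
    neg_apply, h.shapeOp_symm, h.inducedForm_shapeOp, neg_neg, h.fderivWithin_tangentProj_eq_sub,
    map_sub, map_smul, h.localCovDeriv_normal_orthogonal, smul_zero, sub_zero,
    h.isLocalMetric_target.isInnerForm.symm]

theorem covDeriv_tangentProj_parallel (h : IsLocalHypersurface G' φ n s s' y)
    (hξ : IsLocallyParallel G' s' ξ (φ y)) (u : E) :
    fderivWithin ℝ (fun z => tangentProj G' φ s z ξ) s y u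
        + christoffel (inducedForm G' φ s) s y u (tangentProj G' φ s y ξ)
      = localAngle G' φ n ξ y • shapeOp G' φ n s s' y u := by
  have hT := h.differentiableWithinAt_tangentProj_apply ξ
  have hθ := h.differentiableWithinAt_localAngle (ξ := ξ)
  have hθn : DifferentiableWithinAt ℝ (fun z => localAngle G' φ n ξ z • n z) s y :=
    hθ.smul h.differentiableWithinAt_normal
  have hdecomp : (fun _ => ξ) =ᶠ[𝓝[s] y] fun z =>
      fderivWithin ℝ φ s z (tangentProj G' φ s z ξ) + localAngle G' φ n ξ z • n z :=
    h.eventually.mono fun z hz => (hz.fderivWithin_tangentProj_add_normal ξ).symm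
  have hparallel : localCovDeriv G' φ (fun _ => ξ) s s' y u = 0 := by
    rw [localCovDeriv_const, h.christoffel_parallel hξ]
  rw [localCovDeriv_congr hdecomp h.mem, localCovDeriv_add h.isRegion h.mem
      ((h.isLocalMap.differentiableWithinAt_fderivWithin h.isRegion).clm_apply hT)
      hθn, add_apply,
    h.isLocalMap.localCovDeriv_fderivWithin_apply h.isRegion hT,
    localCovDeriv_smul_apply h.isRegion h.mem hθ h.differentiableWithinAt_normal,
    h.localCovDeriv_normal] at hparallel
  have htangent := congrArg (tangentProj G' φ s y) hparallel
  simp only [map_add, map_smul, map_neg, map_zero, h.tangentProj_mapHessian, h.tangentProj_normal,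
    h.tangentProj_fderivWithin, smul_zero, zero_add] at htangent
  linear_combination (norm := module) htangent

theorem shapeOpExtDeriv_tangentProj (h : IsLocalHypersurface G' φ n s s' y)
    (hR : ∀ u w, curvatureEnd G' s' (φ y) ξ w u = 0) (u : E) :
    fderivWithin ℝ φ s y (shapeOpExtDeriv G' φ n s s' y (tangentProj G' φ s y ξ) u)
      = -(localAngle G' φ n ξ y
        • curvatureEnd G' s' (φ y) (n y) (n y) (fderivWithin ℝ φ s y u)) := by
  have hlinear (a : ℝ) (x : E') : curvatureEnd G' s' (φ y) (ξ - a • n y) (n y) x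
      = curvatureEnd G' s' (φ y) ξ (n y) x - a • curvatureEnd G' s' (φ y) (n y) (n y) x := by
    simp only [curvatureEnd_apply, map_sub, map_smul, sub_apply, smul_apply]
    module
  rw [← h.curvatureEnd_normal_fderivWithin, h.fderivWithin_tangentProj_eq_sub, hlinear, hR,
    zero_sub, localAngle]

theorem traceForm_shapeOpExtDeriv (h : IsLocalHypersurface G' φ n s s' y)
    (hR : ∀ u w, curvatureEnd G' s' (φ y) ξ w u = 0) :
    traceForm (shapeOpExtDeriv G' φ n s s' y (tangentProj G' φ s y ξ))
      = -(localAngle G' φ n ξ y * coordRicci G' s' (φ y) (n y) (n y)) := by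
  have htrace := h.trace_eq_of_normal_eq_zero
    (L := -(localAngle G' φ n ξ y • (curvatureEnd G' s' (φ y) (n y) (n y)).toLinearMap))
    (by simp [curvatureEnd_apply]) fun u => (h.shapeOpExtDeriv_tangentProj hR u).symm
  rw [traceForm_apply, ← htrace, map_neg, map_smul, smul_eq_mul, coordRicci]

theorem covDeriv_coordGrad_localAngle (h : IsLocalHypersurface G' φ n s s' y)
    (hξ : IsLocallyParallel G' s' ξ (φ y)) :
    fderivWithin ℝ (coordGrad (inducedForm G' φ s) s (localAngle G' φ n ξ)) s y
        + (christoffel (inducedForm G' φ s) s y).flip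
          (coordGrad (inducedForm G' φ s) s (localAngle G' φ n ξ) y)
      = shapeOpExtDeriv G' φ n s s' y (tangentProj G' φ s y ξ)
        - fderivWithin ℝ (shapeOp G' φ n s s') s y (tangentProj G' φ s y ξ)
        - (christoffel (inducedForm G' φ s) s y (tangentProj G' φ s y ξ) ∘L shapeOp G' φ n s s' y
          - shapeOp G' φ n s s' y
            ∘L christoffel (inducedForm G' φ s) s y (tangentProj G' φ s y ξ))
        - localAngle G' φ n ξ y • (shapeOp G' φ n s s' y ∘L shapeOp G' φ n s s' y) := by
  have hξ_eventually : ∀ᶠ z in 𝓝[s] y, IsLocallyParallel G' s' ξ (φ z) :=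
    h.isLocalMap.tendsto.eventually (eventually_eventually_nhdsWithin.2 hξ)
  have hgrad : coordGrad (inducedForm G' φ s) s (localAngle G' φ n ξ)
      =ᶠ[𝓝[s] y] fun z => -shapeOp G' φ n s s' z (tangentProj G' φ s z ξ) := by
    filter_upwards [h.eventually, hξ_eventually] with z hz hξz using hz.coordGrad_localAngle hξz
  have hy := h.isRegion.uniqueDiffOn y h.mem
  rw [hgrad.fderivWithin_eq (h.coordGrad_localAngle hξ), h.coordGrad_localAngle hξ,
    fderivWithin_fun_neg hy, fderivWithin_clm_apply hy h.differentiableWithinAt_shapeOp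
      (h.differentiableWithinAt_tangentProj_apply ξ)]
  ext u
  have hST := congrArg (shapeOp G' φ n s s' y) (h.covDeriv_tangentProj_parallel hξ u)
  rw [map_add, map_smul, h.isLocalMetric.christoffel_comm h.isRegion] at hST
  simp only [add_apply, neg_apply, sub_apply, smul_apply, ContinuousLinearMap.comp_apply,
    ContinuousLinearMap.flip_apply, map_neg, shapeOpExtDeriv_apply]
  linear_combination (norm := module) -hST

theorem coordDiv_coordGrad_localAngle (h : IsLocalHypersurface G' φ n s s' y)
    (hξ : IsLocallyParallel G' s' ξ (φ y)) (hR : ∀ u w, curvatureEnd G' s' (φ y) ξ w u = 0) :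
    coordDiv (inducedForm G' φ s) s
        (coordGrad (inducedForm G' φ s) s (localAngle G' φ n ξ)) y
      = -traceForm (fderivWithin ℝ (shapeOp G' φ n s s') s y (tangentProj G' φ s y ξ))
        - localAngle G' φ n ξ y * (coordRicci G' s' (φ y) (n y) (n y)
          + traceForm (shapeOp G' φ n s s' y ∘L shapeOp G' φ n s s' y)) := by
  rw [coordDiv, ← traceForm_apply, h.covDeriv_coordGrad_localAngle hξ, map_sub, map_sub, map_sub,
    map_sub, h.traceForm_shapeOpExtDeriv hR, map_smul, traceForm_comp_comm (christoffel _ _ _ _),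
    smul_eq_mul]
  ring

theorem traceForm_fderivWithin_shapeOp_tangentProj (h : IsLocalHypersurface G' φ n s s' y)
    (ξ : E') {ψ : E' → ℝ} (hψ : ContDiffWithinAt ℝ 2 ψ s' (φ y)) {a : ℝ}
    (hH : ∀ᶠ z in 𝓝[s] y, traceForm (shapeOp G' φ n s s' z)
      - fderivWithin ℝ ψ s' (φ z) (n z) = a) :
    traceForm (fderivWithin ℝ (shapeOp G' φ n s s') s y (tangentProj G' φ s y ξ))
      = coordHessian G' s' ψ (φ y) ξ (n y)
        - localAngle G' φ n ξ y * coordHessian G' s' ψ (φ y) (n y) (n y)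
        - fderivWithin ℝ ψ s' (φ y)
          (fderivWithin ℝ φ s y (shapeOp G' φ n s s' y (tangentProj G' φ s y ξ))) := by
  have hy := h.isRegion.uniqueDiffOn y h.mem
  have htrace : HasFDerivWithinAt (fun z => traceForm (shapeOp G' φ n s s' z))
      (traceForm ∘L fderivWithin ℝ (shapeOp G' φ n s s') s y) s y :=
    (traceForm (E := E)).hasFDerivAt.comp_hasFDerivWithinAt y
      h.differentiableWithinAt_shapeOp.hasFDerivWithinAt
  have hH : (fun z => traceForm (shapeOp G' φ n s s' z)) =ᶠ[𝓝[s] y]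
      fun z => fderivWithin ℝ ψ s' (φ z) (n z) + a :=
    hH.mono fun z hz => sub_eq_iff_eq_add'.1 hz
  have hlinear (b : ℝ) : coordHessian G' s' ψ (φ y) (ξ - b • n y) (n y)
      = coordHessian G' s' ψ (φ y) ξ (n y) - b * coordHessian G' s' ψ (φ y) (n y) (n y) := by
    simp only [coordHessian, map_sub, map_smul, sub_apply, smul_apply, smul_eq_mul]
    ring
  calc traceForm (fderivWithin ℝ (shapeOp G' φ n s s') s y (tangentProj G' φ s y ξ))
      = fderivWithin ℝ (fun z => traceForm (shapeOp G' φ n s s' z)) s y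
          (tangentProj G' φ s y ξ) := by rw [htrace.fderivWithin hy]; rfl
    _ = fderivWithin ℝ (fun z => fderivWithin ℝ ψ s' (φ z) (n z)) s y
          (tangentProj G' φ s y ξ) := by
        rw [hH.fderivWithin_eq (hH.self_of_nhdsWithin h.mem), fderivWithin_add_const]
    _ = _ := by
        rw [h.isLocalMap.fderivWithin_fderivWithin_apply_field (G' := G') h.isRegion
          h.isRegion_target hψ h.differentiableWithinAt_normal,
          h.fderivWithin_tangentProj_eq_sub, hlinear, h.localCovDeriv_normal, map_neg, localAngle,
          ← sub_eq_add_neg]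

theorem coordDiv_coordGrad_localAngle_add_drift (h : IsLocalHypersurface G' φ n s s' y)
    (hξ : IsLocallyParallel G' s' ξ (φ y)) (hR : ∀ u w, curvatureEnd G' s' (φ y) ξ w u = 0)
    {ψ : E' → ℝ} (hψ : ContDiffWithinAt ℝ 2 ψ s' (φ y)) {a : ℝ}
    (hH : ∀ᶠ z in 𝓝[s] y, traceForm (shapeOp G' φ n s s' z)
      - fderivWithin ℝ ψ s' (φ z) (n z) = a) :
    coordDiv (inducedForm G' φ s) s
        (coordGrad (inducedForm G' φ s) s (localAngle G' φ n ξ)) y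
      + fderivWithin ℝ (fun z => ψ (φ z)) s y
        (coordGrad (inducedForm G' φ s) s (localAngle G' φ n ξ) y)
      = -localAngle G' φ n ξ y * (coordRicci G' s' (φ y) (n y) (n y)
          - coordHessian G' s' ψ (φ y) (n y) (n y)
          + traceForm (shapeOp G' φ n s s' y ∘L shapeOp G' φ n s s' y))
        - coordHessian G' s' ψ (φ y) ξ (n y) := by
  rw [h.coordDiv_coordGrad_localAngle hξ hR, h.coordGrad_localAngle hξ,
    h.traceForm_fderivWithin_shapeOp_tangentProj ξ hψ hH,
    h.isLocalMap.fderivWithin_comp_apply h.isRegion (hψ.differentiableWithinAt (by simp)), map_neg,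
    map_neg]
  ring

end IsLocalHypersurface

end Angle

section ChartExpressions

variable {E : Type*} [NormedAddCommGroup E] [NormedSpace ℝ E]
  {H : Type*} [TopologicalSpace H] {I : ModelWithCorners ℝ E H}
  {S : Type*} [TopologicalSpace S] [ChartedSpace H S]
  {E' : Type*} [NormedAddCommGroup E'] [NormedSpace ℝ E']
  {H' : Type*} [TopologicalSpace H'] {J : ModelWithCorners ℝ E' H'}
  {W : Type*} [TopologicalSpace W] [ChartedSpace H' W]

variable (I) in
theorem isRegion_range : IsRegion (range I) :=
  ⟨I.uniqueDiffOn, I.range_subset_closure_interior⟩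

variable (I J) in
/-- The coordinate expression of a map in the charts at `p₀` and `x₁`; for `F = id` this is a
change of coordinates. -/
def chartMap (F : S → W) (p₀ : S) (x₁ : W) (y : E) : E' :=
  extChartAt J x₁ (F ((extChartAt I p₀).symm y))

theorem chartMap_self (F : S → W) (p : S) (x₁ : W) :
    chartMap I J F p x₁ (extChartAt I p p) = extChartAt J x₁ (F p) := by
  simp [chartMap]

theorem chartMap_of_mem (F : S → W) {p q : S} (hq : q ∈ (extChartAt I p).source) (x₁ : W) :
    chartMap I J F p x₁ (extChartAt I p q) = extChartAt J x₁ (F q) := by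
  rw [chartMap, (extChartAt I p).left_inv hq]

variable (I) in
/-- The derivative at `x` of the chart at `x₁`. -/
def chartDeriv (x₁ x : S) : TangentSpace I x →L[ℝ] E :=
  mfderiv I 𝓘(ℝ, E) (extChartAt I x₁) x

variable (I) in
/-- The derivative at `y` of the inverse of the chart at `x₁`. -/
def chartDerivSymm (x₁ : S) (y : E) : E →L[ℝ] TangentSpace I ((extChartAt I x₁).symm y) :=
  mfderivWithin 𝓘(ℝ, E) I (extChartAt I x₁).symm (range I) y

theorem chartForm_eq_apply_chartDerivSymm (g : BilinField I S) (x₁ : S) (y u v : E) :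
    chartForm g x₁ y u v
      = g ((extChartAt I x₁).symm y) (chartDerivSymm I x₁ y u) (chartDerivSymm I x₁ y v) := rfl

theorem exists_mem_target_symm_eq {x₁ x : S} (hx : x ∈ (extChartAt I x₁).source) :
    ∃ y ∈ (extChartAt I x₁).target, (extChartAt I x₁).symm y = x :=
  ⟨_, (extChartAt I x₁).map_source hx, (extChartAt I x₁).left_inv hx⟩

theorem eventually_mem_target_and_mem_source {F : S → W} {p₀ : S} {x₁ : W} {z : E}
    (hz : z ∈ (extChartAt I p₀).target) (hF : ContinuousAt F ((extChartAt I p₀).symm z))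
    (hx : F ((extChartAt I p₀).symm z) ∈ (extChartAt J x₁).source) :
    ∀ᶠ w in 𝓝[range I] z, w ∈ (extChartAt I p₀).target ∧
      F ((extChartAt I p₀).symm w) ∈ (extChartAt J x₁).source :=
  (eventually_mem_set.2 (extChartAt_target_mem_nhdsWithin_of_mem hz)).and
    ((hF.comp_continuousWithinAt (continuousAt_extChartAt_symm'' hz).continuousWithinAt).eventually
      ((isOpen_extChartAt_source x₁).mem_nhds hx))

section ChartDeriv

variable [IsManifold I 1 S]

theorem chartDeriv_chartDerivSymm {x₁ : S} {y : E} (hy : y ∈ (extChartAt I x₁).target) (u : E) :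
    chartDeriv I x₁ ((extChartAt I x₁).symm y) (chartDerivSymm I x₁ y u) = u :=
  congrArg (fun f : E →L[ℝ] E => f u)
    (mfderiv_extChartAt_comp_mfderivWithin_extChartAt_symm (I := I) hy)

theorem chartDerivSymm_chartDeriv {x₁ : S} {y : E} (hy : y ∈ (extChartAt I x₁).target)
    (a : TangentSpace I ((extChartAt I x₁).symm y)) :
    chartDerivSymm I x₁ y (chartDeriv I x₁ ((extChartAt I x₁).symm y) a) = a :=
  congrArg (fun f : TangentSpace I ((extChartAt I x₁).symm y) →L[ℝ]
    TangentSpace I ((extChartAt I x₁).symm y) => f a)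
    (mfderivWithin_extChartAt_symm_comp_mfderiv_extChartAt (I := I) hy)

theorem chartDeriv_self (x : S) (a : TangentSpace I x) : chartDeriv I x x a = a :=
  congrArg (fun f : E →L[ℝ] E => f a) (mfderiv_extChartAt_self (I := I))

theorem chartDeriv_injective {x₁ x : S} (hx : x ∈ (extChartAt I x₁).source) :
    Function.Injective (chartDeriv I x₁ x) :=
  (isInvertible_mfderiv_extChartAt hx).injective

theorem chartDeriv_surjective {x₁ x : S} (hx : x ∈ (extChartAt I x₁).source) :
    Function.Surjective (chartDeriv I x₁ x) :=
  (isInvertible_mfderiv_extChartAt hx).surjective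

theorem chartForm_chartDeriv (g : BilinField I S) {x₁ x : S} (hx : x ∈ (extChartAt I x₁).source)
    (a b : TangentSpace I x) :
    chartForm g x₁ (extChartAt I x₁ x) (chartDeriv I x₁ x a) (chartDeriv I x₁ x b) = g x a b := by
  obtain ⟨y, hy, rfl⟩ := exists_mem_target_symm_eq hx
  rw [(extChartAt I x₁).right_inv hy, chartForm_eq_apply_chartDerivSymm,
    chartDerivSymm_chartDeriv hy, chartDerivSymm_chartDeriv hy]

variable [IsManifold J 1 W]

theorem fderivWithin_chartMap {F : S → W} {p₀ : S} {x₁ : W} {z : E}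
    (hz : z ∈ (extChartAt I p₀).target)
    (hF : MDifferentiableAt I J F ((extChartAt I p₀).symm z))
    (hx : F ((extChartAt I p₀).symm z) ∈ (extChartAt J x₁).source) (u : E) :
    fderivWithin ℝ (chartMap I J F p₀ x₁) (range I) z u
      = chartDeriv J x₁ (F ((extChartAt I p₀).symm z))
        (mfderiv I J F ((extChartAt I p₀).symm z) (chartDerivSymm I p₀ z u)) := by
  have hunique : UniqueMDiffWithinAt 𝓘(ℝ, E) (range I) z :=
    I.uniqueMDiffOn z (extChartAt_target_subset_range p₀ hz)
  rw [extChartAt_source] at hx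
  have hchart := mdifferentiableAt_extChartAt (I := J) hx
  have hcomp : chartMap I J F p₀ x₁ = (extChartAt J x₁ ∘ F) ∘ (extChartAt I p₀).symm := rfl
  rw [← mfderivWithin_eq_fderivWithin, hcomp, mfderiv_comp_mfderivWithin z (hchart.comp _ hF)
    (mdifferentiableWithinAt_extChartAt_symm hz) hunique, mfderiv_comp _ hchart hF]
  rfl

theorem inducedForm_chartMap (g : BilinField J W) {F : S → W} {p₀ : S} {x₁ : W} {z : E}
    (hz : z ∈ (extChartAt I p₀).target)
    (hF : MDifferentiableAt I J F ((extChartAt I p₀).symm z))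
    (hx : F ((extChartAt I p₀).symm z) ∈ (extChartAt J x₁).source) :
    inducedForm (chartForm g x₁) (chartMap I J F p₀ x₁) (range I) z
      = chartForm (pullback I F g) p₀ z := by
  ext u v
  rw [inducedForm_apply, fderivWithin_chartMap hz hF hx, fderivWithin_chartMap hz hF hx,
    chartMap, chartForm_chartDeriv g hx]
  rfl

theorem fderivWithin_chartMap_chartDeriv {F : S → W} {p₀ p : S} {x₁ : W}
    (hp : p ∈ (extChartAt I p₀).source) (hF : MDifferentiableAt I J F p)
    (hx : F p ∈ (extChartAt J x₁).source) (a : TangentSpace I p) :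
    fderivWithin ℝ (chartMap I J F p₀ x₁) (range I) (extChartAt I p₀ p) (chartDeriv I p₀ p a)
      = chartDeriv J x₁ (F p) (mfderiv I J F p a) := by
  obtain ⟨y, hy, rfl⟩ := exists_mem_target_symm_eq hp
  rw [(extChartAt I p₀).right_inv hy, fderivWithin_chartMap hy hF hx, chartDerivSymm_chartDeriv hy]

theorem fderivWithin_transition_chartDeriv {x₀ x₁ x : W} (hx₀ : x ∈ (extChartAt J x₀).source)
    (hx₁ : x ∈ (extChartAt J x₁).source) (a : TangentSpace J x) :
    fderivWithin ℝ (chartMap J J id x₀ x₁) (range J) (extChartAt J x₀ x) (chartDeriv J x₀ x a)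
      = chartDeriv J x₁ x a := by
  rw [fderivWithin_chartMap_chartDeriv hx₀ mdifferentiableAt_id hx₁, mfderiv_id]
  rfl

theorem fderivWithin_transition_surjective {x₀ x₁ x : W} (hx₀ : x ∈ (extChartAt J x₀).source)
    (hx₁ : x ∈ (extChartAt J x₁).source) : Function.Surjective
      (fderivWithin ℝ (chartMap J J id x₀ x₁) (range J) (extChartAt J x₀ x)) := fun c =>
  let ⟨a, ha⟩ := chartDeriv_surjective hx₁ c
  ⟨chartDeriv J x₀ x a, (fderivWithin_transition_chartDeriv hx₀ hx₁ a).trans ha⟩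

theorem inducedForm_transition (g : BilinField J W) {x₀ x₁ x : W}
    (hx₀ : x ∈ (extChartAt J x₀).source) (hx₁ : x ∈ (extChartAt J x₁).source) :
    inducedForm (chartForm g x₁) (chartMap J J id x₀ x₁) (range J)
      =ᶠ[𝓝[range J] (extChartAt J x₀ x)] chartForm g x₀ := by
  have hpullback : pullback J id g = g := by
    ext x a b
    rw [pullback, mfderiv_id]
    rfl
  have hmem := eventually_mem_target_and_mem_source (I := J) (J := J) (F := id) (x₁ := x₁)
    ((extChartAt J x₀).map_source hx₀) continuousAt_id (by rwa [id, (extChartAt J x₀).left_inv hx₀])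
  filter_upwards [hmem] with w hw
  rw [inducedForm_chartMap g hw.1 mdifferentiableAt_id hw.2, hpullback]

end ChartDeriv

variable [IsManifold I ∞ S] [IsManifold J ∞ W]

theorem isLocalMap_chartMap {F : S → W} (hF : ContMDiff I J ∞ F) {p₀ : S} {x₁ : W} {z : E}
    (hz : z ∈ (extChartAt I p₀).target)
    (hx : F ((extChartAt I p₀).symm z) ∈ (extChartAt J x₁).source) :
    IsLocalMap (chartMap I J F p₀ x₁) (range I) (range J) z where
  mem := extChartAt_target_subset_range p₀ hz
  contDiffWithinAt := by
    rw [extChartAt_source] at hx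
    have hchart : ContMDiffAt J 𝓘(ℝ, E') ∞ (extChartAt J x₁) (F ((extChartAt I p₀).symm z)) :=
      contMDiffAt_extChartAt' hx
    have hsymm : ContMDiffWithinAt 𝓘(ℝ, E) I ∞ (extChartAt I p₀).symm (range I) z :=
      contMDiffWithinAt_extChartAt_symm_range p₀ hz
    exact ((hchart.comp _ hF.contMDiffAt).comp_contMDiffWithinAt z hsymm).contDiffWithinAt.of_le
      (by norm_cast)
  eventually_mapsTo := Eventually.of_forall fun _ => mem_range_self _

theorem isLocalMap_transition {x₀ x₁ x : W} (hx₀ : x ∈ (extChartAt J x₀).source)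
    (hx₁ : x ∈ (extChartAt J x₁).source) :
    IsLocalMap (chartMap J J id x₀ x₁) (range J) (range J) (extChartAt J x₀ x) :=
  isLocalMap_chartMap contMDiff_id ((extChartAt J x₀).map_source hx₀)
    (by rwa [id, (extChartAt J x₀).left_inv hx₀])

/-- A Riemannian metric of class `C²`, expressed through its coordinate expressions. -/
structure IsSmoothMetric (g : BilinField J W) : Prop where
  isInnerForm : ∀ x, IsInnerForm (E := E') (g x)
  contDiffWithinAt_chartForm : ∀ x₁, ∀ y ∈ (extChartAt J x₁).target,
    ContDiffWithinAt ℝ 2 (chartForm g x₁) (range J) y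

namespace IsSmoothMetric

variable {g : BilinField J W}

theorem isInnerForm_chartForm (hg : IsSmoothMetric g) {x₁ : W} {y : E'}
    (hy : y ∈ (extChartAt J x₁).target) : IsInnerForm (chartForm g x₁ y) :=
  (hg.isInnerForm _).pullForm (E := E') (E' := E')
    (isInvertible_mfderivWithin_extChartAt_symm hy).injective

theorem isLocalMetric (hg : IsSmoothMetric g) {x₁ : W} {y : E'}
    (hy : y ∈ (extChartAt J x₁).target) : IsLocalMetric (chartForm g x₁) (range J) y where
  mem := extChartAt_target_subset_range x₁ hy
  contDiffWithinAt := hg.contDiffWithinAt_chartForm x₁ y hy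
  eventually_isInnerForm := by
    filter_upwards [extChartAt_target_mem_nhdsWithin_of_mem hy] with z hz
      using hg.isInnerForm_chartForm hz

variable [FiniteDimensional ℝ E']

theorem christoffel_transition (hg : IsSmoothMetric g) {x₀ x₁ x : W}
    (hx₀ : x ∈ (extChartAt J x₀).source) (hx₁ : x ∈ (extChartAt J x₁).source) (a b : E') :
    fderivWithin ℝ (chartMap J J id x₀ x₁) (range J) (extChartAt J x₀ x)
        (christoffel (chartForm g x₀) (range J) (extChartAt J x₀ x) a b)
      = mapHessian (chartForm g x₁) (chartMap J J id x₀ x₁) (range J) (range J)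
        (extChartAt J x₀ x) a b := by
  have ht := (extChartAt J x₀).map_source hx₀
  have hτ := isLocalMap_transition hx₀ hx₁
  have hind := inducedForm_transition g hx₀ hx₁
  have hG : IsLocalMetric (chartForm g x₁) (range J) (chartMap J J id x₀ x₁ (extChartAt J x₀ x)) :=
    hg.isLocalMetric (by rw [chartMap_of_mem id hx₀]; exact (extChartAt J x₁).map_source hx₁)
  have hlow : christoffelLow (inducedForm (chartForm g x₁) (chartMap J J id x₀ x₁) (range J))
      (range J) (extChartAt J x₀ x)
      = christoffelLow (chartForm g x₀) (range J) (extChartAt J x₀ x) := by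
    rw [christoffelLow, christoffelLow, hind.fderivWithin_eq (hind.self_of_nhdsWithin hτ.mem)]
  refine hG.isInnerForm.ext fun c => ?_
  obtain ⟨c, rfl⟩ := fderivWithin_transition_surjective hx₀ hx₁ c
  rw [← inducedForm_apply, hind.self_of_nhdsWithin hτ.mem, (hg.isLocalMetric ht).apply_christoffel,
    ← hlow, hτ.christoffelLow_inducedForm (isRegion_range J) hG]

theorem fderivWithin_transition_localCovDeriv (hg : IsSmoothMetric g) {x₀ x₁ x : W}
    (hx₀ : x ∈ (extChartAt J x₀).source) (hx₁ : x ∈ (extChartAt J x₁).source) {φ n : E → E'}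
    {s : Set E} {y : E} (hs : IsRegion s) (hφ : IsLocalMap φ s (range J) y)
    (hφy : φ y = extChartAt J x₀ x) (hn : DifferentiableWithinAt ℝ n s y) (u : E) :
    fderivWithin ℝ (chartMap J J id x₀ x₁) (range J) (φ y)
        (localCovDeriv (chartForm g x₀) φ n s (range J) y u)
      = fderivWithin ℝ (fun w => fderivWithin ℝ (chartMap J J id x₀ x₁) (range J) (φ w) (n w)) s y u
        + christoffel (chartForm g x₁) (range J) (extChartAt J x₁ x)
          (fderivWithin ℝ (chartMap J J id x₀ x₁) (range J) (φ y) (fderivWithin ℝ φ s y u))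
          (fderivWithin ℝ (chartMap J J id x₀ x₁) (range J) (φ y) (n y)) := by
  have hτ : IsLocalMap (chartMap J J id x₀ x₁) (range J) (range J) (φ y) :=
    hφy ▸ isLocalMap_transition hx₀ hx₁
  have hderiv := ((hφ.comp_hasFDerivWithinAt (hτ.differentiableWithinAt_fderivWithin
    (isRegion_range J))).clm_apply hn.hasFDerivWithinAt).fderivWithin (hs.uniqueDiffOn y hφ.mem)
  rw [localCovDeriv_apply, map_add, hderiv, hφy, hg.christoffel_transition hx₀ hx₁, mapHessian,
    chartMap_of_mem id hx₀ x₁, id]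
  simp only [add_apply, ContinuousLinearMap.comp_apply, ContinuousLinearMap.flip_apply]
  rw [add_assoc]

end IsSmoothMetric

end ChartExpressions

section CovariantDerivative

variable {E : Type*} [NormedAddCommGroup E] [NormedSpace ℝ E]
  {H : Type*} [TopologicalSpace H] {I : ModelWithCorners ℝ E H}
  {S : Type*} [TopologicalSpace S] [ChartedSpace H S]
  {E' : Type*} [NormedAddCommGroup E'] [NormedSpace ℝ E']
  {H' : Type*} [TopologicalSpace H'] {J : ModelWithCorners ℝ E' H'}
  {W : Type*} [TopologicalSpace W] [ChartedSpace H' W]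
  {F : S → W} {X : ∀ p, TangentSpace J (F p)}

/-- The coordinate expression of a vector field along `F` in the charts at `p₀` and `F p₀`. -/
def chartFieldMap (I : ModelWithCorners ℝ E H) (F : S → W) (X : ∀ p, TangentSpace J (F p))
    (p₀ : S) (y : E) : E' :=
  chartField F X p₀ ((extChartAt I p₀).symm y)

theorem chartField_apply {S : Type*} (F : S → W) (X : ∀ p, TangentSpace J (F p)) (p₀ p : S) :
    chartField F X p₀ p = chartDeriv J (F p₀) (F p) (X p) := rfl

theorem chartFieldMap_apply (F : S → W) (X : ∀ p, TangentSpace J (F p)) (p₀ : S) (z : E) :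
    chartFieldMap I F X p₀ z = chartDeriv J (F p₀) (F ((extChartAt I p₀).symm z))
      (X ((extChartAt I p₀).symm z)) := rfl

theorem contMDiffAt_chartField [IsManifold J 1 W]
    (hX : ContMDiff I J.tangent ∞ (fun p => (⟨F p, X p⟩ : TangentBundle J W))) (p : S) :
    ContMDiffAt I 𝓘(ℝ, E') ∞ (chartField F X p) p := by
  obtain ⟨hF, htriv⟩ := Bundle.contMDiffAt_totalSpace.1 (hX p)
  refine htriv.congr_of_eventuallyEq ?_
  filter_upwards [hF.continuousAt.eventually
    ((chartAt H' (F p)).open_source.mem_nhds (mem_chart_source H' (F p)))] with q hq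
  rw [chartField_apply, chartDeriv, ← TangentBundle.continuousLinearMapAt_trivializationAt hq,
    Bundle.Trivialization.continuousLinearMapAt_apply,
    Bundle.Trivialization.coe_linearMapAt_of_mem _ hq]

theorem chartField_symm_eventuallyEq [IsManifold J 1 W] (hF : Continuous F) {p₀ : S} {z : E}
    (hz : z ∈ (extChartAt I p₀).target)
    (hx : F ((extChartAt I p₀).symm z) ∈ (extChartAt J (F p₀)).source) :
    (fun w => chartField F X ((extChartAt I p₀).symm z) ((extChartAt I p₀).symm w))
      =ᶠ[𝓝[range I] z] fun w =>
        fderivWithin ℝ (chartMap J J id (F p₀) (F ((extChartAt I p₀).symm z))) (range J)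
          (chartMap I J F p₀ (F p₀) w) (chartFieldMap I F X p₀ w) := by
  filter_upwards [eventually_mem_target_and_mem_source hz hF.continuousAt hx,
    eventually_mem_target_and_mem_source (J := J) hz hF.continuousAt (mem_extChartAt_source _)]
    with w hw₀ hw
  rw [chartFieldMap_apply, chartField_apply, chartMap,
    fderivWithin_transition_chartDeriv hw₀.2 hw.2]

theorem fderivWithin_chartField_symm [IsManifold I 1 S] [IsManifold J 1 W]
    (hX : ContMDiff I J.tangent ∞ (fun p => (⟨F p, X p⟩ : TangentBundle J W))) {p₀ : S} {z : E}
    (hz : z ∈ (extChartAt I p₀).target) (u : E) :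
    fderivWithin ℝ (fun w => chartField F X ((extChartAt I p₀).symm z) ((extChartAt I p₀).symm w))
        (range I) z u
      = mfderiv I 𝓘(ℝ, E') (chartField F X ((extChartAt I p₀).symm z)) ((extChartAt I p₀).symm z)
        (chartDerivSymm I p₀ z u) := by
  have hcomp := mfderiv_comp_mfderivWithin z
    ((contMDiffAt_chartField hX ((extChartAt I p₀).symm z)).mdifferentiableAt (by simp))
    (mdifferentiableWithinAt_extChartAt_symm hz)
    (I.uniqueMDiffOn z (extChartAt_target_subset_range p₀ hz))
  rw [mfderivWithin_eq_fderivWithin] at hcomp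
  exact congrArg (fun f : E →L[ℝ] E' => f u) hcomp

variable [IsManifold I ∞ S] [IsManifold J ∞ W] [FiniteDimensional ℝ E'] {g : BilinField J W}

namespace IsSmoothMetric

theorem localCovDeriv_chartFieldMap (hg : IsSmoothMetric g) (hF : ContMDiff I J ∞ F)
    (hX : ContMDiff I J.tangent ∞ (fun p => (⟨F p, X p⟩ : TangentBundle J W))) {p₀ : S} {z : E}
    (hz : z ∈ (extChartAt I p₀).target)
    (hx : F ((extChartAt I p₀).symm z) ∈ (extChartAt J (F p₀)).source)
    (hn : DifferentiableWithinAt ℝ (chartFieldMap I F X p₀) (range I) z) (u : E) :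
    localCovDeriv (chartForm g (F p₀)) (chartMap I J F p₀ (F p₀)) (chartFieldMap I F X p₀)
        (range I) (range J) z u
      = chartDeriv J (F p₀) (F ((extChartAt I p₀).symm z))
        (covDerivAlong I F g X ((extChartAt I p₀).symm z) (chartDerivSymm I p₀ z u)) := by
  have hx_self := mem_extChartAt_source (I := J) (F ((extChartAt I p₀).symm z))
  have hfield := chartField_symm_eventuallyEq (X := X) hF.continuous hz hx
  have htransition := hg.fderivWithin_transition_localCovDeriv hx hx_self (isRegion_range I)
    (isLocalMap_chartMap hF hz hx) rfl hn u
  rw [← hfield.fderivWithin_eq (hfield.self_of_nhdsWithin (extChartAt_target_subset_range p₀ hz)),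
    fderivWithin_chartField_symm hX hz,
    fderivWithin_chartMap hz (hF.mdifferentiableAt (by simp)) hx, chartFieldMap_apply, chartMap,
    fderivWithin_transition_chartDeriv hx hx_self,
    fderivWithin_transition_chartDeriv hx hx_self, chartDeriv_self, chartDeriv_self] at htransition
  obtain ⟨a, ha⟩ := chartDeriv_surjective hx (localCovDeriv (chartForm g (F p₀))
    (chartMap I J F p₀ (F p₀)) (chartFieldMap I F X p₀) (range I) (range J) z u)
  rw [← ha, fderivWithin_transition_chartDeriv hx hx_self, chartDeriv_self] at htransition
  rw [← ha, htransition]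
  rfl

theorem localCovDeriv_chartFieldMap_extChartAt (hg : IsSmoothMetric g) (hF : ContMDiff I J ∞ F)
    (hX : ContMDiff I J.tangent ∞ (fun p => (⟨F p, X p⟩ : TangentBundle J W))) {p q : S}
    (hq : q ∈ (extChartAt I p).source) (hx : F q ∈ (extChartAt J (F p)).source)
    (hn : DifferentiableWithinAt ℝ (chartFieldMap I F X p) (range I) (extChartAt I p q))
    (u : TangentSpace I q) :
    localCovDeriv (chartForm g (F p)) (chartMap I J F p (F p)) (chartFieldMap I F X p) (range I)
        (range J) (extChartAt I p q) (chartDeriv I p q u)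
      = chartDeriv J (F p) (F q) (covDerivAlong I F g X q u) := by
  obtain ⟨z, hz, rfl⟩ := exists_mem_target_symm_eq hq
  rw [(extChartAt I p).right_inv hz] at hn ⊢
  rw [hg.localCovDeriv_chartFieldMap hF hX hz hx hn, chartDerivSymm_chartDeriv hz]

end IsSmoothMetric

end CovariantDerivative

section CoordCongr

variable {E : Type*} [NormedAddCommGroup E] [NormedSpace ℝ E]
  {G₁ G₂ : E → E →L[ℝ] E →L[ℝ] ℝ} {s : Set E} {y : E}

theorem coordGrad_congr (hG : G₁ =ᶠ[𝓝[s] y] G₂) {f₁ f₂ : E → ℝ} (hf : f₁ =ᶠ[𝓝[s] y] f₂) :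
    coordGrad G₁ s f₁ =ᶠ[𝓝[s] y] coordGrad G₂ s f₂ := by
  filter_upwards [hG, hf.fderivWithin (𝕜 := ℝ)] with z hGz hfz
  rw [coordGrad, coordGrad, hGz, hfz]

theorem coordDiv_congr (hy : y ∈ s) (hG : G₁ =ᶠ[𝓝[s] y] G₂) {X₁ X₂ : E → E}
    (hX : X₁ =ᶠ[𝓝[s] y] X₂) : coordDiv G₁ s X₁ y = coordDiv G₂ s X₂ y := by
  rw [coordDiv, coordDiv, christoffel_congr hG hy, hX.fderivWithin_eq (hX.self_of_nhdsWithin hy),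
    hX.self_of_nhdsWithin hy]

end CoordCongr

section Manifold

variable {E : Type*} [NormedAddCommGroup E] [NormedSpace ℝ E]
  {H : Type*} [TopologicalSpace H] {I : ModelWithCorners ℝ E H}
  {S : Type*} [TopologicalSpace S] [ChartedSpace H S]
  {E' : Type*} [NormedAddCommGroup E'] [NormedSpace ℝ E']
  {H' : Type*} [TopologicalSpace H'] {J : ModelWithCorners ℝ E' H'}
  {W : Type*} [TopologicalSpace W] [ChartedSpace H' W]
  {g : BilinField J W} {F : S → W} {N : ∀ p, TangentSpace J (F p)}

theorem apply_grad [FiniteDimensional ℝ E'] {x : W} (hg : IsInnerForm (E := E') (g x)) (f : W → ℝ)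
    (v : TangentSpace J x) : g x (grad g f x) v = mfderiv J 𝓘(ℝ, ℝ) f x v :=
  hg.apply_inverse (mfderiv J 𝓘(ℝ, ℝ) f x : E' →L[ℝ] ℝ) v

theorem map_symm_extChartAt_mem_source (F : S → W) (p : S) :
    F ((extChartAt I p).symm (extChartAt I p p)) ∈ (extChartAt J (F p)).source := by
  rw [(extChartAt I p).left_inv (mem_extChartAt_source p)]
  exact mem_extChartAt_source _

variable (I J) in
theorem eventually_mem_charts (hF : Continuous F) (p : S) :
    ∀ᶠ w in 𝓝[range I] (extChartAt I p p), w ∈ (extChartAt I p).target ∧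
      F ((extChartAt I p).symm w) ∈ (extChartAt J (F p)).source :=
  eventually_mem_target_and_mem_source (mem_extChartAt_target p) hF.continuousAt
    (map_symm_extChartAt_mem_source F p)

theorem chartFun_comp_eventuallyEq (ψ : W → ℝ) (hF : Continuous F) (p : S) :
    (fun z => chartFun J ψ (F p) (chartMap I J F p (F p) z))
      =ᶠ[𝓝[range I] (extChartAt I p p)] chartFun I (ψ ∘ F) p := by
  filter_upwards [eventually_mem_charts I J hF p] with w hw
  rw [chartFun, chartFun, chartMap, (extChartAt J (F p)).left_inv hw.2, Function.comp_apply]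

section IsManifoldOne

variable [IsManifold J 1 W]

theorem chartForm_self (g : BilinField J W) (x : W) :
    chartForm g x (extChartAt J x x) = (g x : E' →L[ℝ] E' →L[ℝ] ℝ) := by
  have happly (a b : TangentSpace J x) : chartForm g x (extChartAt J x x) a b = g x a b := by
    rw [← chartForm_chartDeriv g (mem_extChartAt_source x) a b, chartDeriv_self, chartDeriv_self]
  ext a b
  exact happly a b

theorem chartFieldMap_self (N : ∀ p, TangentSpace J (F p)) (p : S) :
    chartFieldMap I F N p (extChartAt I p p) = N p := by
  rw [chartFieldMap, (extChartAt I p).left_inv (mem_extChartAt_source p), chartField_apply,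
    chartDeriv_self]

theorem fderivWithin_chartFun {f : W → ℝ} {x₀ x : W} (hf : MDifferentiableAt J 𝓘(ℝ, ℝ) f x)
    (hx : x ∈ (extChartAt J x₀).source) (a : TangentSpace J x) :
    fderivWithin ℝ (chartFun J f x₀) (range J) (extChartAt J x₀ x) (chartDeriv J x₀ x a)
      = mfderiv J 𝓘(ℝ, ℝ) f x a := by
  obtain ⟨y, hy, rfl⟩ := exists_mem_target_symm_eq hx
  have hcomp := mfderiv_comp_mfderivWithin y hf (mdifferentiableWithinAt_extChartAt_symm hy)
    (J.uniqueMDiffOn y (extChartAt_target_subset_range x₀ hy))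
  rw [mfderivWithin_eq_fderivWithin] at hcomp
  rw [(extChartAt J x₀).right_inv hy]
  exact (congrArg (fun f : E' →L[ℝ] ℝ => f (chartDeriv J x₀ ((extChartAt J x₀).symm y) a))
    hcomp).trans (congrArg _ (chartDerivSymm_chartDeriv hy a))

theorem fderivWithin_chartFun_self {f : W → ℝ} {x : W} (hf : MDifferentiableAt J 𝓘(ℝ, ℝ) f x) :
    fderivWithin ℝ (chartFun J f x) (range J) (extChartAt J x x)
      = (mfderiv J 𝓘(ℝ, ℝ) f x : E' →L[ℝ] ℝ) := by
  have happly (a : TangentSpace J x) : fderivWithin ℝ (chartFun J f x) (range J)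
      (extChartAt J x x) a = mfderiv J 𝓘(ℝ, ℝ) f x a := by
    rw [← fderivWithin_chartFun hf (mem_extChartAt_source x), chartDeriv_self]
  ext a
  exact happly a

theorem coordGrad_chartFun_self {x : W} {f : W → ℝ} (hf : MDifferentiableAt J 𝓘(ℝ, ℝ) f x) :
    coordGrad (chartForm g x) (range J) (chartFun J f x) (extChartAt J x x) = grad g f x := by
  rw [coordGrad, chartForm_self, fderivWithin_chartFun_self hf]
  rfl

/-- A parallel vector field `V`, equal to the constant `ξ` in all charts, whose contractions with
the curvature tensor vanish. -/
structure IsParallelField (g : BilinField J W) (V : ∀ x : W, TangentSpace J x) (ξ : E') : Prop where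
  chartDeriv_eq : ∀ x₀ x : W, x ∈ (extChartAt J x₀).source → chartDeriv J x₀ x (V x) = ξ
  isLocallyParallel :
    ∀ x : W, IsLocallyParallel (chartForm g x) (range J) ξ (extChartAt J x x)
  curvatureEnd_eq_zero :
    ∀ (x : W) (u w : E'), curvatureEnd (chartForm g x) (range J) (extChartAt J x x) ξ w u = 0

namespace IsParallelField

variable {V : ∀ x : W, TangentSpace J x} {ξ : E'}

theorem apply_eq (hV : IsParallelField g V ξ) (x : W) : V x = ξ := by
  rw [← hV.chartDeriv_eq x x (mem_extChartAt_source x), chartDeriv_self]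

theorem localAngle_eventuallyEq (hV : IsParallelField g V ξ) (hF : Continuous F)
    (N : ∀ p, TangentSpace J (F p)) (p : S) :
    localAngle (chartForm g (F p)) (chartMap I J F p (F p)) (chartFieldMap I F N p) ξ
      =ᶠ[𝓝[range I] (extChartAt I p p)] chartFun I (fun p => g (F p) (V (F p)) (N p)) p := by
  filter_upwards [eventually_mem_charts I J hF p] with w hw
  rw [localAngle, chartFun, ← hV.chartDeriv_eq _ _ hw.2, chartFieldMap_apply, chartMap,
    chartForm_chartDeriv g hw.2]

end IsParallelField

variable [IsManifold I 1 S]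

theorem chartDerivSymm_injective {x₁ : S} {y : E} (hy : y ∈ (extChartAt I x₁).target) :
    Function.Injective (chartDerivSymm I x₁ y) :=
  Function.LeftInverse.injective (g := chartDeriv I x₁ ((extChartAt I x₁).symm y))
    (chartDeriv_chartDerivSymm hy)

/-- The derivative of the inverse of a chart as a linear equivalence. -/
def chartDerivEquiv {x₁ : S} {y : E} (hy : y ∈ (extChartAt I x₁).target) :
    E ≃ₗ[ℝ] TangentSpace I ((extChartAt I x₁).symm y) where
  toLinearMap := (chartDerivSymm I x₁ y).toLinearMap
  invFun := chartDeriv I x₁ ((extChartAt I x₁).symm y)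
  left_inv := chartDeriv_chartDerivSymm hy
  right_inv := chartDerivSymm_chartDeriv hy

theorem inducedForm_chartMap_eventuallyEq (g : BilinField J W) (hF : ContMDiff I J ∞ F) (p : S) :
    inducedForm (chartForm g (F p)) (chartMap I J F p (F p)) (range I)
      =ᶠ[𝓝[range I] (extChartAt I p p)] chartForm (pullback I F g) p := by
  filter_upwards [eventually_mem_charts I J hF.continuous p] with w hw
    using inducedForm_chartMap g hw.1 (hF.mdifferentiableAt (by simp)) hw.2

end IsManifoldOne

theorem isInnerForm_pullback (hg : ∀ x, IsInnerForm (E := E') (g x))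
    (hF : IsSmoothImmersion I J F) (p : S) : IsInnerForm (E := E) (pullback I F g p) :=
  (hg (F p)).pullForm (E := E) (E' := E') (hF.2 p)

variable [IsManifold J ∞ W]

theorem contDiffWithinAt_chartFun {f : W → ℝ} (hf : ContMDiff J 𝓘(ℝ, ℝ) ∞ f) {x₀ : W} {y : E'}
    (hy : y ∈ (extChartAt J x₀).target) : ContDiffWithinAt ℝ 2 (chartFun J f x₀) (range J) y :=
  (hf.contMDiffAt.comp_contMDiffWithinAt y
    (contMDiffWithinAt_extChartAt_symm_range x₀ hy)).contDiffWithinAt.of_le (by norm_cast)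

variable [IsManifold I ∞ S]

theorem contDiffWithinAt_chartFieldMap
    (hX : ContMDiff I J.tangent ∞ (fun p => (⟨F p, N p⟩ : TangentBundle J W))) (p : S) :
    ContDiffWithinAt ℝ 2 (chartFieldMap I F N p) (range I) (extChartAt I p p) := by
  have hfield : ContMDiffAt I 𝓘(ℝ, E') ∞ (chartField F N p)
      ((extChartAt I p).symm (extChartAt I p p)) := by
    rw [(extChartAt I p).left_inv (mem_extChartAt_source p)]
    exact contMDiffAt_chartField hX p
  exact (hfield.comp_contMDiffWithinAt _ (contMDiffWithinAt_extChartAt_symm_range p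
    (mem_extChartAt_target p))).contDiffWithinAt.of_le (by norm_cast)

theorem IsGaussMap.isLocalHypersurface (hN : IsGaussMap I F g N) (hg : IsSmoothMetric g)
    (hF : IsSmoothImmersion I J F) (hdim : Module.finrank ℝ E' = Module.finrank ℝ E + 1) (p : S) :
    IsLocalHypersurface (chartForm g (F p)) (chartMap I J F p (F p)) (chartFieldMap I F N p)
      (range I) (range J) (extChartAt I p p) where
  isRegion := isRegion_range I
  isRegion_target := isRegion_range J
  isLocalMap := isLocalMap_chartMap hF.1 (mem_extChartAt_target p)
    (map_symm_extChartAt_mem_source F p)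
  isLocalMetric_target := hg.isLocalMetric (by
    rw [chartMap_self]
    exact mem_extChartAt_target _)
  eventually_injective := by
    filter_upwards [eventually_mem_charts I J hF.1.continuous p] with w hw u₁ u₂ hu
    have hFw : MDifferentiableAt I J F ((extChartAt I p).symm w) := hF.1.mdifferentiableAt (by simp)
    rw [fderivWithin_chartMap hw.1 hFw hw.2, fderivWithin_chartMap hw.1 hFw hw.2] at hu
    exact chartDerivSymm_injective hw.1 (hF.2 _ (chartDeriv_injective hw.2 hu))
  contDiffWithinAt_normal := contDiffWithinAt_chartFieldMap hN.smooth p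
  eventually_unit := by
    filter_upwards [eventually_mem_charts I J hF.1.continuous p] with w hw
    rw [chartFieldMap_apply, chartMap, chartForm_chartDeriv g hw.2, hN.unit]
  eventually_orthogonal := by
    filter_upwards [eventually_mem_charts I J hF.1.continuous p] with w hw u
    rw [chartFieldMap_apply, fderivWithin_chartMap hw.1 (hF.1.mdifferentiableAt (by simp)) hw.2,
      chartMap, chartForm_chartDeriv g hw.2, hN.normal]
  finrank_eq := hdim

end Manifold

section ShapeOperator

variable {E : Type*} [NormedAddCommGroup E] [NormedSpace ℝ E]
  {H : Type*} [TopologicalSpace H] {I : ModelWithCorners ℝ E H}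
  {S : Type*} [TopologicalSpace S] [ChartedSpace H S] [IsManifold I ∞ S]
  {E' : Type*} [NormedAddCommGroup E'] [NormedSpace ℝ E']
  {H' : Type*} [TopologicalSpace H'] {J : ModelWithCorners ℝ E' H'}
  {W : Type*} [TopologicalSpace W] [ChartedSpace H' W] [IsManifold J ∞ W]
  {g : BilinField J W} {F : S → W} {N : ∀ p, TangentSpace J (F p)}

variable (I) in
/-- The shape operator of a hypersurface with Gauss map `N`, in the charts at `p` and `F p`. -/
def chartShapeOp (g : BilinField J W) (F : S → W) (N : ∀ p, TangentSpace J (F p)) (p : S) :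
    E → E →L[ℝ] E :=
  shapeOp (chartForm g (F p)) (chartMap I J F p (F p)) (chartFieldMap I F N p) (range I) (range J)

variable (I) in
/-- The squared norm `|σ|² = trace S²` of the second fundamental form of a hypersurface. -/
def secondFFNormSq [FiniteDimensional ℝ E] (g : BilinField J W) (F : S → W)
    (N : ∀ p, TangentSpace J (F p)) (p : S) : ℝ :=
  traceForm (chartShapeOp I g F N p (extChartAt I p p)
    ∘L chartShapeOp I g F N p (extChartAt I p p))

variable [FiniteDimensional ℝ E] [FiniteDimensional ℝ E']

theorem secondFF_eq_zero_of_chartShapeOp_eq_zero (hg : IsSmoothMetric g)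
    (hF : IsSmoothImmersion I J F) (hN : IsGaussMap I F g N)
    (hdim : Module.finrank ℝ E' = Module.finrank ℝ E + 1) {p : S}
    (hS : chartShapeOp I g F N p (extChartAt I p p) = 0) (u w : TangentSpace I p) :
    secondFF I F g N p u w = 0 := by
  have hlocal := hN.isLocalHypersurface hg hF hdim p
  have hcov : covDerivAlong I F g N p u = 0 := by
    have hcov := hg.localCovDeriv_chartFieldMap_extChartAt hF.1 hN.smooth (mem_extChartAt_source p)
      (mem_extChartAt_source _) hlocal.differentiableWithinAt_normal u
    rw [hlocal.localCovDeriv_normal, ← chartShapeOp, hS, zero_apply, map_zero, neg_zero,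
      chartDeriv_self] at hcov
    exact hcov.symm
  rw [secondFF, hcov, map_zero, zero_apply, neg_zero]

theorem secondFFNormSq_nonneg (hg : IsSmoothMetric g) (hF : IsSmoothImmersion I J F)
    (hN : IsGaussMap I F g N) (hdim : Module.finrank ℝ E' = Module.finrank ℝ E + 1) (p : S) :
    0 ≤ secondFFNormSq I g F N p :=
  let h := hN.isLocalHypersurface hg hF hdim p
  h.isLocalMetric.isInnerForm.trace_comp_self_nonneg h.shapeOp_symm

theorem secondFF_eq_zero_of_secondFFNormSq_eq_zero (hg : IsSmoothMetric g)
    (hF : IsSmoothImmersion I J F) (hN : IsGaussMap I F g N)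
    (hdim : Module.finrank ℝ E' = Module.finrank ℝ E + 1) {p : S}
    (hS : secondFFNormSq I g F N p = 0) (u w : TangentSpace I p) : secondFF I F g N p u w = 0 :=
  let h := hN.isLocalHypersurface hg hF hdim p
  secondFF_eq_zero_of_chartShapeOp_eq_zero hg hF hN hdim
    (h.isLocalMetric.isInnerForm.eq_zero_of_trace_comp_self_eq_zero h.shapeOp_symm hS) u w

theorem pullback_chartDerivSymm_chartShapeOp (hg : IsSmoothMetric g) (hF : IsSmoothImmersion I J F)
    (hN : IsGaussMap I F g N) {p : S} {z : E} (hz : z ∈ (extChartAt I p).target)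
    (hx : F ((extChartAt I p).symm z) ∈ (extChartAt J (F p)).source)
    (h : IsLocalHypersurface (chartForm g (F p)) (chartMap I J F p (F p)) (chartFieldMap I F N p)
      (range I) (range J) z) (u w : E) :
    pullback I F g ((extChartAt I p).symm z) (chartDerivSymm I p z (chartShapeOp I g F N p z u))
        (chartDerivSymm I p z w)
      = -g (F ((extChartAt I p).symm z))
          (covDerivAlong I F g N ((extChartAt I p).symm z) (chartDerivSymm I p z u))
          (mfderiv I J F ((extChartAt I p).symm z) (chartDerivSymm I p z w)) := by
  have hFz : MDifferentiableAt I J F ((extChartAt I p).symm z) := hF.1.mdifferentiableAt (by simp)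
  have hshape := h.inducedForm_shapeOp u w
  rwa [hg.localCovDeriv_chartFieldMap hF.1 hN.smooth hz hx h.differentiableWithinAt_normal,
    fderivWithin_chartMap hz hFz hx, chartMap, chartForm_chartDeriv g hx,
    inducedForm_chartMap g hz hFz hx, chartForm_eq_apply_chartDerivSymm] at hshape

theorem divAlong_gaussMap (hg : IsSmoothMetric g) (hF : IsSmoothImmersion I J F)
    (hN : IsGaussMap I F g N) {p : S} {z : E} (hz : z ∈ (extChartAt I p).target)
    (hx : F ((extChartAt I p).symm z) ∈ (extChartAt J (F p)).source)
    (h : IsLocalHypersurface (chartForm g (F p)) (chartMap I J F p (F p)) (chartFieldMap I F N p)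
      (range I) (range J) z) :
    divAlong I F g N ((extChartAt I p).symm z) = -traceForm (chartShapeOp I g F N p z) := by
  set q := (extChartAt I p).symm z
  set B : TangentSpace I q →L[ℝ] TangentSpace I q →L[ℝ] ℝ :=
    ContinuousLinearMap.precomp ℝ (mfderiv I J F q) ∘L g (F q) ∘L covDerivAlong I F g N q
  have hinner := isInnerForm_pullback hg.isInnerForm hF q
  have hconj : ((pullback I F g q).inverse ∘L B).toLinearMap
      = (chartDerivEquiv hz).conj (-(chartShapeOp I g F N p z).toLinearMap) := by
    ext a
    obtain ⟨u, rfl⟩ := (chartDerivEquiv hz).surjective a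
    rw [LinearEquiv.conj_apply_apply, LinearEquiv.symm_apply_apply]
    refine hinner.ext fun b => ?_
    obtain ⟨w, rfl⟩ := (chartDerivEquiv hz).surjective b
    have hneg : pullback I F g q (chartDerivSymm I p z (-(chartShapeOp I g F N p z u)))
        (chartDerivSymm I p z w) = B (chartDerivSymm I p z u) (chartDerivSymm I p z w) := by
      rw [map_neg, map_neg, neg_apply, pullback_chartDerivSymm_chartShapeOp hg hF hN hz hx h,
        neg_neg]
      rfl
    exact (hinner.apply_inverse (B (chartDerivSymm I p z u)) _).trans hneg.symm
  rw [divAlong, hconj, LinearMap.trace_conj', map_neg, traceForm_apply]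

theorem weightedMeanCurvature_eq (hg : IsSmoothMetric g) (hF : IsSmoothImmersion I J F)
    (hN : IsGaussMap I F g N) {ψ : W → ℝ} (hψ : MDifferentiable J 𝓘(ℝ, ℝ) ψ) {p : S} {z : E}
    (hz : z ∈ (extChartAt I p).target)
    (hx : F ((extChartAt I p).symm z) ∈ (extChartAt J (F p)).source)
    (h : IsLocalHypersurface (chartForm g (F p)) (chartMap I J F p (F p)) (chartFieldMap I F N p)
      (range I) (range J) z) :
    weightedMeanCurvature I F g ψ N ((extChartAt I p).symm z)
      = traceForm (chartShapeOp I g F N p z) - fderivWithin ℝ (chartFun J ψ (F p)) (range J)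
          (chartMap I J F p (F p) z) (chartFieldMap I F N p z) := by
  rw [weightedMeanCurvature, divAlong_gaussMap hg hF hN hz hx h, apply_grad (hg.isInnerForm _),
    chartFieldMap_apply, chartMap, fderivWithin_chartFun (hψ _) hx]
  exact (neg_add _ _).trans (congrArg (· + _) (neg_neg _))

variable {V : ∀ x : W, TangentSpace J x} {ξ : E'}

theorem IsParallelField.driftedLaplacian_angle (hV : IsParallelField g V ξ) (hg : IsSmoothMetric g)
    (hF : IsSmoothImmersion I J F) (hN : IsGaussMap I F g N)
    (hdim : Module.finrank ℝ E' = Module.finrank ℝ E + 1)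
    {ψ : W → ℝ} (hψ : ContMDiff J 𝓘(ℝ, ℝ) ∞ ψ) {a : ℝ}
    (hH : ∀ p, weightedMeanCurvature I F g ψ N p = a) {p : S}
    (hθ : MDifferentiableAt I 𝓘(ℝ, ℝ) (fun p => g (F p) (V (F p)) (N p)) p) :
    driftedLaplacian (pullback I F g) (ψ ∘ F) (fun p => g (F p) (V (F p)) (N p)) p
      = -g (F p) (V (F p)) (N p) * (ricciBE g ψ (F p) (N p) (N p) + secondFFNormSq I g F N p)
        - hessian g ψ (F p) (V (F p)) (N p) := by
  have h := hN.isLocalHypersurface hg hF hdim p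
  have hbase : chartMap I J F p (F p) (extChartAt I p p) = extChartAt J (F p) (F p) :=
    chartMap_self F p (F p)
  have hmean : ∀ᶠ z in 𝓝[range I] (extChartAt I p p), traceForm (chartShapeOp I g F N p z)
      - fderivWithin ℝ (chartFun J ψ (F p)) (range J)
          (chartMap I J F p (F p) z) (chartFieldMap I F N p z) = a := by
    filter_upwards [eventually_mem_charts I J hF.1.continuous p, h.eventually] with w hw hlocal
    rw [← weightedMeanCurvature_eq hg hF hN (hψ.mdifferentiable (by simp)) hw.1 hw.2 hlocal, hH]
  have hmetric := inducedForm_chartMap_eventuallyEq g hF.1 p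
  have hψF := chartFun_comp_eventuallyEq (I := I) (J := J) ψ hF.1.continuous p
  have hgrad := coordGrad_congr hmetric (hV.localAngle_eventuallyEq hF.1.continuous N p)
  have hlaplace := h.coordDiv_coordGrad_localAngle_add_drift
    (hbase ▸ hV.isLocallyParallel _) (hbase ▸ hV.curvatureEnd_eq_zero _)
    (contDiffWithinAt_chartFun hψ (hbase ▸ mem_extChartAt_target _)) hmean
  rw [coordDiv_congr h.mem hmetric hgrad, hgrad.self_of_nhdsWithin h.mem,
    coordGrad_chartFun_self hθ, localAngle, hbase, chartFieldMap_self,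
    hψF.fderivWithin_eq (hψF.self_of_nhdsWithin h.mem),
    fderivWithin_chartFun_self ((hψ.comp hF.1).mdifferentiableAt (by simp)), chartForm_self,
    ← hV.apply_eq (F p)] at hlaplace
  rw [driftedLaplacian, apply_grad (isInnerForm_pullback hg.isInnerForm hF p)]
  exact hlaplace

end ShapeOperator

section ProductCoordinates

variable {E : Type*} [NormedAddCommGroup E] [NormedSpace ℝ E]

theorem fderiv_fderiv_apply {v : ℝ → ℝ} (hv : ContDiff ℝ 2 v) (t x y : ℝ) :
    fderiv ℝ (fderiv ℝ v) t x y = x * y * deriv (deriv v) t := by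
  have hdv : DifferentiableAt ℝ (fderiv ℝ v) t :=
    (hv.fderiv_right (m := 1) (by norm_num)).differentiable (by simp) t
  have hone : deriv (deriv v) t = fderiv ℝ (fderiv ℝ v) t 1 1 := by
    change fderiv ℝ (fun r => fderiv ℝ v r 1) t 1 = _
    rw [fderiv_clm_apply hdv (differentiableAt_const _)]
    simp
  calc fderiv ℝ (fderiv ℝ v) t x y = fderiv ℝ (fderiv ℝ v) t (x • 1) (y • 1) := by simp
    _ = x * y * deriv (deriv v) t := by
      rw [map_smul, map_smul, smul_apply, smul_eq_mul, smul_eq_mul, hone]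
      ring

/-- The pull-back of bilinear forms to `E × ℝ`. -/
def liftForm : (E →L[ℝ] E →L[ℝ] ℝ) →L[ℝ] (E × ℝ →L[ℝ] E × ℝ →L[ℝ] ℝ) :=
  (ContinuousLinearMap.postcomp (E × ℝ)
      (ContinuousLinearMap.precomp ℝ (ContinuousLinearMap.fst ℝ E ℝ)))
    ∘L (ContinuousLinearMap.precomp (E →L[ℝ] ℝ) (ContinuousLinearMap.fst ℝ E ℝ))

theorem liftForm_apply (A : E →L[ℝ] E →L[ℝ] ℝ) (a b : E × ℝ) : liftForm A a b = A a.1 b.1 := rfl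

/-- The form `dt²` on `E × ℝ`. -/
def lineForm : E × ℝ →L[ℝ] E × ℝ →L[ℝ] ℝ :=
  pullForm (innerSL ℝ : ℝ →L[ℝ] ℝ →L[ℝ] ℝ) (ContinuousLinearMap.snd ℝ E ℝ)

theorem lineForm_apply (a b : E × ℝ) : lineForm a b = a.2 * b.2 := by
  change inner ℝ a.2 b.2 = _
  simp [mul_comm]

/-- The product of a form on `E` and `dt²`. -/
def prodForm (A : E →L[ℝ] E →L[ℝ] ℝ) : E × ℝ →L[ℝ] E × ℝ →L[ℝ] ℝ := liftForm A + lineForm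

theorem prodForm_apply (A : E →L[ℝ] E →L[ℝ] ℝ) (a b : E × ℝ) :
    prodForm A a b = A a.1 b.1 + a.2 * b.2 := by
  rw [prodForm, add_apply, add_apply, liftForm_apply, lineForm_apply]

theorem IsInnerForm.prodForm {A : E →L[ℝ] E →L[ℝ] ℝ} (hA : IsInnerForm A) :
    IsInnerForm (prodForm A) where
  symm a b := by
    rw [prodForm_apply, prodForm_apply, hA.symm, mul_comm]
  pos a ha := by
    rw [prodForm_apply]
    by_cases hfst : a.1 = 0
    · have hsnd : a.2 ≠ 0 := fun hsnd => ha (Prod.ext hfst hsnd)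
      rw [hfst, map_zero, zero_add]
      exact mul_self_pos.2 hsnd
    · exact add_pos_of_pos_of_nonneg (hA.pos _ hfst) (mul_self_nonneg _)

/-- The Christoffel symbols of a product with a line, in terms of those of the first factor. -/
def liftChristoffel : (E →L[ℝ] E →L[ℝ] E) →L[ℝ] (E × ℝ →L[ℝ] E × ℝ →L[ℝ] E × ℝ) :=
  (ContinuousLinearMap.postcomp (E × ℝ)
      ((ContinuousLinearMap.postcomp (E × ℝ) (ContinuousLinearMap.inl ℝ E ℝ))
        ∘L (ContinuousLinearMap.precomp E (ContinuousLinearMap.fst ℝ E ℝ))))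
    ∘L (ContinuousLinearMap.precomp (E →L[ℝ] E) (ContinuousLinearMap.fst ℝ E ℝ))

theorem liftChristoffel_apply (A : E →L[ℝ] E →L[ℝ] E) (a b : E × ℝ) :
    liftChristoffel A a b = (A a.1 b.1, 0) := rfl

variable {G : E → E →L[ℝ] E →L[ℝ] ℝ} {G' : E × ℝ → E × ℝ →L[ℝ] E × ℝ →L[ℝ] ℝ} {s : Set E}
  {z : E × ℝ}

theorem tendsto_fst_nhdsWithin {X : Type*} [TopologicalSpace X] (s : Set X) (z : X × ℝ) :
    Tendsto Prod.fst (𝓝[s ×ˢ (univ : Set ℝ)] z) (𝓝[s] z.1) :=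
  tendsto_nhdsWithin_iff.2 ⟨continuousAt_fst.continuousWithinAt,
    eventually_mem_nhdsWithin.mono fun _ hw => hw.1⟩

theorem hasFDerivWithinAt_comp_fst {F : Type*} [NormedAddCommGroup F] [NormedSpace ℝ F]
    {f : E → F} {f' : E →L[ℝ] F} (hf : HasFDerivWithinAt f f' s z.1) :
    HasFDerivWithinAt (fun w : E × ℝ => f w.1) (f' ∘L ContinuousLinearMap.fst ℝ E ℝ)
      (s ×ˢ univ) z :=
  hf.comp_of_tendsto z hasFDerivWithinAt_fst (tendsto_fst_nhdsWithin s z)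

theorem hasFDerivWithinAt_comp_fst_add_comp_snd {F : Type*} [NormedAddCommGroup F]
    [NormedSpace ℝ F] {f : E → F} {f' : E →L[ℝ] F} {v : ℝ → F} {v' : ℝ →L[ℝ] F}
    (hf : HasFDerivWithinAt f f' s z.1) (hv : HasFDerivAt v v' z.2) :
    HasFDerivWithinAt (fun w : E × ℝ => f w.1 + v w.2)
      (f' ∘L ContinuousLinearMap.fst ℝ E ℝ + v' ∘L ContinuousLinearMap.snd ℝ E ℝ)
      (s ×ˢ univ) z :=
  (hasFDerivWithinAt_comp_fst hf).add (hv.comp_hasFDerivWithinAt z hasFDerivWithinAt_snd)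

/-- `G'` is, near `z`, the product metric `G + dt²` on `s × ℝ`. -/
structure IsLineProduct (G' : E × ℝ → E × ℝ →L[ℝ] E × ℝ →L[ℝ] ℝ) (G : E → E →L[ℝ] E →L[ℝ] ℝ)
    (s : Set E) (z : E × ℝ) : Prop where
  isRegion : IsRegion s
  isLocalMetric_fst : IsLocalMetric G s z.1
  eventually_eq : ∀ᶠ w in 𝓝[s ×ˢ univ] z, G' w = prodForm (G w.1)

namespace IsLineProduct

theorem mem (h : IsLineProduct G' G s z) : z ∈ s ×ˢ (univ : Set ℝ) :=
  ⟨h.isLocalMetric_fst.mem, mem_univ _⟩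

theorem uniqueDiffOn (h : IsLineProduct G' G s z) : UniqueDiffOn ℝ (s ×ˢ (univ : Set ℝ)) :=
  h.isRegion.uniqueDiffOn.prod uniqueDiffOn_univ

theorem apply_eq (h : IsLineProduct G' G s z) : G' z = prodForm (G z.1) :=
  h.eventually_eq.self_of_nhdsWithin h.mem

theorem eventually (h : IsLineProduct G' G s z) :
    ∀ᶠ w in 𝓝[s ×ˢ univ] z, IsLineProduct G' G s w := by
  filter_upwards [(tendsto_fst_nhdsWithin s z).eventually h.isLocalMetric_fst.eventually,
    eventually_eventually_nhdsWithin.2 h.eventually_eq] with w hmetric heq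
    using ⟨h.isRegion, hmetric, heq⟩

theorem isLocalMetric (h : IsLineProduct G' G s z) : IsLocalMetric G' (s ×ˢ univ) z where
  mem := h.mem
  contDiffWithinAt := by
    have hfst : ContDiffWithinAt ℝ 2 (fun w : E × ℝ => G w.1) (s ×ˢ univ) z :=
      h.isLocalMetric_fst.contDiffWithinAt.comp z contDiffWithinAt_fst fun w hw => hw.1
    exact (((liftForm (E := E)).contDiff.contDiffAt.comp_contDiffWithinAt z hfst).add
      (contDiffWithinAt_const (c := lineForm (E := E)))).congr_of_eventuallyEq h.eventually_eq
      h.apply_eq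
  eventually_isInnerForm := by
    filter_upwards [h.eventually] with w hw
    rw [hw.apply_eq]
    exact hw.isLocalMetric_fst.isInnerForm.prodForm

theorem fderivWithin_eq (h : IsLineProduct G' G s z) : fderivWithin ℝ G' (s ×ˢ univ) z
    = (liftForm ∘L fderivWithin ℝ G s z.1) ∘L ContinuousLinearMap.fst ℝ E ℝ :=
  (((hasFDerivWithinAt_comp_fst ((liftForm (E := E)).hasFDerivAt.comp_hasFDerivWithinAt _
    h.isLocalMetric_fst.differentiableWithinAt.hasFDerivWithinAt)).add_const
      lineForm).congr_of_eventuallyEq h.eventually_eq h.apply_eq).fderivWithin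
    (h.uniqueDiffOn z h.mem)

variable [FiniteDimensional ℝ E]

theorem christoffel_eq (h : IsLineProduct G' G s z) :
    christoffel G' (s ×ˢ univ) z = liftChristoffel (christoffel G s z.1) := by
  refine ContinuousLinearMap.ext fun a => ContinuousLinearMap.ext fun b =>
    h.isLocalMetric.isInnerForm.ext fun c => ?_
  rw [h.isLocalMetric.apply_christoffel, h.apply_eq, prodForm_apply, liftChristoffel_apply,
    h.isLocalMetric_fst.apply_christoffel, christoffelLow_apply, christoffelLow_apply,
    h.fderivWithin_eq]
  simp only [ContinuousLinearMap.comp_apply, liftForm_apply, ContinuousLinearMap.coe_fst']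
  ring

theorem fderivWithin_christoffel (h : IsLineProduct G' G s z) (a : E × ℝ) :
    fderivWithin ℝ (christoffel G' (s ×ˢ univ)) (s ×ˢ univ) z a
      = liftChristoffel (fderivWithin ℝ (christoffel G s) s z.1 a.1) := by
  have hlift := hasFDerivWithinAt_comp_fst
    ((liftChristoffel (E := E)).hasFDerivAt.comp_hasFDerivWithinAt _
      ((h.isLocalMetric_fst.contDiffWithinAt_christoffel h.isRegion).differentiableWithinAt
        (by simp)).hasFDerivWithinAt)
  have hderiv := hlift.congr_of_eventuallyEq (f₁ := christoffel G' (s ×ˢ univ))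
    (h.eventually.mono fun w hw => hw.christoffel_eq) h.christoffel_eq
  rw [hderiv.fderivWithin (h.uniqueDiffOn z h.mem)]
  rfl

theorem curvatureEnd_eq (h : IsLineProduct G' G s z) (u v w : E × ℝ) :
    curvatureEnd G' (s ×ˢ univ) z v w u = (curvatureEnd G s z.1 v.1 w.1 u.1, 0) := by
  rw [curvatureEnd_apply, curvatureEnd_apply, h.fderivWithin_christoffel,
    h.fderivWithin_christoffel, h.christoffel_eq]
  simp [liftChristoffel_apply]

theorem coordRicci_eq (h : IsLineProduct G' G s z) (v w : E × ℝ) :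
    coordRicci G' (s ×ˢ univ) z v w = coordRicci G s z.1 v.1 w.1 := by
  have hprodMap : (curvatureEnd G' (s ×ˢ univ) z v w).toLinearMap
      = (curvatureEnd G s z.1 v.1 w.1).toLinearMap.prodMap (0 : ℝ →ₗ[ℝ] ℝ) :=
    LinearMap.ext fun u => h.curvatureEnd_eq u v w
  rw [coordRicci, hprodMap, LinearMap.trace_prodMap', map_zero, add_zero]
  rfl

theorem isLocallyParallel (h : IsLineProduct G' G s z) :
    IsLocallyParallel G' (s ×ˢ univ) (0, 1) z := by
  filter_upwards [h.eventually] with w hw u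
  rw [hw.christoffel_eq, liftChristoffel_apply, map_zero, Prod.mk_zero_zero]

theorem curvatureEnd_vertical (h : IsLineProduct G' G s z) (u w : E × ℝ) :
    curvatureEnd G' (s ×ˢ univ) z (0, 1) w u = 0 := by
  rw [h.curvatureEnd_eq, curvatureEnd_apply]
  simp

theorem coordHessian_eq (h : IsLineProduct G' G s z) {f : E → ℝ}
    (hf : ContDiffWithinAt ℝ 2 f s z.1) {v : ℝ → ℝ} (hv : ContDiff ℝ 2 v) (a b : E × ℝ) :
    coordHessian G' (s ×ˢ univ) (fun w => f w.1 + v w.2) z a b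
      = coordHessian G s f z.1 a.1 b.1 + a.2 * b.2 * deriv (deriv v) z.2 := by
  have hdv : Differentiable ℝ (fderiv ℝ v) :=
    (hv.fderiv_right (m := 1) (by norm_num)).differentiable (by simp)
  have hdf : DifferentiableWithinAt ℝ (fderivWithin ℝ f s) s z.1 :=
    (hf.fderivWithin_right h.isRegion.uniqueDiffOn (m := 1) (by norm_num)
      h.isLocalMetric_fst.mem).differentiableWithinAt (by simp)
  have hfirst (w : E × ℝ) (hw : w ∈ s ×ˢ univ) (hfw : DifferentiableWithinAt ℝ f s w.1) :
      fderivWithin ℝ (fun w : E × ℝ => f w.1 + v w.2) (s ×ˢ univ) w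
        = ContinuousLinearMap.precomp ℝ (ContinuousLinearMap.fst ℝ E ℝ) (fderivWithin ℝ f s w.1)
          + ContinuousLinearMap.precomp ℝ (ContinuousLinearMap.snd ℝ E ℝ) (fderiv ℝ v w.2) :=
    (hasFDerivWithinAt_comp_fst_add_comp_snd hfw.hasFDerivWithinAt
      (hv.differentiable (by simp) w.2).hasFDerivAt).fderivWithin (h.uniqueDiffOn w hw)
  have hf_eventually := hf.eventually (by simp)
  rw [insert_eq_of_mem h.isLocalMetric_fst.mem] at hf_eventually
  have hfirst_eventually := (eventually_mem_nhdsWithin (a := z) (s := s ×ˢ univ)).and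
    ((tendsto_fst_nhdsWithin s z).eventually hf_eventually) |>.mono fun w hw =>
      hfirst w hw.1 (hw.2.differentiableWithinAt (by simp))
  have hsecond := ((hasFDerivWithinAt_comp_fst_add_comp_snd
    ((ContinuousLinearMap.precomp ℝ (ContinuousLinearMap.fst ℝ E ℝ)
      ).hasFDerivAt.comp_hasFDerivWithinAt _ hdf.hasFDerivWithinAt)
    ((ContinuousLinearMap.precomp ℝ (ContinuousLinearMap.snd ℝ E ℝ)
      ).hasFDerivAt.comp _ (hdv z.2).hasFDerivAt)).congr_of_eventuallyEq hfirst_eventually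
      (hfirst_eventually.self_of_nhdsWithin h.mem)).fderivWithin (h.uniqueDiffOn z h.mem)
  rw [coordHessian, coordHessian, hsecond, hfirst z h.mem (hf.differentiableWithinAt (by simp)),
    h.christoffel_eq, liftChristoffel_apply, ← fderiv_fderiv_apply hv]
  simp only [add_apply, ContinuousLinearMap.comp_apply, ContinuousLinearMap.coe_fst',
    ContinuousLinearMap.coe_snd', map_zero, add_zero, ContinuousLinearMap.precomp_apply]
  ring

end IsLineProduct

end ProductCoordinates

section SmoothMetric

variable {E : Type*} [NormedAddCommGroup E] [NormedSpace ℝ E]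
  {H : Type*} [TopologicalSpace H] {I : ModelWithCorners ℝ E H}
  {M : Type*} [TopologicalSpace M] [ChartedSpace H M]

theorem contDiffWithinAt_of_apply [FiniteDimensional ℝ E] {D F : Type*}
    [NormedAddCommGroup D] [NormedSpace ℝ D] [NormedAddCommGroup F] [NormedSpace ℝ F]
    {f : D → E →L[ℝ] F} {s : Set D} {n : ℕ∞ω} {y : D}
    (h : ∀ u, ContDiffWithinAt ℝ n (fun z => f z u) s y) : ContDiffWithinAt ℝ n f s y := by
  let coordinates := ContinuousLinearEquiv.ofFinrankEq
    (Module.finrank_fin_fun (n := Module.finrank ℝ E) ℝ).symm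
  let columns := (coordinates.arrowCongr (1 : F ≃L[ℝ] F)).trans
    (ContinuousLinearEquiv.piRing (Fin (Module.finrank ℝ E)))
  rw [← Function.id_comp f, ← columns.symm_comp_self]
  exact columns.symm.contDiff.contDiffAt.comp_contDiffWithinAt y
    (contDiffWithinAt_pi.2 fun i => h _)

theorem symm_extChartAt_mem_chartAt_source {x₁ : M} {y : E} (hy : y ∈ (extChartAt I x₁).target) :
    (extChartAt I x₁).symm y ∈ (chartAt H x₁).source := by
  rw [← extChartAt_source I]
  exact (extChartAt I x₁).map_target hy

theorem chartForm_eq_symmL [IsManifold I 1 M] (g : BilinField I M) {x₁ : M} {y : E}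
    (hy : y ∈ (extChartAt I x₁).target) (u w : E) :
    chartForm g x₁ y u w = g ((extChartAt I x₁).symm y)
      ((trivializationAt E (TangentSpace I) x₁).symmL ℝ ((extChartAt I x₁).symm y) u)
      ((trivializationAt E (TangentSpace I) x₁).symmL ℝ ((extChartAt I x₁).symm y) w) := by
  rw [TangentBundle.symmL_trivializationAt (symm_extChartAt_mem_chartAt_source hy),
    (extChartAt I x₁).right_inv hy]
  rfl

theorem contMDiffAt_symmL_trivializationAt [IsManifold I ∞ M] {x₁ x : M}
    (hx : x ∈ (chartAt H x₁).source) (a : E) :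
    ContMDiffAt I (I.prod 𝓘(ℝ, E)) ∞ (fun m : M => Bundle.TotalSpace.mk' E (E := TangentSpace I) m
      ((trivializationAt E (TangentSpace I) x₁).symmL ℝ m a)) x :=
  ((trivializationAt E (TangentSpace I) x₁).contMDiffAt_symmL (n := ∞) (IB := I)
    (by simpa using hx)).clm_bundle_apply (E₁ := Bundle.Trivial M E)
    (Bundle.contMDiffAt_totalSpace.2 ⟨contMDiffAt_id, contMDiffAt_const⟩)

theorem isSmoothMetric_inner [FiniteDimensional ℝ E] [IsManifold I ∞ M]
    (g : Bundle.ContMDiffRiemannianMetric I ∞ E (fun x : M => TangentSpace I x)) :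
    IsSmoothMetric (J := I) g.inner where
  isInnerForm x := ⟨g.symm x, fun u hu => g.pos x u hu⟩
  contDiffWithinAt_chartForm x₁ y hy := by
    refine ContDiffWithinAt.of_le (n := ∞)
      (contDiffWithinAt_of_apply fun u => contDiffWithinAt_of_apply fun w => ?_) (by norm_cast)
    have hframe :=
      contMDiffAt_symmL_trivializationAt (I := I) (symm_extChartAt_mem_chartAt_source hy)
    have hinner := (g.contMDiff ((extChartAt I x₁).symm y)).clm_bundle_apply₂
      (E₃ := Bundle.Trivial M ℝ) (hframe u) (hframe w)
    have hcoord := ((Bundle.contMDiffAt_totalSpace.1 hinner).2.comp_contMDiffWithinAt y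
      (contMDiffWithinAt_extChartAt_symm_range (n := ∞) x₁ hy)).contDiffWithinAt
    refine hcoord.congr_of_eventuallyEq ?_ (chartForm_eq_symmL g.inner hy u w)
    filter_upwards [extChartAt_target_mem_nhdsWithin_of_mem hy] with z hz
      using chartForm_eq_symmL g.inner hz u w

end SmoothMetric

section ConstantMetric

variable {E : Type*} [NormedAddCommGroup E] [NormedSpace ℝ E]

theorem christoffel_const (B : E →L[ℝ] E →L[ℝ] ℝ) (s : Set E) :
    christoffel (fun _ => B) s = fun _ => 0 := by
  funext y
  have hlow (a b : E) : christoffelLow (fun _ => B) s y a b = 0 := by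
    ext c
    rw [christoffelLow_apply]
    simp
  ext a b
  rw [christoffel_apply, hlow, zero_apply, zero_apply]
  exact map_zero B.inverse

theorem coordRicci_const (B : E →L[ℝ] E →L[ℝ] ℝ) (s : Set E) (y a b : E) :
    coordRicci (fun _ => B) s y a b = 0 := by
  have hcurvature : curvatureEnd (fun _ => B) s y a b = 0 := by
    ext u
    rw [curvatureEnd_apply, christoffel_const]
    simp
  rw [coordRicci, hcurvature, ContinuousLinearMap.toLinearMap_zero, map_zero]

theorem coordHessian_const (B : E →L[ℝ] E →L[ℝ] ℝ) (s : Set E) (f : E → ℝ) (y a b : E) :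
    coordHessian (fun _ => B) s f y a b = fderivWithin ℝ (fderivWithin ℝ f s) s y a b := by
  rw [coordHessian, christoffel_const]
  simp

end ConstantMetric

section Line

theorem lineMetric_apply (t : ℝ) (a b : ℝ) : lineMetric t a b = a * b := by
  change inner ℝ a b = _
  simp [mul_comm]

theorem chartForm_lineMetric (t : ℝ) :
    chartForm lineMetric t = fun _ => (innerSL ℝ : ℝ →L[ℝ] ℝ →L[ℝ] ℝ) := by
  have hid (y : ℝ) : (mfderivWithin 𝓘(ℝ, ℝ) 𝓘(ℝ, ℝ) (extChartAt 𝓘(ℝ, ℝ) t).symm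
      (range 𝓘(ℝ, ℝ)) y : ℝ →L[ℝ] ℝ) = ContinuousLinearMap.id ℝ ℝ := by
    rw [extChartAt_model_space_eq_id, modelWithCornersSelf_coe, range_id, mfderivWithin_univ]
    exact mfderiv_id
  funext y
  refine ContinuousLinearMap.ext fun a => ContinuousLinearMap.ext fun b => ?_
  exact congrArg₂ (fun c d : ℝ => inner ℝ c d) (congrArg (· a) (hid y)) (congrArg (· b) (hid y))

theorem ricciBE_lineMetric {v : ℝ → ℝ} (hv : ContDiff ℝ 2 v) (t a b : ℝ) :
    ricciBE lineMetric v t a b = -(a * b * deriv (deriv v) t) := by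
  have hchartFun : chartFun 𝓘(ℝ, ℝ) v t = v := by
    funext y
    rw [chartFun, extChartAt_model_space_eq_id]
    rfl
  have hchart : extChartAt 𝓘(ℝ, ℝ) t t = t := by
    rw [extChartAt_model_space_eq_id]
    rfl
  change coordRicci (chartForm lineMetric t) (range 𝓘(ℝ, ℝ)) (extChartAt 𝓘(ℝ, ℝ) t t) a b
    - coordHessian (chartForm lineMetric t) (range 𝓘(ℝ, ℝ)) (chartFun 𝓘(ℝ, ℝ) v t)
      (extChartAt 𝓘(ℝ, ℝ) t t) a b = _
  rw [chartForm_lineMetric, coordRicci_const, coordHessian_const, modelWithCornersSelf_coe,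
    range_id, fderivWithin_univ, fderivWithin_univ, hchartFun, hchart, fderiv_fderiv_apply hv,
    zero_sub]

end Line

section Product

variable {E : Type*} [NormedAddCommGroup E] [NormedSpace ℝ E]
  {H : Type*} [TopologicalSpace H] {I : ModelWithCorners ℝ E H}
  {M : Type*} [TopologicalSpace M] [ChartedSpace H M] {g : BilinField I M}

theorem cylMetric_apply (g : BilinField I M) (x : M × ℝ)
    (a b : TangentSpace (I.prod 𝓘(ℝ, ℝ)) x) :
    cylMetric g x a b = g x.1 a.1 b.1 + (a.2 : ℝ) * (b.2 : ℝ) := by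
  have hfst : mfderiv (I.prod 𝓘(ℝ, ℝ)) I Prod.fst x
      = ContinuousLinearMap.fst ℝ (TangentSpace I x.1) (TangentSpace 𝓘(ℝ, ℝ) x.2) := mfderiv_fst
  have hsnd : mfderiv (I.prod 𝓘(ℝ, ℝ)) 𝓘(ℝ, ℝ) Prod.snd x
      = ContinuousLinearMap.snd ℝ (TangentSpace I x.1) (TangentSpace 𝓘(ℝ, ℝ) x.2) := mfderiv_snd
  change g x.1 (mfderiv (I.prod 𝓘(ℝ, ℝ)) I Prod.fst x a) (mfderiv (I.prod 𝓘(ℝ, ℝ)) I Prod.fst x b)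
    + lineMetric x.2 (mfderiv (I.prod 𝓘(ℝ, ℝ)) 𝓘(ℝ, ℝ) Prod.snd x a)
      (mfderiv (I.prod 𝓘(ℝ, ℝ)) 𝓘(ℝ, ℝ) Prod.snd x b) = _
  rw [hfst, hsnd]
  exact congrArg (_ + ·) (lineMetric_apply x.2 a.2 b.2)

theorem cylMetric_eq_prodForm (g : BilinField I M) (x : M × ℝ) :
    (cylMetric g x : E × ℝ →L[ℝ] E × ℝ →L[ℝ] ℝ) = prodForm (E := E) (g x.1) :=
  ContinuousLinearMap.ext fun a => ContinuousLinearMap.ext fun b =>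
    (cylMetric_apply g x a b).trans (prodForm_apply (E := E) (g x.1) a b).symm

theorem range_prod_real : range (I.prod 𝓘(ℝ, ℝ)) = range I ×ˢ (univ : Set ℝ) := by
  rw [ModelWithCorners.range_prod, modelWithCornersSelf_coe, range_id]

theorem extChartAt_prod_real (x : M × ℝ) :
    extChartAt (I.prod 𝓘(ℝ, ℝ)) x = (extChartAt I x.1).prod (PartialEquiv.refl ℝ) := by
  rw [extChartAt_prod, extChartAt_model_space_eq_id]

theorem extChartAt_prod_real_apply (x y : M × ℝ) :
    extChartAt (I.prod 𝓘(ℝ, ℝ)) x y = (extChartAt I x.1 y.1, y.2) := by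
  rw [extChartAt_prod_real]
  rfl

theorem mem_extChartAt_prod_real_source {x y : M × ℝ} :
    y ∈ (extChartAt (I.prod 𝓘(ℝ, ℝ)) x).source ↔ y.1 ∈ (extChartAt I x.1).source := by
  rw [extChartAt_prod_real]
  simp

theorem fst_mem_extChartAt_target {x : M × ℝ} {w : E × ℝ}
    (hw : w ∈ (extChartAt (I.prod 𝓘(ℝ, ℝ)) x).target) : w.1 ∈ (extChartAt I x.1).target := by
  rw [extChartAt_prod_real] at hw
  exact hw.1

theorem chartFun_prodWeight (h : M → ℝ) (v : ℝ → ℝ) (x : M × ℝ) :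
    chartFun (I.prod 𝓘(ℝ, ℝ)) (prodWeight h v) x = fun w => chartFun I h x.1 w.1 + v w.2 := by
  funext w
  rw [chartFun, chartFun, prodWeight, extChartAt_prod_real]
  rfl

section IsManifoldOne

variable [IsManifold I 1 M]

theorem chartDeriv_prod {x y : M × ℝ} (hy : y.1 ∈ (extChartAt I x.1).source)
    (a : TangentSpace (I.prod 𝓘(ℝ, ℝ)) y) :
    chartDeriv (I.prod 𝓘(ℝ, ℝ)) x y a = (chartDeriv I x.1 y.1 a.1, a.2) := by
  have hchart : HasMFDerivAt I 𝓘(ℝ, E) (extChartAt I x.1) y.1 (chartDeriv I x.1 y.1) := by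
    rw [extChartAt_source] at hy
    exact (mdifferentiableAt_extChartAt hy).hasMFDerivAt
  have hfst : HasMFDerivAt (I.prod 𝓘(ℝ, ℝ)) 𝓘(ℝ, E) (extChartAt I x.1 ∘ Prod.fst) y
      (chartDeriv I x.1 y.1 ∘L ContinuousLinearMap.fst ℝ (TangentSpace I y.1) ℝ) :=
    hchart.comp y (hasMFDerivAt_fst (I' := 𝓘(ℝ, ℝ)) y)
  have hprod : HasMFDerivAt (I.prod 𝓘(ℝ, ℝ)) 𝓘(ℝ, E × ℝ)
      (fun y => ((extChartAt I x.1 ∘ Prod.fst) y, y.2)) y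
      ((chartDeriv I x.1 y.1 ∘L ContinuousLinearMap.fst ℝ (TangentSpace I y.1) ℝ).prod
        (ContinuousLinearMap.snd ℝ (TangentSpace I y.1) ℝ)) :=
    ⟨hfst.1.prodMk continuousAt_snd,
      hfst.2.prodMk (hasMFDerivAt_snd (I := I) (I' := 𝓘(ℝ, ℝ)) y).2⟩
  have hchart_prod : (extChartAt (I.prod 𝓘(ℝ, ℝ)) x : M × ℝ → E × ℝ)
      = fun y => ((extChartAt I x.1 ∘ Prod.fst) y, y.2) :=
    funext (extChartAt_prod_real_apply x)
  rw [chartDeriv, hchart_prod, hprod.mfderiv]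
  rfl

theorem chartForm_cylMetric (g : BilinField I M) {x y : M × ℝ}
    (hy : y ∈ (extChartAt (I.prod 𝓘(ℝ, ℝ)) x).source) :
    chartForm (cylMetric g) x (extChartAt (I.prod 𝓘(ℝ, ℝ)) x y)
      = prodForm (chartForm g x.1 (extChartAt (I.prod 𝓘(ℝ, ℝ)) x y).1) := by
  have hy₁ := mem_extChartAt_prod_real_source.1 hy
  refine ContinuousLinearMap.ext fun A => ContinuousLinearMap.ext fun B => ?_
  obtain ⟨a, rfl⟩ := chartDeriv_surjective hy A
  obtain ⟨b, rfl⟩ := chartDeriv_surjective hy B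
  rw [chartForm_chartDeriv _ hy, prodForm_apply, chartDeriv_prod hy₁, chartDeriv_prod hy₁,
    extChartAt_prod_real_apply]
  exact (cylMetric_apply g y a b).trans
    (congrArg (· + _) (chartForm_chartDeriv g hy₁ a.1 b.1).symm)

end IsManifoldOne

variable [IsManifold I ∞ M]

theorem IsSmoothMetric.isLineProduct (hg : IsSmoothMetric g) {x : M × ℝ} {w : E × ℝ}
    (hw : w ∈ (extChartAt (I.prod 𝓘(ℝ, ℝ)) x).target) :
    IsLineProduct (chartForm (cylMetric g) x) (chartForm g x.1) (range I) w where
  isRegion := isRegion_range I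
  isLocalMetric_fst := hg.isLocalMetric (fst_mem_extChartAt_target hw)
  eventually_eq := by
    rw [← range_prod_real]
    filter_upwards [extChartAt_target_mem_nhdsWithin_of_mem hw] with z hz
    have hform := chartForm_cylMetric g ((extChartAt (I.prod 𝓘(ℝ, ℝ)) x).map_target hz)
    rwa [(extChartAt (I.prod 𝓘(ℝ, ℝ)) x).right_inv hz] at hform

theorem IsSmoothMetric.cylMetric (hg : IsSmoothMetric g) : IsSmoothMetric (cylMetric g) where
  isInnerForm x := cylMetric_eq_prodForm g x ▸ (hg.isInnerForm x.1).prodForm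
  contDiffWithinAt_chartForm x w hw := by
    rw [range_prod_real]
    exact (hg.isLineProduct hw).isLocalMetric.contDiffWithinAt

theorem IsSmoothMetric.isLineProduct_extChartAt (hg : IsSmoothMetric g) (x : M × ℝ) :
    IsLineProduct (chartForm (WeightedGeom.cylMetric g) x) (chartForm g x.1) (range I)
      (extChartAt I x.1 x.1, x.2) :=
  extChartAt_prod_real_apply (I := I) x x ▸ hg.isLineProduct (mem_extChartAt_target x)

variable [FiniteDimensional ℝ E]

theorem isParallelField_vertical (hg : IsSmoothMetric g) :
    IsParallelField (cylMetric g) (vertical I) (0, 1) where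
  chartDeriv_eq x₀ x hx := by
    rw [chartDeriv_prod (mem_extChartAt_prod_real_source.1 hx)]
    exact Prod.ext (map_zero _) rfl
  isLocallyParallel x := by
    rw [range_prod_real, extChartAt_prod_real_apply]
    exact (hg.isLineProduct_extChartAt x).isLocallyParallel
  curvatureEnd_eq_zero x u w := by
    rw [range_prod_real, extChartAt_prod_real_apply]
    exact (hg.isLineProduct_extChartAt x).curvatureEnd_vertical u w

theorem christoffelAt_cylMetric (hg : IsSmoothMetric g) (x : M × ℝ)
    (a b : TangentSpace (I.prod 𝓘(ℝ, ℝ)) x) :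
    christoffelAt (cylMetric g) x a b = (christoffelAt g x.1 a.1 b.1, (0 : ℝ)) := by
  rw [christoffelAt, christoffelAt, range_prod_real, extChartAt_prod_real_apply,
    (hg.isLineProduct_extChartAt x).christoffel_eq]
  rfl

theorem ricci_cylMetric (hg : IsSmoothMetric g) (x : M × ℝ)
    (a b : TangentSpace (I.prod 𝓘(ℝ, ℝ)) x) :
    ricci (cylMetric g) x a b = ricci g x.1 a.1 b.1 := by
  unfold ricci
  rw [range_prod_real, extChartAt_prod_real_apply]
  exact (hg.isLineProduct_extChartAt x).coordRicci_eq a b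

variable {h : M → ℝ} {v : ℝ → ℝ}

theorem hessian_prodWeight (hg : IsSmoothMetric g) (hh : ContMDiff I 𝓘(ℝ, ℝ) ∞ h)
    (hv : ContDiff ℝ ∞ v) (x : M × ℝ) (a b : TangentSpace (I.prod 𝓘(ℝ, ℝ)) x) :
    hessian (cylMetric g) (prodWeight h v) x a b
      = hessian g h x.1 a.1 b.1 + (a.2 : ℝ) * (b.2 : ℝ) * deriv (deriv v) x.2 := by
  unfold hessian
  rw [range_prod_real, extChartAt_prod_real_apply, chartFun_prodWeight]
  exact (hg.isLineProduct_extChartAt x).coordHessian_eq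
    (contDiffWithinAt_chartFun hh (mem_extChartAt_target x.1)) (hv.of_le (by norm_cast)) a b

theorem ricciBE_prodWeight (hg : IsSmoothMetric g) (hh : ContMDiff I 𝓘(ℝ, ℝ) ∞ h)
    (hv : ContDiff ℝ ∞ v) (x : M × ℝ) (a b : TangentSpace (I.prod 𝓘(ℝ, ℝ)) x) :
    ricciBE (cylMetric g) (prodWeight h v) x a b
      = ricciBE g h x.1 a.1 b.1 - (a.2 : ℝ) * (b.2 : ℝ) * deriv (deriv v) x.2 :=
  (congrArg₂ (· - ·) (ricci_cylMetric hg x a b) (hessian_prodWeight hg hh hv x a b)).trans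
    (sub_sub _ _ _).symm

end Product

section Angle

variable {E : Type*} [NormedAddCommGroup E] [NormedSpace ℝ E]
  {H : Type*} [TopologicalSpace H] {I : ModelWithCorners ℝ E H}
  {M : Type*} [TopologicalSpace M] [ChartedSpace H M]

theorem angle_eq_snd {S : Type*} {F : S → M × ℝ} {N : ∀ p, TangentSpace (I.prod 𝓘(ℝ, ℝ)) (F p)}
    (g : BilinField I M) (p : S) : angle g F N p = (N p).2 := by
  have hvertical (b : TangentSpace I (F p).1) (r : ℝ) :
      g (F p).1 (0 : TangentSpace I (F p).1) b + (1 : ℝ) * r = r := by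
    rw [map_zero, zero_apply, zero_add, one_mul]
  exact (cylMetric_apply g (F p) (vertical I (F p)) (N p)).trans (hvertical (N p).1 (N p).2)

variable {E₀ : Type*} [NormedAddCommGroup E₀] [NormedSpace ℝ E₀]
  {H₀ : Type*} [TopologicalSpace H₀] {I₀ : ModelWithCorners ℝ E₀ H₀}
  {S : Type*} [TopologicalSpace S] [ChartedSpace H₀ S] {F : S → M × ℝ}

theorem mfderiv_snd_comp (hF : MDifferentiable I₀ (I.prod 𝓘(ℝ, ℝ)) F) (p : S)
    (u : TangentSpace I₀ p) :
    mfderiv I₀ 𝓘(ℝ, ℝ) (fun q => (F q).2) p u = (mfderiv I₀ (I.prod 𝓘(ℝ, ℝ)) F p u).2 := by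
  have hcomp := mfderiv_comp p (mdifferentiableAt_snd (I := I) (I' := 𝓘(ℝ, ℝ)) (x := F p)) (hF p)
  rw [mfderiv_snd] at hcomp
  exact congrArg (fun f : TangentSpace I₀ p →L[ℝ] ℝ => f u) hcomp

variable [IsManifold I 1 M] {N : ∀ p, TangentSpace (I.prod 𝓘(ℝ, ℝ)) (F p)} {g : BilinField I M}

theorem apply_normal_fst_eq_one_sub_angle_sq (hN : IsGaussMap I₀ F (cylMetric g) N) (p : S) :
    g (F p).1 (N p).1 (N p).1 = 1 - angle g F N p ^ 2 := by
  have hunit := (cylMetric_apply g (F p) (N p) (N p)).symm.trans (hN.unit p)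
  rw [angle_eq_snd]
  linear_combination hunit

theorem contMDiff_angle (hN : IsGaussMap I₀ F (cylMetric g) N) :
    ContMDiff I₀ 𝓘(ℝ, ℝ) ∞ (angle g F N) := by
  intro p
  have hsnd : ContMDiffAt I₀ 𝓘(ℝ, ℝ) ∞ (fun q => (chartField F N p q).2) p :=
    (ContinuousLinearMap.snd ℝ E ℝ).contMDiff.contMDiffAt.comp p
      (contMDiffAt_chartField hN.smooth p)
  have hF : ContinuousAt F p :=
    ((Bundle.contMDiffAt_totalSpace.1 (hN.smooth p)).1).continuousAt
  refine hsnd.congr_of_eventuallyEq ?_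
  filter_upwards [hF.eventually ((isOpen_extChartAt_source (F p)).mem_nhds
    (mem_extChartAt_source (I := I.prod 𝓘(ℝ, ℝ)) (F p)))] with q hq
  rw [angle_eq_snd, chartField_apply, chartDeriv_prod (mem_extChartAt_prod_real_source.1 hq)]

end Angle

section DriftedLaplacian

variable {E : Type*} [NormedAddCommGroup E] [NormedSpace ℝ E]

theorem coordHessian_zero_left (G : E → E →L[ℝ] E →L[ℝ] ℝ) (s : Set E) (f : E → ℝ) (y w : E) :
    coordHessian G s f y 0 w = 0 := by
  simp [coordHessian]

theorem coordRicci_zero_left (G : E → E →L[ℝ] E →L[ℝ] ℝ) (s : Set E) (y w : E) :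
    coordRicci G s y 0 w = 0 := by
  simp [coordRicci, curvatureEnd]

variable {H : Type*} [TopologicalSpace H] {I : ModelWithCorners ℝ E H}
  {M : Type*} [TopologicalSpace M] [ChartedSpace H M]

theorem hessian_zero_left (g : BilinField I M) (h : M → ℝ) (x : M) (w : TangentSpace I x) :
    hessian g h x (0 : TangentSpace I x) w = 0 :=
  coordHessian_zero_left (chartForm g x) (range I) (chartFun I h x) (extChartAt I x x) w

theorem ricciBE_zero_left (g : BilinField I M) (h : M → ℝ) (x : M) (w : TangentSpace I x) :
    ricciBE g h x (0 : TangentSpace I x) w = 0 := by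
  have hricci : ricci g x (0 : TangentSpace I x) w = 0 :=
    coordRicci_zero_left (chartForm g x) (range I) (extChartAt I x x) w
  rw [ricciBE, hricci, hessian_zero_left, sub_zero]

variable [IsManifold I ∞ M] [FiniteDimensional ℝ E] {g : BilinField I M}
  {h : M → ℝ} {v : ℝ → ℝ}

theorem ricciBE_cylMetric_vertical (hg : IsSmoothMetric g) (hh : ContMDiff I 𝓘(ℝ, ℝ) ∞ h)
    (hv : ContDiff ℝ ∞ v) (x : M × ℝ) :
    ricciBE (cylMetric g) (prodWeight h v) x (vertical I x) (vertical I x)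
      = -deriv (deriv v) x.2 := by
  refine (ricciBE_prodWeight hg hh hv x (vertical I x) (vertical I x)).trans ?_
  refine (congrArg (· - _) (ricciBE_zero_left g h x.1 _)).trans ((zero_sub _).trans ?_)
  exact congrArg Neg.neg ((congrArg (· * _) (one_mul (1 : ℝ))).trans (one_mul _))

theorem ricciBE_cylMetric_normal {S : Type*} {F : S → M × ℝ}
    {N : ∀ p, TangentSpace (I.prod 𝓘(ℝ, ℝ)) (F p)} (hg : IsSmoothMetric g)
    (hh : ContMDiff I 𝓘(ℝ, ℝ) ∞ h) (hv : ContDiff ℝ ∞ v) (p : S) :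
    ricciBE (cylMetric g) (prodWeight h v) (F p) (N p) (N p)
      = ricciBE g h (F p).1 (N p).1 (N p).1 - angle g F N p ^ 2 * deriv (deriv v) (F p).2 := by
  rw [ricciBE_prodWeight hg hh hv, angle_eq_snd, sq]

theorem hessian_prodWeight_vertical (hg : IsSmoothMetric g) (hh : ContMDiff I 𝓘(ℝ, ℝ) ∞ h)
    (hv : ContDiff ℝ ∞ v) (x : M × ℝ) (w : TangentSpace (I.prod 𝓘(ℝ, ℝ)) x) :
    hessian (cylMetric g) (prodWeight h v) x (vertical I x) w
      = (w.2 : ℝ) * deriv (deriv v) x.2 := by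
  refine (hessian_prodWeight hg hh hv x (vertical I x) w).trans ?_
  refine (congrArg (· + _) (hessian_zero_left g h x.1 _)).trans ((zero_add _).trans ?_)
  exact congrArg (· * _) (one_mul (w.2 : ℝ))

variable {H₀ : Type*} [TopologicalSpace H₀] {I₀ : ModelWithCorners ℝ E H₀}
  {S : Type*} [TopologicalSpace S] [ChartedSpace H₀ S] [IsManifold I₀ ∞ S]
  {F : S → M × ℝ} {N : ∀ p, TangentSpace (I.prod 𝓘(ℝ, ℝ)) (F p)}

variable (I₀) in
/-- The potential `q = Ric_h(Nʰ, Nʰ) + (1 - θ²) v'' + |σ|²`, with `Nʰ` the horizontal part of `N`,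
for which the angle function of a hypersurface of constant `ψ`-mean curvature satisfies the Jacobi
equation `Δ_ψ θ + q θ = 0`. -/
def anglePotential (g : BilinField I M) (h : M → ℝ) (v : ℝ → ℝ) (F : S → M × ℝ)
    (N : ∀ p, TangentSpace (I.prod 𝓘(ℝ, ℝ)) (F p)) (p : S) : ℝ :=
  ricciBE g h (F p).1 (N p).1 (N p).1 + (1 - angle g F N p ^ 2) * deriv (deriv v) (F p).2
    + secondFFNormSq I₀ (cylMetric g) F N p

theorem driftedLaplacian_angle_cylMetric (hg : IsSmoothMetric g)
    (hF : IsSmoothImmersion I₀ (I.prod 𝓘(ℝ, ℝ)) F) (hN : IsGaussMap I₀ F (cylMetric g) N)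
    (hh : ContMDiff I 𝓘(ℝ, ℝ) ∞ h) (hv : ContDiff ℝ ∞ v)
    {a : ℝ} (hH : ∀ p, weightedMeanCurvature I₀ F (cylMetric g) (prodWeight h v) N p = a) (p : S) :
    driftedLaplacian (pullback I₀ F (cylMetric g)) (prodWeight h v ∘ F) (angle g F N) p
      = -angle g F N p * anglePotential I₀ g h v F N p := by
  have hψ : ContMDiff (I.prod 𝓘(ℝ, ℝ)) 𝓘(ℝ, ℝ) ∞ (prodWeight h v) :=
    (hh.comp contMDiff_fst).add (hv.contMDiff.comp contMDiff_snd)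
  have hlaplacian := (isParallelField_vertical hg).driftedLaplacian_angle hg.cylMetric hF hN
    (by simp) hψ hH (((contMDiff_angle hN).mdifferentiable (by simp)) p)
  have hhessian : hessian (cylMetric g) (prodWeight h v) (F p) (vertical I (F p)) (N p)
      = angle g F N p * deriv (deriv v) (F p).2 := by
    rw [hessian_prodWeight_vertical hg hh hv, angle_eq_snd]
  rw [ricciBE_cylMetric_normal hg hh hv, hhessian] at hlaplacian
  refine hlaplacian.trans ?_
  change -angle g F N p * _ - _ = _
  rw [anglePotential]
  ring

end DriftedLaplacian

section HalfSpace

variable {E : Type*} [NormedAddCommGroup E] [NormedSpace ℝ E] {ℓ : E →L[ℝ] ℝ} {y : E}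

theorem mem_frontier_halfSpace_iff : y ∈ frontier {z | 0 ≤ ℓ z} ↔ ℓ y = 0 ∧ ℓ ≠ 0 := by
  constructor
  · intro hy
    refine ⟨(frontier_le_subset_eq continuous_const ℓ.continuous hy).symm, ?_⟩
    rintro rfl
    simp at hy
  · rintro ⟨hy, hℓ⟩
    refine ⟨subset_closure hy.ge, fun hy_interior => hℓ ?_⟩
    have hmin : IsLocalMin ℓ y := by
      filter_upwards [mem_interior_iff_mem_nhds.1 hy_interior] with z hz
      rwa [hy]
    simpa using hmin.fderiv_eq_zero

theorem mem_posTangentConeAt_halfSpace (hy : ℓ y = 0) {w : E} (hw : 0 ≤ ℓ w) :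
    w ∈ posTangentConeAt {z | 0 ≤ ℓ z} y := by
  apply mem_posTangentConeAt_of_segment_subset
  rintro z ⟨a, b, -, hb, -, rfl⟩
  simpa [hy] using mul_nonneg hb hw

theorem mem_posTangentConeAt_hyperplane (hy : ℓ y = 0) {w : E} (hw : ℓ w = 0) :
    w ∈ posTangentConeAt {z | ℓ z = 0} y := by
  apply mem_posTangentConeAt_of_segment_subset
  rintro z ⟨a, b, -, -, -, rfl⟩
  simp [hy, hw]

theorem hasFDerivWithinAt_apply_eq_zero_of_eq_zero_on_hyperplane {f : E → ℝ} {f' : E →L[ℝ] ℝ}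
    (hf : HasFDerivWithinAt f f' {z | 0 ≤ ℓ z} y) (hy : ℓ y = 0)
    (hf_zero : ∀ᶠ z in 𝓝[{z | 0 ≤ ℓ z}] y, ℓ z = 0 → f z = 0) {w : E} (hw : ℓ w = 0) :
    f' w = 0 := by
  have hsub : {z | ℓ z = 0} ⊆ {z | 0 ≤ ℓ z} := fun z hz => hz.ge
  have hfy : f y = 0 := hf_zero.self_of_nhdsWithin (hsub hy) hy
  have hmin : IsLocalMinOn f {z | ℓ z = 0} y := by
    filter_upwards [nhdsWithin_mono y hsub hf_zero, self_mem_nhdsWithin] with z hz hℓz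
    rw [hfy, hz hℓz]
  have hnonneg (v : E) (hv : ℓ v = 0) : 0 ≤ f' v :=
    hmin.hasFDerivWithinAt_nonneg (hf.mono hsub) (mem_posTangentConeAt_hyperplane hy hv)
  have hneg := hnonneg (-w) (by simp [hw])
  rw [map_neg] at hneg
  linarith [hnonneg w hw]

theorem exists_eq_mul_of_nonneg_on_halfSpace {f : E → ℝ} {f' : E →L[ℝ] ℝ}
    (hf : HasFDerivWithinAt f f' {z | 0 ≤ ℓ z} y) (hy : ℓ y = 0) (hfy : f y = 0)
    (hf_nonneg : ∀ᶠ z in 𝓝[{z | 0 ≤ ℓ z}] y, 0 ≤ f z) :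
    ∃ k : ℝ, 0 ≤ k ∧ ∀ w, f' w = k * ℓ w := by
  have hmin : IsLocalMinOn f {z | 0 ≤ ℓ z} y := by
    filter_upwards [hf_nonneg] with z hz
    rwa [hfy]
  have hnonneg (w : E) (hw : 0 ≤ ℓ w) : 0 ≤ f' w :=
    hmin.hasFDerivWithinAt_nonneg hf (mem_posTangentConeAt_halfSpace hy hw)
  have hzero (w : E) (hw : ℓ w = 0) : f' w = 0 := by
    have hneg := hnonneg (-w) (by simp [hw])
    rw [map_neg] at hneg
    linarith [hnonneg w hw.ge]
  by_cases hℓ : ∀ w, ℓ w = 0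
  · exact ⟨0, le_rfl, fun w => by rw [hzero w (hℓ w), zero_mul]⟩
  · push Not at hℓ
    obtain ⟨e, he⟩ := hℓ
    refine ⟨f' ((ℓ e)⁻¹ • e), hnonneg _ (by simp [he]), fun w => ?_⟩
    have hproj := hzero (w - ℓ w • ((ℓ e)⁻¹ • e)) (by simp [he])
    rw [map_sub, map_smul, smul_eq_mul] at hproj
    linarith

end HalfSpace

section LocalFreeBoundary

variable {E : Type*} [NormedAddCommGroup E] [NormedSpace ℝ E]
  {E' : Type*} [NormedAddCommGroup E'] [NormedSpace ℝ E']
  {G' : E' → E' →L[ℝ] E' →L[ℝ] ℝ} {φ n : E → E'} {ℓ : E →L[ℝ] ℝ} {ℓ' : E' →L[ℝ] ℝ} {y : E}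

theorem IsLocalMap.exists_linearForm_fderivWithin_eq_mul
    (hφ : IsLocalMap φ {z | 0 ≤ ℓ z} {z | 0 ≤ ℓ' z} y) (hy : ℓ y = 0) (hφy : ℓ' (φ y) = 0) :
    ∃ k : ℝ, 0 ≤ k ∧ ∀ w, ℓ' (fderivWithin ℝ φ {z | 0 ≤ ℓ z} y w) = k * ℓ w :=
  exists_eq_mul_of_nonneg_on_halfSpace
    (ℓ'.hasFDerivAt.comp_hasFDerivWithinAt y hφ.hasFDerivWithinAt) hy hφy
    hφ.eventually_mapsTo

namespace IsLocalHypersurface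

variable [FiniteDimensional ℝ E]

theorem apply_localCovDeriv_normal_eq_apply_tangentProj [FiniteDimensional ℝ E'] {s : Set E}
    {s' : Set E'} (h : IsLocalHypersurface G' φ n s s' y) (X : E') (u : E) :
    G' (φ y) X (localCovDeriv G' φ n s s' y u)
      = G' (φ y) (fderivWithin ℝ φ s y u)
          (localCovDeriv G' φ n s s' y (tangentProj G' φ s y X)) := by
  have hsymm := h.shapeOp_symm u (tangentProj G' φ s y X)
  rw [h.inducedForm_shapeOp, h.inducedForm_shapeOp, neg_inj,
    h.fderivWithin_tangentProj_eq_sub, map_sub, map_smul, h.localCovDeriv_normal_orthogonal,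
    smul_zero, sub_zero] at hsymm
  rw [h.isLocalMetric_target.isInnerForm.symm, hsymm, h.isLocalMetric_target.isInnerForm.symm]

/-- `hdual` says that `dφ(u)` is a multiple of the unit normal of the boundary of the target. -/
theorem linearForm_tangentProj_eq_zero
    (h : IsLocalHypersurface G' φ n {z | 0 ≤ ℓ z} {z | 0 ≤ ℓ' z} y)
    (hy : ℓ y = 0) (hφy : ℓ' (φ y) = 0) (hn : ℓ' (n y) = 0) {X : E'} (hX : ℓ' X = 0)
    {u : E} {m : ℝ} (hu : u ≠ 0)
    (hdual : ∀ Y, G' (φ y) (fderivWithin ℝ φ {z | 0 ≤ ℓ z} y u) Y = m * ℓ' Y) :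
    ℓ (tangentProj G' φ {z | 0 ≤ ℓ z} y X) = 0 := by
  obtain ⟨k, -, hk⟩ := h.isLocalMap.exists_linearForm_fderivWithin_eq_mul hy hφy
  have hk_ne : k ≠ 0 := by
    rintro rfl
    refine hu (h.isLocalMetric.isInnerForm.eq_zero ?_)
    rw [inducedForm_apply, hdual, hk, zero_mul, mul_zero]
  have hkT := hk (tangentProj G' φ {z | 0 ≤ ℓ z} y X)
  rw [h.fderivWithin_tangentProj_eq_sub, map_sub, map_smul, hX, hn, smul_zero, sub_zero] at hkT
  exact (mul_eq_zero.1 hkT.symm).resolve_left hk_ne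

theorem apply_localCovDeriv_normal_conormal [FiniteDimensional ℝ E']
    (h : IsLocalHypersurface G' φ n {z | 0 ≤ ℓ z} {z | 0 ≤ ℓ' z} y)
    (hy : ℓ y = 0) (hφy : ℓ' (φ y) = 0)
    (hn : ∀ᶠ z in 𝓝[{z | 0 ≤ ℓ z}] y, ℓ z = 0 → ℓ' (n z) = 0) {ξ : E'}
    (hξ : ∀ u, christoffel G' {z | 0 ≤ ℓ' z} (φ y) u ξ = 0) (hξ_tangent : ℓ' ξ = 0)
    {u : E} {m : ℝ} (hu : u ≠ 0)
    (hdual : ∀ Y, G' (φ y) (fderivWithin ℝ φ {z | 0 ≤ ℓ z} y u) Y = m * ℓ' Y) :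
    G' (φ y) ξ (localCovDeriv G' φ n {z | 0 ≤ ℓ z} {z | 0 ≤ ℓ' z} y u)
      = -G' (φ y) ξ (n y) * G' (φ y) (christoffel G' {z | 0 ≤ ℓ' z} (φ y) (n y) (n y))
          (fderivWithin ℝ φ {z | 0 ≤ ℓ z} y u) := by
  have hny : ℓ' (n y) = 0 := hn.self_of_nhdsWithin h.mem hy
  have hdn : ℓ' (fderivWithin ℝ n {z | 0 ≤ ℓ z} y (tangentProj G' φ {z | 0 ≤ ℓ z} y ξ)) = 0 :=
    hasFDerivWithinAt_apply_eq_zero_of_eq_zero_on_hyperplane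
      (ℓ'.hasFDerivAt.comp_hasFDerivWithinAt y h.differentiableWithinAt_normal.hasFDerivWithinAt)
      hy hn (h.linearForm_tangentProj_eq_zero hy hφy hny hξ_tangent hu hdual)
  rw [h.apply_localCovDeriv_normal_eq_apply_tangentProj,
    h.isLocalMetric_target.isInnerForm.symm (christoffel _ _ _ _ _), hdual, hdual,
    localCovDeriv_apply, map_add, hdn, h.isLocalMetric_target.christoffel_comm h.isRegion_target,
    h.fderivWithin_tangentProj_eq_sub, map_sub, hξ, map_smul, zero_sub, map_neg, map_smul,
    smul_eq_mul]
  ring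

end IsLocalHypersurface

end LocalFreeBoundary

section Boundary

variable {E : Type*} [NormedAddCommGroup E] [NormedSpace ℝ E]
  {H : Type*} [TopologicalSpace H] {I : ModelWithCorners ℝ E H}
  {S : Type*} [TopologicalSpace S] [ChartedSpace H S]

theorem mem_boundary_iff_mem_frontier [IsManifold I 1 S] {p q : S}
    (hq : q ∈ (extChartAt I p).source) :
    q ∈ I.boundary S ↔ extChartAt I p q ∈ frontier (range I) := by
  have hmem_target := (extChartAt I p).map_source hq
  have hinterior : q ∈ I.interior S ↔ extChartAt I p q ∈ interior (extChartAt I p).target := by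
    rw [extChartAt_source] at hq
    exact I.isInteriorPoint_iff_of_mem_atlas one_ne_zero (chart_mem_atlas H p) hq
  have hinterior_target : extChartAt I p q ∈ interior (extChartAt I p).target
      ↔ extChartAt I p q ∈ interior (range I) := by
    refine ⟨fun h => interior_mono (extChartAt_target_subset_range p) h, fun h => ?_⟩
    rw [mem_interior_iff_mem_nhds] at h ⊢
    have htarget := extChartAt_target_mem_nhdsWithin_of_mem hmem_target
    rwa [nhdsWithin_eq_nhds.2 h] at htarget
  have hclosure : extChartAt I p q ∈ closure (range I) :=
    subset_closure (extChartAt_target_subset_range p hmem_target)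
  rw [← I.compl_interior, mem_compl_iff, hinterior, hinterior_target]
  exact ⟨fun h => ⟨hclosure, h⟩, fun h => h.2⟩

variable [hI : HalfSpaceModel I]

theorem mem_boundary_iff [IsManifold I 1 S] {p q : S} (hq : q ∈ (extChartAt I p).source) :
    q ∈ I.boundary S ↔ hI.ℓ (extChartAt I p q) = 0 ∧ hI.ℓ ≠ 0 := by
  rw [mem_boundary_iff_mem_frontier hq, hI.range_eq, mem_frontier_halfSpace_iff]

theorem ℓ_eq_zero_and_ne_zero_of_mem_boundary {p : S} (hp : p ∈ I.boundary S) :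
    hI.ℓ (extChartAt I p p) = 0 ∧ hI.ℓ ≠ 0 := by
  have hfrontier : extChartAt I p p ∈ frontier (range I) := hp
  rwa [hI.range_eq, mem_frontier_halfSpace_iff] at hfrontier

variable [FiniteDimensional ℝ E] {g : BilinField I S} {p : S}

theorem innerNormal_apply (hg : IsInnerForm (E := E) (g p)) (w : TangentSpace I p) :
    g p (innerNormal g p) w
      = (Real.sqrt (bdryForm p ((g p).inverse (bdryForm p))))⁻¹ * bdryForm p w := by
  have hinverse : g p ((g p).inverse (bdryForm p)) w = bdryForm p w := hg.apply_inverse hI.ℓ w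
  rw [innerNormal, map_smul, smul_apply, smul_eq_mul, hinverse]

theorem bdryForm_inverse_bdryForm_pos (hg : IsInnerForm (E := E) (g p))
    (hp : p ∈ I.boundary S) : 0 < bdryForm p ((g p).inverse (bdryForm p)) := by
  have hinverse (w : TangentSpace I p) :
      g p ((g p).inverse (bdryForm p)) w = bdryForm p w := hg.apply_inverse hI.ℓ w
  have hne : ((g p).inverse (bdryForm p) : E) ≠ 0 := by
    intro hzero
    refine (ℓ_eq_zero_and_ne_zero_of_mem_boundary hp).2 (ContinuousLinearMap.ext fun w => ?_)
    have hw : g p (0 : TangentSpace I p) w = bdryForm (I := I) p w :=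
      (congrArg (fun v : TangentSpace I p => g p v w) hzero.symm).trans (hinverse w)
    rw [map_zero] at hw
    exact hw.symm
  exact (hg.pos _ hne).trans_eq (hinverse _)

theorem bdrySFF_nonneg_iff (hg : IsInnerForm (E := E) (g p)) (hp : p ∈ I.boundary S)
    (u w : TangentSpace I p) :
    0 ≤ bdrySFF g p u w ↔ 0 ≤ bdryForm p (christoffelAt g p u w) := by
  have hsymm : bdrySFF g p u w = g p (innerNormal g p) (christoffelAt g p u w) := hg.symm _ _
  rw [hsymm, innerNormal_apply hg]
  exact mul_nonneg_iff_of_pos_left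
    (inv_pos.2 (Real.sqrt_pos.2 (bdryForm_inverse_bdryForm_pos hg hp)))

theorem innerNormal_unit (hg : IsInnerForm (E := E) (g p)) (hp : p ∈ I.boundary S) :
    g p (innerNormal g p) (innerNormal g p) = 1 := by
  have hpos := bdryForm_inverse_bdryForm_pos hg hp
  rw [innerNormal_apply hg, innerNormal, map_smul, smul_eq_mul, ← mul_assoc, ← mul_inv,
    Real.mul_self_sqrt hpos.le, inv_mul_cancel₀ hpos.ne']

theorem innerNormal_ne_zero (hg : IsInnerForm (E := E) (g p)) (hp : p ∈ I.boundary S) :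
    (innerNormal g p : E) ≠ 0 := by
  intro hzero
  have hunit := innerNormal_unit hg hp
  have hzero : innerNormal g p = (0 : TangentSpace I p) := hzero
  rw [hzero, map_zero] at hunit
  exact zero_ne_one hunit

theorem eq_innerNormal (hg : IsInnerForm (E := E) (g p)) (hp : p ∈ I.boundary S)
    {u : TangentSpace I p} {k : ℝ} (hk : 0 ≤ k) (hdual : ∀ w, g p u w = k * bdryForm p w)
    (hu : g p u u = 1) : u = innerNormal g p := by
  set m := (Real.sqrt (bdryForm p ((g p).inverse (bdryForm p))))⁻¹
  have hm : 0 < m := inv_pos.2 (Real.sqrt_pos.2 (bdryForm_inverse_bdryForm_pos hg hp))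
  have hsmul : m • u = k • innerNormal g p := by
    refine hg.ext (E := E) fun (w : TangentSpace I p) => ?_
    have hu_apply : g p (m • u) w = m * (k * bdryForm (I := I) p w) := by
      rw [map_smul, smul_apply, hdual, smul_eq_mul]
    have hν_apply : g p (k • innerNormal g p) w = k * (m * bdryForm (I := I) p w) := by
      rw [map_smul, smul_apply, innerNormal_apply hg, smul_eq_mul]
    exact hu_apply.trans ((mul_left_comm _ _ _).trans hν_apply.symm)
  have hnorm : g p (m • u) (m • u) = g p (k • innerNormal g p) (k • innerNormal g p) := by
    rw [hsmul]
  simp only [map_smul, smul_apply, hu, innerNormal_unit hg hp, smul_eq_mul, mul_one] at hnorm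
  have hmk : m = k := (mul_self_inj hm.le hk).1 hnorm
  rw [← hmk] at hsmul
  exact smul_right_injective _ hm.ne' hsmul

end Boundary

section FreeBoundary

variable {E : Type*} [NormedAddCommGroup E] [NormedSpace ℝ E]
  {H : Type*} [TopologicalSpace H] {I : ModelWithCorners ℝ E H}
  {S : Type*} [TopologicalSpace S] [ChartedSpace H S]
  {E' : Type*} [NormedAddCommGroup E'] [NormedSpace ℝ E']
  {H' : Type*} [TopologicalSpace H'] {J : ModelWithCorners ℝ E' H'}
  {W : Type*} [TopologicalSpace W] [ChartedSpace H' W] {F : S → W}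

theorem fderivWithin_chartMap_self [IsManifold I 1 S] [IsManifold J 1 W] {p : S}
    (hF : MDifferentiableAt I J F p) (a : TangentSpace I p) :
    fderivWithin ℝ (chartMap I J F p (F p)) (range I) (extChartAt I p p) a
      = mfderiv I J F p a := by
  rw [← chartDeriv_self p a, fderivWithin_chartMap_chartDeriv (mem_extChartAt_source p) hF
    (mem_extChartAt_source (F p)), chartDeriv_self, chartDeriv_self]

variable [hJ : HalfSpaceModel J]

theorem HasFreeBoundary.map_mem_boundary {g : BilinField J W} (hfree : HasFreeBoundary I F g)
    {p : S} (hp : p ∈ I.boundary S) : F p ∈ J.boundary W :=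
  (hfree ⟨p, hp⟩).1.subset hp

theorem HasFreeBoundary.bdryForm_normal [FiniteDimensional ℝ E'] [IsManifold J 1 W]
    {g : BilinField J W} {N : ∀ p, TangentSpace J (F p)} (hfree : HasFreeBoundary I F g)
    (hg : ∀ x, IsInnerForm (E := E') (g x)) (hN : IsGaussMap I F g N) {p : S}
    (hp : p ∈ I.boundary S) : bdryForm (F p) (N p) = 0 := by
  obtain ⟨u, hu⟩ := (hfree ⟨p, hp⟩).2 p hp
  have hpos := bdryForm_inverse_bdryForm_pos (hg (F p)) (hfree.map_mem_boundary hp)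
  have horth : g (F p) (innerNormal g (F p)) (N p) = 0 :=
    ((hg (F p)).symm _ _).trans (hu ▸ hN.normal p u)
  rw [innerNormal_apply (hg (F p))] at horth
  exact (mul_eq_zero.1 horth).resolve_left (inv_pos.2 (Real.sqrt_pos.2 hpos)).ne'

variable [IsManifold J ∞ W]

theorem ℓ_chartDeriv_eq_zero_of_bdryForm_eq_zero {x₀ x : W} (hx : x ∈ (extChartAt J x₀).source)
    (hx_boundary : x ∈ J.boundary W) {a : TangentSpace J x} (ha : bdryForm x a = 0) :
    hJ.ℓ (chartDeriv J x₀ x a) = 0 := by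
  have hτ := isLocalMap_transition (mem_extChartAt_source (I := J) x) hx
  have hderiv := fderivWithin_transition_chartDeriv (mem_extChartAt_source x) hx a
  rw [hJ.range_eq] at hτ hderiv
  obtain ⟨k, -, hk⟩ := hτ.exists_linearForm_fderivWithin_eq_mul
    (ℓ_eq_zero_and_ne_zero_of_mem_boundary hx_boundary).1
    (by rw [chartMap_self]; exact ((mem_boundary_iff hx).1 hx_boundary).1)
  rw [← hderiv, hk, chartDeriv_self]
  exact mul_eq_zero_of_right _ ha

variable [hI : HalfSpaceModel I] [IsManifold I ∞ S]

theorem exists_bdryForm_mfderiv_eq_mul (hF : ContMDiff I J ∞ F) {p : S} (hp : p ∈ I.boundary S)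
    (hFp : F p ∈ J.boundary W) : ∃ k : ℝ, 0 ≤ k ∧
      ∀ w : TangentSpace I p, bdryForm (F p) (mfderiv I J F p w) = k * bdryForm p w := by
  have hφ : IsLocalMap (chartMap I J F p (F p)) (range I) (range J) (extChartAt I p p) :=
    isLocalMap_chartMap hF (mem_extChartAt_target p) (map_symm_extChartAt_mem_source F p)
  have hderiv := fderivWithin_chartMap_self (J := J) (hF.mdifferentiableAt (x := p) (by simp))
  rw [hI.range_eq] at hφ hderiv
  rw [hJ.range_eq] at hφ
  obtain ⟨k, hk_nonneg, hk⟩ := hφ.exists_linearForm_fderivWithin_eq_mul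
    (ℓ_eq_zero_and_ne_zero_of_mem_boundary hp).1
    (by rw [chartMap_self]; exact (ℓ_eq_zero_and_ne_zero_of_mem_boundary hFp).1)
  refine ⟨k, hk_nonneg, fun w => ?_⟩
  rw [← hderiv]
  exact hk w

namespace HasFreeBoundary

variable [FiniteDimensional ℝ E'] {g : BilinField J W}

theorem mfderiv_innerNormal [FiniteDimensional ℝ E] (hfree : HasFreeBoundary I F g)
    (hg : ∀ x, IsInnerForm (E := E') (g x)) (hF : IsSmoothImmersion I J F) {p : S}
    (hp : p ∈ I.boundary S) :
    mfderiv I J F p (innerNormal (pullback I F g) p) = innerNormal g (F p) := by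
  obtain ⟨u, hu⟩ := (hfree ⟨p, hp⟩).2 p hp
  have hFp := hfree.map_mem_boundary hp
  obtain ⟨k, hk_nonneg, hk⟩ := exists_bdryForm_mfderiv_eq_mul hF.1 hp hFp
  have hdual (w : TangentSpace I p) : pullback I F g p u w
      = (Real.sqrt (bdryForm (F p) ((g (F p)).inverse (bdryForm (F p)))))⁻¹ * k
        * bdryForm p w := by
    rw [pullback, pullForm_apply, hu, innerNormal_apply (hg (F p)), hk, mul_assoc]
  have hunit : pullback I F g p u u = 1 := by
    rw [pullback, pullForm_apply, hu, innerNormal_unit (hg (F p)) hFp]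
  rw [← eq_innerNormal (isInnerForm_pullback hg hF p) hp
    (mul_nonneg (inv_nonneg.2 (Real.sqrt_nonneg _)) hk_nonneg) hdual hunit, hu]

variable {N : ∀ p, TangentSpace J (F p)}

theorem eventually_ℓ_chartFieldMap_eq_zero (hfree : HasFreeBoundary I F g)
    (hg : ∀ x, IsInnerForm (E := E') (g x)) (hF : Continuous F) (hN : IsGaussMap I F g N) {p : S}
    (hp : p ∈ I.boundary S) :
    ∀ᶠ z in 𝓝[range I] (extChartAt I p p), hI.ℓ z = 0 → hJ.ℓ (chartFieldMap I F N p z) = 0 := by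
  filter_upwards [eventually_mem_charts I J hF p] with z hz hℓz
  have hq : (extChartAt I p).symm z ∈ I.boundary S := by
    rw [mem_boundary_iff ((extChartAt I p).map_target hz.1), (extChartAt I p).right_inv hz.1]
    exact ⟨hℓz, (ℓ_eq_zero_and_ne_zero_of_mem_boundary hp).2⟩
  exact ℓ_chartDeriv_eq_zero_of_bdryForm_eq_zero hz.2 (hfree.map_mem_boundary hq)
    (hfree.bdryForm_normal hg hN hq)

end HasFreeBoundary

end FreeBoundary

section AngleConormal

variable {E : Type*} [NormedAddCommGroup E] [NormedSpace ℝ E]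
  {H : Type*} [TopologicalSpace H] {I : ModelWithCorners ℝ E H}
  {S : Type*} [TopologicalSpace S] [ChartedSpace H S] [IsManifold I ∞ S]
  {E' : Type*} [NormedAddCommGroup E'] [NormedSpace ℝ E'] [FiniteDimensional ℝ E']
  {H' : Type*} [TopologicalSpace H'] {J : ModelWithCorners ℝ E' H'}
  {W : Type*} [TopologicalSpace W] [ChartedSpace H' W] [IsManifold J ∞ W]
  {F : S → W} {g : BilinField J W} {N : ∀ p, TangentSpace J (F p)}
  {V : ∀ x : W, TangentSpace J x} {ξ : E'} {p : S}

theorem IsParallelField.mfderiv_angle (hV : IsParallelField g V ξ) (hg : IsSmoothMetric g)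
    (hF : IsSmoothImmersion I J F) (hN : IsGaussMap I F g N)
    (hdim : Module.finrank ℝ E' = Module.finrank ℝ E + 1)
    (hθ : MDifferentiableAt I 𝓘(ℝ, ℝ) (fun p => g (F p) (V (F p)) (N p)) p)
    (u : TangentSpace I p) :
    mfderiv I 𝓘(ℝ, ℝ) (fun p => g (F p) (V (F p)) (N p)) p u
      = chartForm g (F p) (extChartAt J (F p) (F p)) ξ
          (localCovDeriv (chartForm g (F p)) (chartMap I J F p (F p)) (chartFieldMap I F N p)
            (range I) (range J) (extChartAt I p p) u) := by
  have h := hN.isLocalHypersurface hg hF hdim p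
  have hangle := hV.localAngle_eventuallyEq (I := I) hF.1.continuous N p
  have hparallel := hV.isLocallyParallel (F p)
  rw [← chartMap_self (I := I) (J := J) F p (F p)] at hparallel
  have hderiv := h.fderivWithin_localAngle hparallel u
  rw [hangle.fderivWithin_eq (hangle.self_of_nhdsWithin h.mem), chartMap_self] at hderiv
  rw [← hderiv]
  exact congrArg (fun A : E →L[ℝ] ℝ => A u) (fderivWithin_chartFun_self hθ).symm

variable [FiniteDimensional ℝ E] [hI : HalfSpaceModel I] [hJ : HalfSpaceModel J]

theorem HasFreeBoundary.mfderiv_angle (hfree : HasFreeBoundary I F g) (hg : IsSmoothMetric g)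
    (hF : IsSmoothImmersion I J F) (hN : IsGaussMap I F g N)
    (hdim : Module.finrank ℝ E' = Module.finrank ℝ E + 1) (hV : IsParallelField g V ξ)
    (hξ : hJ.ℓ ξ = 0) (hθ : MDifferentiableAt I 𝓘(ℝ, ℝ) (fun p => g (F p) (V (F p)) (N p)) p)
    (hp : p ∈ I.boundary S) :
    mfderiv I 𝓘(ℝ, ℝ) (fun p => g (F p) (V (F p)) (N p)) p (innerNormal (pullback I F g) p)
      = -g (F p) (V (F p)) (N p) * bdrySFF g (F p) (N p) (N p) := by
  have h := hN.isLocalHypersurface hg hF hdim p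
  have hparallel := (hV.isLocallyParallel (F p)).self_of_nhdsWithin
    (extChartAt_target_subset_range _ (mem_extChartAt_target (F p)))
  have hderiv := fderivWithin_chartMap_self (hF.1.mdifferentiableAt (x := p) (by simp))
    (innerNormal (pullback I F g) p)
  rw [hfree.mfderiv_innerNormal hg.isInnerForm hF hp] at hderiv
  have htangent := hfree.eventually_ℓ_chartFieldMap_eq_zero hg.isInnerForm hF.1.continuous hN hp
  have hformula := hV.mfderiv_angle hg hF hN hdim hθ (innerNormal (pullback I F g) p)
  have hbase : chartMap I J F p (F p) (extChartAt I p p) = extChartAt J (F p) (F p) :=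
    chartMap_self F p (F p)
  rw [hI.range_eq] at h hderiv htangent hformula
  rw [hJ.range_eq] at h hparallel hformula
  have hconormal := h.apply_localCovDeriv_normal_conormal
    (ℓ_eq_zero_and_ne_zero_of_mem_boundary hp).1
    (by rw [hbase]; exact (ℓ_eq_zero_and_ne_zero_of_mem_boundary (hfree.map_mem_boundary hp)).1)
    htangent (by rw [hbase]; exact hparallel) hξ
    (innerNormal_ne_zero (isInnerForm_pullback hg.isInnerForm hF p) hp)
    (fun Y => by
      rw [hderiv, hbase, chartForm_self]
      exact innerNormal_apply (hg.isInnerForm (F p)) Y)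
  rw [hbase, hderiv, chartFieldMap_self, chartForm_self, ← hV.apply_eq (F p)] at hconormal
  rw [hformula, chartForm_self, ← hV.apply_eq (F p), bdrySFF, christoffelAt, hJ.range_eq]
  exact hconormal

end AngleConormal

section Constant

variable {E : Type*} [NormedAddCommGroup E] [NormedSpace ℝ E]
  {H : Type*} [TopologicalSpace H] {I : ModelWithCorners ℝ E H}
  {S : Type*} [TopologicalSpace S] [ChartedSpace H S]

theorem hasFDerivWithinAt_chartFun_zero [IsManifold I 1 S] {f : S → ℝ}
    (hf : MDifferentiable I 𝓘(ℝ, ℝ) f) (hf_zero : ∀ p, mfderiv I 𝓘(ℝ, ℝ) f p = 0) {p : S} {z : E}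
    (hz : z ∈ (extChartAt I p).target) :
    HasFDerivWithinAt (chartFun I f p) (0 : E →L[ℝ] ℝ) (range I) z := by
  have hdiff : DifferentiableWithinAt ℝ (chartFun I f p) (range I) z :=
    mdifferentiableWithinAt_iff_differentiableWithinAt.1
      ((hf _).comp_mdifferentiableWithinAt z (mdifferentiableWithinAt_extChartAt_symm hz))
  have hchain := mfderiv_comp_mfderivWithin z (hf _) (mdifferentiableWithinAt_extChartAt_symm hz)
    (I.uniqueMDiffOn z (extChartAt_target_subset_range p hz))
  rw [mfderivWithin_eq_fderivWithin, hf_zero, ContinuousLinearMap.zero_comp] at hchain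
  exact hdiff.hasFDerivWithinAt.congr_fderiv hchain

theorem isLocallyConstant_of_mfderiv_eq_zero [IsManifold I 1 S] {f : S → ℝ}
    (hf : MDifferentiable I 𝓘(ℝ, ℝ) f) (hf_zero : ∀ p, mfderiv I 𝓘(ℝ, ℝ) f p = 0) :
    IsLocallyConstant f := by
  rw [IsLocallyConstant.iff_eventually_eq]
  intro p
  obtain ⟨r, hr, hball_subset⟩ := Metric.mem_nhdsWithin_iff.1
    (extChartAt_target_mem_nhdsWithin_of_mem (mem_extChartAt_target (I := I) p))
  have hconvex : Convex ℝ (Metric.ball (extChartAt I p p) r ∩ range I) :=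
    (convex_ball _ _).inter I.convex_range
  have hmem_range {q : S} (hq : q ∈ (extChartAt I p).source) : extChartAt I p q ∈ range I :=
    extChartAt_target_subset_range p ((extChartAt I p).map_source hq)
  have hp := mem_extChartAt_source (I := I) p
  have hderiv : ∀ z ∈ Metric.ball (extChartAt I p p) r ∩ range I,
      HasFDerivWithinAt (chartFun I f p) (0 : E →L[ℝ] ℝ)
        (Metric.ball (extChartAt I p p) r ∩ range I) z := fun z hz =>
    (hasFDerivWithinAt_chartFun_zero hf hf_zero (hball_subset hz)).mono inter_subset_right
  filter_upwards [(continuousAt_extChartAt (I := I) p).eventually (Metric.ball_mem_nhds _ hr),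
    extChartAt_source_mem_nhds (I := I) p] with q hq_ball hq
  have hnorm := hconvex.norm_image_sub_le_of_norm_hasFDerivWithin_le (C := 0) hderiv
    (fun _ _ => by simp) ⟨Metric.mem_ball_self hr, hmem_range hp⟩ ⟨hq_ball, hmem_range hq⟩
  rwa [zero_mul, norm_le_zero_iff, sub_eq_zero, chartFun, chartFun,
    (extChartAt I p).left_inv hq, (extChartAt I p).left_inv hp] at hnorm

theorem driftedLaplacian_const (g : BilinField I S) (ψ : S → ℝ) (a : ℝ) (p : S) :
    driftedLaplacian g ψ (fun _ => a) p = 0 := by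
  have hcoordGrad : coordGrad (chartForm g p) (range I) (chartFun I (fun _ => a) p)
      = fun _ => 0 := by
    funext z
    change (chartForm g p z).inverse (fderivWithin ℝ (fun _ => a) (range I) z) = 0
    rw [fderivWithin_fun_const]
    exact map_zero _
  have hgrad : grad g (fun _ => a) p = 0 := by
    rw [grad, mfderiv_const]
    exact map_zero _
  rw [driftedLaplacian, laplacian, hcoordGrad, hgrad, map_zero, coordDiv]
  simp

end Constant

section Cylinder

variable {E : Type*} [NormedAddCommGroup E] [NormedSpace ℝ E]
  {H : Type*} [TopologicalSpace H] {I : ModelWithCorners ℝ E H}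
  {M : Type*} [TopologicalSpace M] [ChartedSpace H M] [IsManifold I ∞ M]
  {H₀ : Type*} [TopologicalSpace H₀] {I₀ : ModelWithCorners ℝ E H₀}
  {S : Type*} [TopologicalSpace S] [ChartedSpace H₀ S]
  {g : BilinField I M} {h : M → ℝ} {v : ℝ → ℝ} {c : ℝ}
  {F : S → M × ℝ} {N : ∀ p, TangentSpace (I.prod 𝓘(ℝ, ℝ)) (F p)}

theorem one_sub_angle_sq_nonneg (hg : ∀ x, IsInnerForm (E := E) (g x))
    (hN : IsGaussMap I₀ F (cylMetric g) N) (p : S) : 0 ≤ 1 - angle g F N p ^ 2 := by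
  rw [← apply_normal_fst_eq_one_sub_angle_sq hN]
  exact (hg (F p).1).nonneg (N p).1

theorem add_deriv_deriv_nonneg (hv : ContDiff ℝ 2 v)
    (hRicv : ∀ (t : ℝ) (w : TangentSpace 𝓘(ℝ, ℝ) t),
      ricciBE lineMetric v t w w ≤ c * lineMetric t w w) (t : ℝ) :
    0 ≤ c + deriv (deriv v) t := by
  have hle := hRicv t (1 : ℝ)
  rw [ricciBE_lineMetric hv, lineMetric_apply] at hle
  linarith

variable [IsManifold I₀ ∞ S]

theorem exists_snd_eq_const_of_angle_sq_eq_one [ConnectedSpace S]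
    (hg : ∀ x, IsInnerForm (E := E) (g x)) (hF : IsSmoothImmersion I₀ (I.prod 𝓘(ℝ, ℝ)) F)
    (hN : IsGaussMap I₀ F (cylMetric g) N) (hangle : ∀ p, angle g F N p ^ 2 = 1) :
    ∃ s : ℝ, ∀ p, (F p).2 = s := by
  have hF_diff : MDifferentiable I₀ (I.prod 𝓘(ℝ, ℝ)) F := hF.1.mdifferentiable (by simp)
  have hhorizontal (p : S) : ((N p).1 : E) = 0 := by
    have hnorm := apply_normal_fst_eq_one_sub_angle_sq hN p
    rw [hangle, sub_self] at hnorm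
    exact (hg (F p).1).eq_zero hnorm
  have hderiv (p : S) (u : TangentSpace I₀ p) :
      mfderiv I₀ 𝓘(ℝ, ℝ) (fun q => (F q).2) p u = (0 : ℝ) := by
    have hnormal := (cylMetric_apply g (F p) (N p) _).symm.trans (hN.normal p u)
    have hhorizontal_apply : g (F p).1 (N p).1 (mfderiv I₀ (I.prod 𝓘(ℝ, ℝ)) F p u).1 = 0 :=
      (congrArg (fun a : TangentSpace I (F p).1 => g (F p).1 a _) (hhorizontal p)).trans
        (congrArg (fun A : TangentSpace I (F p).1 →L[ℝ] ℝ => A _) (map_zero (g (F p).1)))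
    have hangle_ne : angle g F N p ≠ 0 := by
      intro hzero
      simpa [hzero] using hangle p
    rw [hhorizontal_apply, zero_add, ← angle_eq_snd g p, ← mfderiv_snd_comp hF_diff] at hnormal
    exact (mul_eq_zero.1 hnormal).resolve_left hangle_ne
  have hconst := isLocallyConstant_of_mfderiv_eq_zero (I := I₀)
    ((contMDiff_snd.comp hF.1).mdifferentiable (by simp))
    fun p => ContinuousLinearMap.ext (hderiv p)
  obtain ⟨s, hs⟩ := hconst.exists_eq_const
  exact ⟨s, congrFun hs⟩

variable [FiniteDimensional ℝ E]

theorem anglePotential_nonneg (hg : IsSmoothMetric g)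
    (hF : IsSmoothImmersion I₀ (I.prod 𝓘(ℝ, ℝ)) F) (hN : IsGaussMap I₀ F (cylMetric g) N)
    (hv : ∀ t, 0 ≤ c + deriv (deriv v) t)
    (hRich : ∀ (x : M) (w : TangentSpace I x), c * g x w w ≤ ricciBE g h x w w) (p : S) :
    0 ≤ anglePotential I₀ g h v F N p := by
  have hRic := hRich (F p).1 (N p).1
  have hprod := mul_nonneg (one_sub_angle_sq_nonneg hg.isInnerForm hN p) (hv (F p).2)
  have hσ := secondFFNormSq_nonneg hg.cylMetric hF hN (by simp) p
  rw [apply_normal_fst_eq_one_sub_angle_sq hN] at hRic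
  rw [anglePotential]
  linarith

theorem eq_of_anglePotential_eq_zero (hg : IsSmoothMetric g)
    (hF : IsSmoothImmersion I₀ (I.prod 𝓘(ℝ, ℝ)) F) (hN : IsGaussMap I₀ F (cylMetric g) N)
    (hv : ∀ t, 0 ≤ c + deriv (deriv v) t)
    (hRich : ∀ (x : M) (w : TangentSpace I x), c * g x w w ≤ ricciBE g h x w w) {p : S}
    (hzero : anglePotential I₀ g h v F N p = 0) :
    secondFFNormSq I₀ (cylMetric g) F N p = 0 ∧
      ricciBE g h (F p).1 (N p).1 (N p).1 = c * (1 - angle g F N p ^ 2) ∧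
      (1 - angle g F N p ^ 2) * (c + deriv (deriv v) (F p).2) = 0 := by
  have hRic := hRich (F p).1 (N p).1
  have hprod := mul_nonneg (one_sub_angle_sq_nonneg hg.isInnerForm hN p) (hv (F p).2)
  have hσ := secondFFNormSq_nonneg hg.cylMetric hF hN (by simp) p
  rw [apply_normal_fst_eq_one_sub_angle_sq hN] at hRic
  rw [anglePotential] at hzero
  exact ⟨by linarith, by linarith, by linarith⟩

theorem anglePotential_eq_zero_of_angle_eq_const (hg : IsSmoothMetric g)
    (hh : ContMDiff I 𝓘(ℝ, ℝ) ∞ h) (hv : ContDiff ℝ ∞ v)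
    (hF : IsSmoothImmersion I₀ (I.prod 𝓘(ℝ, ℝ)) F) (hN : IsGaussMap I₀ F (cylMetric g) N)
    (hH : ∃ a : ℝ, ∀ p, weightedMeanCurvature I₀ F (cylMetric g) (prodWeight h v) N p = a)
    {a : ℝ} (hangle : ∀ p, angle g F N p = a) (ha : a ≠ 0) (p : S) :
    anglePotential I₀ g h v F N p = 0 := by
  obtain ⟨b, hb⟩ := hH
  have hlaplacian := driftedLaplacian_angle_cylMetric hg hF hN hh hv hb p
  rw [show angle g F N = fun _ => a from funext hangle, driftedLaplacian_const] at hlaplacian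
  exact (mul_eq_zero.1 hlaplacian.symm).resolve_left (neg_ne_zero.2 ha)

variable [hI : HalfSpaceModel I] [hI₀ : HalfSpaceModel I₀]

theorem HasFreeBoundary.mfderiv_angle_cylMetric (hfree : HasFreeBoundary I₀ F (cylMetric g))
    (hg : IsSmoothMetric g) (hF : IsSmoothImmersion I₀ (I.prod 𝓘(ℝ, ℝ)) F)
    (hN : IsGaussMap I₀ F (cylMetric g) N) {p : S} (hp : p ∈ I₀.boundary S) :
    mfderiv I₀ 𝓘(ℝ, ℝ) (angle g F N) p (innerNormal (pullback I₀ F (cylMetric g)) p)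
      = -angle g F N p * bdrySFF (cylMetric g) (F p) (N p) (N p) :=
  hfree.mfderiv_angle hg.cylMetric hF hN (by simp) (isParallelField_vertical hg)
    (map_zero hI.ℓ) ((contMDiff_angle hN).mdifferentiable (by simp) p) hp

theorem bdrySFF_cylMetric_nonneg (hg : IsSmoothMetric g) (hconvex : HasLocallyConvexBoundary g)
    {x : M × ℝ} (hx : x ∈ (I.prod 𝓘(ℝ, ℝ)).boundary (M × ℝ))
    {a : TangentSpace (I.prod 𝓘(ℝ, ℝ)) x} (ha : bdryForm x a = 0) :
    0 ≤ bdrySFF (cylMetric g) x a a := by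
  have hx_base : x.1 ∈ I.boundary M := by
    rw [ModelWithCorners.boundary_of_boundaryless_right] at hx
    exact hx.1
  rw [bdrySFF_nonneg_iff (hg.cylMetric.isInnerForm x) hx, christoffelAt_cylMetric hg]
  exact (bdrySFF_nonneg_iff (hg.isInnerForm x.1) hx_base a.1 a.1).1 (hconvex x.1 hx_base a.1 ha)

theorem HasFreeBoundary.bdrySFF_cylMetric_normal_eq_zero
    (hfree : HasFreeBoundary I₀ F (cylMetric g)) (hg : IsSmoothMetric g)
    (hF : IsSmoothImmersion I₀ (I.prod 𝓘(ℝ, ℝ)) F) (hN : IsGaussMap I₀ F (cylMetric g) N)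
    {a : ℝ} (hangle : ∀ p, angle g F N p = a) (ha : a ≠ 0) {p : S} (hp : p ∈ I₀.boundary S) :
    bdrySFF (cylMetric g) (F p) (N p) (N p) = 0 := by
  have hderiv := hfree.mfderiv_angle_cylMetric hg hF hN hp
  rw [show angle g F N = fun _ => a from funext hangle, mfderiv_const] at hderiv
  exact (mul_eq_zero.1 hderiv.symm).resolve_left (neg_ne_zero.2 ha)

theorem exists_angle_eq_const (hg : IsSmoothMetric g) (hconvex : HasLocallyConvexBoundary g)
    (hh : ContMDiff I 𝓘(ℝ, ℝ) ∞ h) (hv : ContDiff ℝ ∞ v)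
    (hF : IsSmoothImmersion I₀ (I.prod 𝓘(ℝ, ℝ)) F) (hN : IsGaussMap I₀ F (cylMetric g) N)
    (hangle : ∀ p, angle g F N p ≤ 0)
    (hpar : IsWeightedParabolic (pullback I₀ F (cylMetric g)) (prodWeight h v ∘ F))
    (hH : ∃ a : ℝ, ∀ p, weightedMeanCurvature I₀ F (cylMetric g) (prodWeight h v) N p = a)
    (hfree : HasFreeBoundary I₀ F (cylMetric g))
    (hpotential : ∀ p, 0 ≤ anglePotential I₀ g h v F N p) :
    ∃ a : ℝ, ∀ p, angle g F N p = a := by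
  obtain ⟨b, hb⟩ := hH
  refine hpar _ ((contMDiff_angle hN).of_le (by norm_cast))
    ⟨0, forall_mem_range.2 hangle⟩ (fun p _ => ?_) (fun p hp => ?_)
  · rw [driftedLaplacian_angle_cylMetric hg hF hN hh hv hb]
    exact mul_nonneg (neg_nonneg.2 (hangle p)) (hpotential p)
  · rw [hfree.mfderiv_angle_cylMetric hg hF hN hp]
    exact mul_nonneg (neg_nonneg.2 (hangle p))
      (bdrySFF_cylMetric_nonneg hg hconvex (hfree.map_mem_boundary hp)
        (hfree.bdryForm_normal hg.cylMetric.isInnerForm hN hp))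

end Cylinder

end WeightedGeom

end

end

theorem theorem4p2_general {E : Type*} [NormedAddCommGroup E] [NormedSpace ℝ E]
    [FiniteDimensional ℝ E] {H : Type*} [TopologicalSpace H] {I : ModelWithCorners ℝ E H}
    [HalfSpaceModel I] {M : Type*} [TopologicalSpace M] [ChartedSpace H M] [IsManifold I ∞ M]
    {g : BilinField I M} (hg : IsSmoothMetric g) (hconvex : HasLocallyConvexBoundary g)
    {h : M → ℝ} (hh : ContMDiff I 𝓘(ℝ, ℝ) ∞ h) {v : ℝ → ℝ} (hv : ContDiff ℝ ∞ v) {c : ℝ}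
    (hRicv : ∀ (t : ℝ) (w : TangentSpace 𝓘(ℝ, ℝ) t),
      ricciBE lineMetric v t w w ≤ c * lineMetric t w w)
    (hRich : ∀ (x : M) (w : TangentSpace I x), c * g x w w ≤ ricciBE g h x w w)
    {H₀ : Type*} [TopologicalSpace H₀] {I₀ : ModelWithCorners ℝ E H₀} [HalfSpaceModel I₀]
    {S : Type*} [TopologicalSpace S] [ConnectedSpace S] [ChartedSpace H₀ S] [IsManifold I₀ ∞ S]
    {F : S → M × ℝ} (hF : IsSmoothImmersion I₀ (I.prod 𝓘(ℝ, ℝ)) F)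
    {N : ∀ p : S, TangentSpace (I.prod 𝓘(ℝ, ℝ)) (F p)} (hN : IsGaussMap I₀ F (cylMetric g) N)
    (hangle : ∀ p, angle g F N p ≤ 0)
    (hpar : IsWeightedParabolic (pullback I₀ F (cylMetric g)) (prodWeight h v ∘ F))
    (hH : ∃ a : ℝ, ∀ p, weightedMeanCurvature I₀ F (cylMetric g) (prodWeight h v) N p = a)
    (hfree : HasFreeBoundary I₀ F (cylMetric g)) :
    (∃ a : ℝ, ∀ p, angle g F N p = a) ∧
    ((∀ p, angle g F N p = 0) ∨
     (∃ s : ℝ, ∀ p, (F p).2 = s) ∨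
     (IsTotallyGeodesic I₀ F (cylMetric g) N ∧
      (∀ p, ricciBE (cylMetric g) (prodWeight h v) (F p) (N p) (N p) = c ∧
        ricciBE (cylMetric g) (prodWeight h v) (F p) (vertical I (F p)) (vertical I (F p)) = c) ∧
      ∀ p ∈ I₀.boundary S, bdrySFF (cylMetric g) (F p) (N p) (N p) = 0)) := by
  have hv_nonneg := add_deriv_deriv_nonneg (hv.of_le (by norm_cast)) hRicv
  obtain ⟨a, ha⟩ := exists_angle_eq_const hg hconvex hh hv hF hN hangle hpar hH hfree
    (anglePotential_nonneg hg hF hN hv_nonneg hRich)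
  refine ⟨⟨a, ha⟩, ?_⟩
  by_cases ha_zero : a = 0
  · exact .inl fun p => (ha p).trans ha_zero
  by_cases ha_sq : a ^ 2 = 1
  · exact .inr (.inl (exists_snd_eq_const_of_angle_sq_eq_one hg.isInnerForm hF hN
      fun p => (ha p).symm ▸ ha_sq))
  have hequality (p : S) := eq_of_anglePotential_eq_zero hg hF hN hv_nonneg hRich
    (anglePotential_eq_zero_of_angle_eq_const hg hh hv hF hN hH ha ha_zero p)
  have hdd (p : S) : deriv (deriv v) (F p).2 = -c := by
    have hprod := (hequality p).2.2
    rw [ha] at hprod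
    linarith [(mul_eq_zero.1 hprod).resolve_left (sub_ne_zero.2 (Ne.symm ha_sq))]
  refine .inr (.inr ⟨fun p => secondFF_eq_zero_of_secondFFNormSq_eq_zero hg.cylMetric hF hN
    (by simp) (hequality p).1, fun p => ⟨?_, ?_⟩,
    fun p => hfree.bdrySFF_cylMetric_normal_eq_zero hg hF hN ha ha_zero⟩)
  · rw [ricciBE_cylMetric_normal hg hh hv, (hequality p).2.1, hdd]
    ring
  · rw [ricciBE_cylMetric_vertical hg hh hv, hdd, neg_neg]

theorem theorem4p2 (n : ℕ) [NeZero n]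
    -- the base manifold `M`, of dimension `n`, with (possibly empty) locally convex boundary
    (M : Type*) [TopologicalSpace M] [T2Space M] [SecondCountableTopology M]
    [ChartedSpace (EuclideanHalfSpace n) M] [IsManifold (𝓡∂ n) ∞ M]
    (g : Bundle.ContMDiffRiemannianMetric (𝓡∂ n) ∞ (EuclideanSpace ℝ (Fin n))
      (fun x : M => TangentSpace (𝓡∂ n) x))
    (hconvex : HasLocallyConvexBoundary (I := 𝓡∂ n) g.inner)
    -- the product weight `e^{h(p)} e^{v(t)}`, with `Ric_v ≤ c ≤ Ric_h`
    (h : M → ℝ) (hh : ContMDiff (𝓡∂ n) 𝓘(ℝ, ℝ) ∞ h) (v : ℝ → ℝ) (hv : ContDiff ℝ ∞ v) (c : ℝ)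
    (hRicv : ∀ (t : ℝ) (w : TangentSpace 𝓘(ℝ, ℝ) t),
      ricciBE lineMetric v t w w ≤ c * lineMetric t w w)
    (hRich : ∀ (x : M) (w : TangentSpace (𝓡∂ n) x),
      c * g.inner x w w ≤ ricciBE (I := 𝓡∂ n) g.inner h x w w)
    -- the connected two-sided hypersurface `F : S → M × ℝ`, with Gauss map `N` and `θ ≤ 0`
    (S : Type*) [TopologicalSpace S] [T2Space S] [SecondCountableTopology S] [ConnectedSpace S]
    [ChartedSpace (EuclideanHalfSpace n) S] [IsManifold (𝓡∂ n) ∞ S]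
    (F : S → M × ℝ) (hF : IsSmoothImmersion (𝓡∂ n) ((𝓡∂ n).prod 𝓘(ℝ, ℝ)) F)
    (N : ∀ p : S, TangentSpace ((𝓡∂ n).prod 𝓘(ℝ, ℝ)) (F p))
    (hN : IsGaussMap (𝓡∂ n) F (cylMetric (I := 𝓡∂ n) g.inner) N)
    (hθ : ∀ p, angle (I := 𝓡∂ n) g.inner F N p ≤ 0)
    -- it is `ψ`-parabolic, with constant `ψ`-mean curvature and free boundary
    (hpar : IsWeightedParabolic (pullback (𝓡∂ n) F (cylMetric (I := 𝓡∂ n) g.inner))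
      (prodWeight h v ∘ F))
    (hH : ∃ a : ℝ, ∀ p, weightedMeanCurvature (𝓡∂ n) F (cylMetric (I := 𝓡∂ n) g.inner)
      (prodWeight h v) N p = a)
    (hfree : HasFreeBoundary (𝓡∂ n) F (cylMetric (I := 𝓡∂ n) g.inner)) :
    (∃ a : ℝ, ∀ p, angle (I := 𝓡∂ n) g.inner F N p = a) ∧
    ((∀ p, angle (I := 𝓡∂ n) g.inner F N p = 0) ∨
     (∃ s : ℝ, ∀ p, (F p).2 = s) ∨
     (IsTotallyGeodesic (𝓡∂ n) F (cylMetric (I := 𝓡∂ n) g.inner) N ∧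
      (∀ p, ricciBE (cylMetric (I := 𝓡∂ n) g.inner) (prodWeight h v) (F p) (N p) (N p) = c ∧
        ricciBE (cylMetric (I := 𝓡∂ n) g.inner) (prodWeight h v) (F p)
          (vertical (𝓡∂ n) (F p)) (vertical (𝓡∂ n) (F p)) = c) ∧
      ∀ p ∈ (𝓡∂ n).boundary S,
        bdrySFF (cylMetric (I := 𝓡∂ n) g.inner) (F p) (N p) (N p) = 0)) :=
  theorem4p2_general (isSmoothMetric_inner g) hconvex hh hv hRicv hRich hF hN hθ hpar hH hfree
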